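/- Let $V=\mathbb C^2$ and let $G\subseteq \mathrm{SU}_2$ be, up to conjugation in $\mathrm{SU}_2$, one of the following groups: the cyclic group $C_n=\langle g\rangle$ ($3\le n<\infty$), $g=\mathrm{diag}(\zeta^{-1},\zeta)$ with $\zeta$ a primitive $n$th root of unity; the binary dihedral group $D_n=\langle g,h\rangle$ ($2\le n<\infty$), with $\zeta$ a primitive $2n$th root of unity and $h=\begin{pmatrix}0&i\\ i&0\end{pmatrix}$; the binary tetrahedral, octahedral or icosahedral group $T,O,I$; or $C_\infty=\langle g\rangle$, $D_\infty=\langle g,h\rangle$, with $|\zeta|=1$ and $\zeta$ not a root of unity. Put $\ell=\mathrm{br}(G)=0,1,2,3,5,0,1$ and $\mathrm{diam}(G)=\tilde n,n,4,6,7,\infty,\infty$ for $G=C_n,D_n,T,O,I,C_\infty,D_\infty$ respectively, where $\tilde n=n/2$ for $n$ even and $\tilde n=n$ for $n$ odd. For $k\ge 0$ let $Z_k=\mathrm{End}_G(V^{\otimes k})$, let $\Lambda_k$ be the set of isomorphism classes $\nu$ of irreducible $G$-modules $G^\nu$ occurring in $V^{\otimes k}$ ($\Lambda_k=\emptyset$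 for $k<0$), and identify $a\in\mathrm{End}(V^{\otimes k})$ with $a\otimes \mathbf 1\in \mathrm{End}(V^{\otimes (k+1)})$. For $i\ge1$ let $e_i=1-s_i$, where $s_i$ exchanges the tensor positions $i$ and $i+1$, and let $TL_k(2)$ denote the unital subalgebra of $\mathrm{End}(V^{\otimes k})$ generated by $e_1,\dots,e_{k-1}$ (a copy of the Temperley–Lieb algebra). The $e_i$ satisfy (a) $e_i^2=2e_i$, $\ e_ie_{i\pm1}e_i=e_i$, and $e_ie_j=e_je_i$ for $|i-j|>1$. Write $\mathrm{diam}(G)=\ell+m$ ($m\le\infty$), and let $\nu_0,\nu_1,\dots,\nu_m$ (an infinite sequence $\nu_0,\nu_1,\dots$ if $m=\infty$) be a path from the branch node, going away from the trivial node: $\nu_j\in\Lambda_{\ell+j}\setminus\Lambda_{\ell+j-2}$ for all $j$, and $G^{\nu_{j+1}}$ is a summand of $G^{\nu_j}\otimes V$ whenever $j+1\le m$. (In particular $\nu_0$ is the branch node, $G^{\nu_0}=\mathrm{Sym}^\ell V$.) Let $d_j=\dim G^{\nu_j}$. For every $j\ge0$ with $\ell+j\le \mathrm{diam}(G)$, and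 $\ell+j\ne\mathrm{diam}(G)$ if $G=C_n$ or $D_n$ with $n<\infty$, there is exactly one idempotent $b_j\in Z_{\ell+j}$ whose image is isomorphic to $G^{\nu_j}$. Moreover: (i) If $k\le\ell$, then $Z_k=TL_k(2)$; it is generated by the $e_i$ $(1\le i<k)$, which satisfy (a). (ii) If $\ell<k\le\ell+m=\mathrm{diam}(G)$, and $k\neq\mathrm{diam}(G)$ in case $G=C_n$ or $D_n$ with $n<\infty$, then the unital algebra $Z_k$ is generated by the $e_i$ $(1\le i<k)$ and the $b_j$ $(1\le j\le k-\ell)$. With $M=k-\ell$, these satisfy (a) and (b) $b_ib_j=b_j=b_jb_i$ for $0\le i\le j\le M$; (c) $b_{j+1}=b_j-\frac{d_{j-1}}{d_j}\,b_je_{\ell+j}b_j$ for $1\le j\le M-1$; (d) $e_ib_j=0=b_je_i$ for $1\le i<\ell+j$, and $e_ib_j=b_je_i$ for $i>\ell+j$ $(0\le j\le M)$; (e) $e_{\ell+j}b_je_{\ell+j}=\frac{d_j}{d_{j-1}}\,b_{j-1}e_{\ell+j}$ for $1\le j\le M$. (iii) If $k>\mathrm{diam}(G)=\ell+m$ and $G\ne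 C_n,D_n$ for $n<\infty$, then the unital algebra $Z_k$ is generated by the $e_i$ $(1\le i<k)$ and the $b_j$ $(1\le j\le m)$. These satisfy (a), the relations (b)–(e) with $M=m$, and (f) $b_m=\frac{d_{m-1}}{d_m}\,b_me_{\ell+m}b_m$. All relations are read in $\mathrm{End}(V^{\otimes N})$ for any $N\ge k$ large enough that the operators in them are defined. -/

import Mathlib

noncomputable section

namespace McKay

/-! ### The groups -/

/-- The group `SU₂`. -/
abbrev SU2 : Type := Matrix.specialUnitaryGroup (Fin 2) ℂ

/-- The element of `SU₂` with first row `(α, β)` and second row `(-conj β, conj α)`. -/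
def mkSU2 (α β : ℂ) (h : α * star α + β * star β = 1) : SU2 :=
  ⟨!![α, β; -star β, star α], by
    rw [Matrix.mem_specialUnitaryGroup_iff, Matrix.mem_unitaryGroup_iff]
    refine ⟨?_, by rw [Matrix.det_fin_two_of]; linear_combination h⟩
    ext i j
    fin_cases i <;> fin_cases j <;>
      simp [Matrix.mul_apply, Fin.sum_univ_two, Matrix.star_apply] at h ⊢
    · linear_combination h
    · ring
    · ring
    · linear_combination h⟩

/-- The element of `SU₂` that corresponds to the unit quaternion `a + b i + c j + d k`. -/
def quat (a b c d : ℝ) (h : a ^ 2 + b ^ 2 + c ^ 2 + d ^ 2 = 1) : SU2 :=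
  mkSU2 (a + b * Complex.I) (c + d * Complex.I) (by
    apply Complex.ext
    · simp
      linear_combination h
    · simp
      ring)

/-- The diagonal matrix `diag(ζ⁻¹, ζ)`, for `ζ` on the unit circle. -/
def diagElt (ζ : Circle) : SU2 :=
  mkSU2 ((ζ⁻¹ : Circle) : ℂ) 0 (by
    have h := Complex.mul_conj ((ζ⁻¹ : Circle) : ℂ)
    simp only [Circle.normSq_coe, Complex.ofReal_one] at h
    simpa using h)

/-- The quaternion `i`, that is `diag(i, -i)`. -/
def quatI : SU2 := quat 0 1 0 0 (by norm_num)

/-- The quaternion `k`, that is the matrix with rows `(0, i)` and `(i, 0)`. -/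
def quatK : SU2 := quat 0 0 0 1 (by norm_num)

/-- The quaternion `(1 + i + j + k) / 2`, of order six. -/
def quatOmega : SU2 := quat (1 / 2) (1 / 2) (1 / 2) (1 / 2) (by norm_num)

/-- The quaternion `(1 + i) / √2`, of order eight. -/
def quatOct : SU2 := quat (1 / √2) (1 / √2) 0 0 (by
  rw [div_pow, Real.sq_sqrt (by norm_num)]
  norm_num)

/-- The quaternion `(φ + φ⁻¹ i + j) / 2`, of order ten, with `φ` the golden ratio. -/
def quatIcos : SU2 :=
  quat (Real.goldenRatio / 2) (Real.goldenRatio⁻¹ / 2) (1 / 2) 0 (by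
    rw [Real.inv_goldenRatio]
    have h1 := Real.goldenRatio_sq
    have h2 := Real.goldenConj_sq
    have h3 := Real.goldenRatio_add_goldenConj
    linear_combination (1 / 4) * h1 + (1 / 4) * h2 + (1 / 4) * h3)

/-- The types of groups under consideration: the cyclic groups `C_n`, the binary dihedral groups
`D_n`, the binary tetrahedral, octahedral and icosahedral groups, `C_∞` and `D_∞`. -/
inductive GroupType : Type
  | cyclic (n : ℕ)
  | dihedral (n : ℕ)
  | tetrahedral
  | octahedral
  | icosahedral
  | cyclicInf
  | dihedralInf

/-- The standard subgroups of `SU₂` of each type. -/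
def IsStandard : GroupType → Subgroup SU2 → Prop
  | .cyclic n, S => 3 ≤ n ∧ ∃ ζ : Circle, IsPrimitiveRoot ζ n ∧
      S = Subgroup.closure {diagElt ζ}
  | .dihedral n, S => 2 ≤ n ∧ ∃ ζ : Circle, IsPrimitiveRoot ζ (2 * n) ∧
      S = Subgroup.closure {diagElt ζ, quatK}
  | .tetrahedral, S => S = Subgroup.closure {quatI, quatOmega}
  | .octahedral, S => S = Subgroup.closure {quatOct, quatOmega}
  | .icosahedral, S => S = Subgroup.closure {quatIcos, quatOmega}
  | .cyclicInf, S => ∃ ζ : Circle, (∀ n : ℕ, 0 < n → ζ ^ n ≠ 1) ∧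
      S = Subgroup.closure {diagElt ζ}
  | .dihedralInf, S => ∃ ζ : Circle, (∀ n : ℕ, 0 < n → ζ ^ n ≠ 1) ∧
      S = Subgroup.closure {diagElt ζ, quatK}

/-- `G` is conjugate in `SU₂` to a standard subgroup of type `t`. -/
def IsOfType (t : GroupType) (G : Subgroup SU2) : Prop :=
  ∃ (S : Subgroup SU2) (u : SU2), IsStandard t S ∧ G = S.map (MulAut.conj u).toMonoidHom

/-- The branch node `br(G)` of the representation graph. -/
def br : GroupType → ℕ
  | .cyclic _ => 0
  | .dihedral _ => 1
  | .tetrahedral => 2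
  | .octahedral => 3
  | .icosahedral => 5
  | .cyclicInf => 0
  | .dihedralInf => 1

/-- The diameter `diam(G)` of the representation graph (by convention `n / 2` or `n` for `C_n`,
according to the parity of `n`). -/
def diam : GroupType → ℕ∞
  | .cyclic n => if Even n then ((n / 2 : ℕ) : ℕ∞) else (n : ℕ∞)
  | .dihedral n => (n : ℕ∞)
  | .tetrahedral => 4
  | .octahedral => 6
  | .icosahedral => 7
  | .cyclicInf => ⊤
  | .dihedralInf => ⊤

/-- The type is `C_n` or `D_n` with `n` finite. -/
def IsFiniteCD : GroupType → Prop
  | .cyclic _ => True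
  | .dihedral _ => True
  | _ => False

/-! ### Tensor powers of the natural module `V = ℂ²`

`V^{⊗k}` is the space with basis `v_r`, `r ∈ {-1, 1}^k`, i.e. the space of functions
`(Fin k → Fin 2) → ℂ` (the index `0 : Fin 2` stands for `-1` and `1 : Fin 2` for `1`, so
`v_{-1} = (1, 0)ᵗ` and `v_1 = (0, 1)ᵗ`), and `End(V^{⊗k})` is the algebra of matrices with rows
and columns indexed by `Fin k → Fin 2`. -/

/-- `End(V^{⊗k})`, as matrices with respect to the basis of simple tensors `v_r`. -/
abbrev TensorEnd (k : ℕ) : Type := Matrix (Fin k → Fin 2) (Fin k → Fin 2) ℂ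

/-- The matrix of `g^{⊗k} : v_{s_1} ⊗ ⋯ ⊗ v_{s_k} ↦ g v_{s_1} ⊗ ⋯ ⊗ g v_{s_k}`. -/
def tensorPow (g : Matrix (Fin 2) (Fin 2) ℂ) (k : ℕ) : TensorEnd k :=
  Matrix.of fun r s => ∏ i, g (r i) (s i)

lemma tensorPow_one (k : ℕ) : tensorPow 1 k = 1 := by
  ext r s
  simp only [tensorPow, Matrix.of_apply, Matrix.one_apply]
  by_cases h : r = s
  · subst h
    simp
  · rw [if_neg h]
    obtain ⟨i, hi⟩ := Function.ne_iff.mp h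
    exact Finset.prod_eq_zero (Finset.mem_univ i) (by simp [hi])

lemma tensorPow_mul (g h : Matrix (Fin 2) (Fin 2) ℂ) (k : ℕ) :
    tensorPow (g * h) k = tensorPow g k * tensorPow h k := by
  ext r s
  simp only [tensorPow, Matrix.of_apply, Matrix.mul_apply, ← Finset.prod_mul_distrib]
  rw [Finset.prod_univ_sum, Fintype.piFinset_univ]

/-- The natural representation of `G` on `V = ℂ²`. -/
def natRep (G : Subgroup SU2) : Representation ℂ G (Fin 2 → ℂ) where
  toFun g := Matrix.toLin' (g : SU2).1
  map_one' := by simp [Module.End.one_eq_id]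
  map_mul' g h := by simp [Matrix.toLin'_mul, Module.End.mul_eq_comp]

/-- The diagonal action of `G` on `V^{⊗k}`; it is trivial for `k = 0`. -/
def tensorRep (G : Subgroup SU2) (k : ℕ) : Representation ℂ G ((Fin k → Fin 2) → ℂ) where
  toFun g := Matrix.toLin' (tensorPow (g : SU2).1 k)
  map_one' := by simp [tensorPow_one, Module.End.one_eq_id]
  map_mul' g h := by simp [tensorPow_mul, Matrix.toLin'_mul, Module.End.mul_eq_comp]

/-- The centralizer algebra `Z_k(G) = End_G(V^{⊗k})`. -/
def centralizerAlg (G : Subgroup SU2) (k : ℕ) : Subalgebra ℂ (TensorEnd k) :=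
  Subalgebra.centralizer ℂ (Set.range fun g : G => tensorPow (g : SU2).1 k)

/-- The embedding `a ↦ a ⊗ 1 ⊗ ⋯ ⊗ 1` of `End(V^{⊗p})` into `End(V^{⊗N})`, for `p ≤ N`
(and `0`, never used, for `p > N`). -/
def embed (p N : ℕ) (a : TensorEnd p) : TensorEnd N :=
  if h : p ≤ N then
    Matrix.of fun r s =>
      if ∀ i : Fin N, p ≤ i.val → r i = s i then
        a (fun i => r (Fin.castLE h i)) (fun i => s (Fin.castLE h i))
      else 0
  else 0

/-- The operator `e_i = 1 - s_i` on `V^{⊗N}`, for `1 ≤ i < N`, where `s_i` exchanges the tensor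
positions `i` and `i + 1` (positions are counted from `1`; they are the elements `i - 1` and `i`
of `Fin N`). It is `0`, never used, for other `i`. -/
def tl (N i : ℕ) : TensorEnd N :=
  if h : 1 ≤ i ∧ i < N then
    1 - Matrix.of fun r s =>
      if r = s ∘ Equiv.swap (⟨i - 1, by omega⟩ : Fin N) ⟨i, h.2⟩ then 1 else 0
  else 0

/-- The Temperley–Lieb algebra `TL_k(2)`, identified with the (unital) subalgebra of
`End(V^{⊗k})` generated by `e_1, …, e_{k-1}`. -/
def temperleyLieb (k : ℕ) : Subalgebra ℂ (TensorEnd k) :=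
  Algebra.adjoin ℂ {x | ∃ i, 1 ≤ i ∧ i < k ∧ x = tl k i}

/-! ### The nodes of the representation graph -/

/-- The irreducible finite-dimensional complex representations of `G`. -/
structure Irrep (G : Subgroup SU2) where
  /-- the dimension -/
  dim : ℕ
  /-- the action on `ℂ^dim` -/
  rep : Representation ℂ G (Fin dim → ℂ)
  irreducible : rep.IsIrreducible

/-- `σ` contains a subrepresentation isomorphic to `ρ`. -/
def OccursIn {G : Subgroup SU2} {W U : Type} [AddCommGroup W] [Module ℂ W] [AddCommGroup U]
    [Module ℂ U] (ρ : Representation ℂ G W) (σ : Representation ℂ G U) : Prop :=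
  ∃ f : Representation.IntertwiningMap ρ σ, Function.Injective f

/-- `ν ∈ Λ_k(G)`: the irreducible module `G^ν` occurs in `V^{⊗k}`. -/
def InLevel {G : Subgroup SU2} (ν : Irrep G) (k : ℕ) : Prop :=
  OccursIn ν.rep (tensorRep G k)

/-- `ν ∈ Λ_k(G) \ Λ_{k-2}(G)` (where `Λ_k(G)` is empty for `k < 0`), that is, `G^ν` is a summand
of `V_new^{⊗k}`. -/
def IsNew {G : Subgroup SU2} (ν : Irrep G) (k : ℕ) : Prop :=
  InLevel ν k ∧ ∀ p, p + 2 = k → ¬ InLevel ν p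

/-- There is an edge from `μ` to `ν` in the representation graph: `G^ν` occurs in `G^μ ⊗ V`. -/
def Edge {G : Subgroup SU2} (μ ν : Irrep G) : Prop :=
  OccursIn ν.rep (μ.rep.tprod (natRep G))

/-- `ν_0, ν_1, …, ν_m` (with `ℓ + m = diam(G)`; an infinite sequence if `diam(G) = ∞`) is a path
in the representation graph that starts at the branch node, the only label in
`Λ_ℓ(G) \ Λ_{ℓ-2}(G)`, and moves away from the trivial node at each step. -/
structure IsBranchPath (t : GroupType) {G : Subgroup SU2} (ν : ℕ → Irrep G) : Prop where
  new : ∀ j : ℕ, ((br t + j : ℕ) : ℕ∞) ≤ diam t → IsNew (ν j) (br t + j)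
  edge : ∀ j : ℕ, ((br t + (j + 1) : ℕ) : ℕ∞) ≤ diam t → Edge (ν j) (ν (j + 1))

/-- `b ∈ Z_k(G)` is a projection of `V^{⊗k}` onto a submodule isomorphic to `G^ν`. -/
structure IsProjectionOnto {G : Subgroup SU2} (ν : Irrep G) (k : ℕ) (b : TensorEnd k) :
    Prop where
  mem : b ∈ centralizerAlg G k
  idem : b * b = b
  range : ∃ f : Representation.IntertwiningMap ν.rep (tensorRep G k),
    Function.Injective f ∧ LinearMap.range f.toLinearMap = LinearMap.range (Matrix.toLin' b)

/-- `k ≤ diam(G)`, and `k ≠ diam(G)` if `G` is `C_n` or `D_n` with `n` finite. -/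
def InRange (t : GroupType) (k : ℕ) : Prop :=
  (k : ℕ∞) ≤ diam t ∧ (IsFiniteCD t → (k : ℕ∞) ≠ diam t)

/-! ### The relations -/

/-- The relations (a): the Temperley–Lieb relations for `e_1, …, e_{N-1}` in `End(V^{⊗N})`. -/
structure RelA (N : ℕ) : Prop where
  sq : ∀ i, 1 ≤ i → i < N → tl N i * tl N i = 2 • tl N i
  braid_succ : ∀ i, 1 ≤ i → i + 1 < N → tl N i * tl N (i + 1) * tl N i = tl N i
  braid_pred : ∀ i, 1 ≤ i → i + 1 < N → tl N (i + 1) * tl N i * tl N (i + 1) = tl N (i + 1)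
  comm : ∀ i j, 1 ≤ i → i + 1 < j → j < N → tl N i * tl N j = tl N j * tl N i

/-- The relations (b)–(e) in `End(V^{⊗N})` for the elements `b_0, …, b_M`, where
`b_j ∈ End(V^{⊗(ℓ+j)})` is viewed in `End(V^{⊗N})`, and the numbers `d_0, …, d_M`. -/
structure RelBE (ℓ N M : ℕ) (d : ℕ → ℕ) (b : (j : ℕ) → TensorEnd (ℓ + j)) : Prop where
  rel_b : ∀ i j, i ≤ j → j ≤ M →
    embed (ℓ + i) N (b i) * embed (ℓ + j) N (b j) = embed (ℓ + j) N (b j) ∧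
    embed (ℓ + j) N (b j) * embed (ℓ + i) N (b i) = embed (ℓ + j) N (b j)
  rel_c : ∀ j, 1 ≤ j → j + 1 ≤ M →
    embed (ℓ + (j + 1)) N (b (j + 1)) = embed (ℓ + j) N (b j) -
      ((d (j - 1) : ℂ) / (d j : ℂ)) •
        (embed (ℓ + j) N (b j) * tl N (ℓ + j) * embed (ℓ + j) N (b j))
  rel_d_zero : ∀ i j, j ≤ M → 1 ≤ i → i < ℓ + j →
    tl N i * embed (ℓ + j) N (b j) = 0 ∧ embed (ℓ + j) N (b j) * tl N i = 0
  rel_d_comm : ∀ i j, j ≤ M → ℓ + j < i → i < N →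
    tl N i * embed (ℓ + j) N (b j) = embed (ℓ + j) N (b j) * tl N i
  rel_e : ∀ j, 1 ≤ j → j ≤ M → ℓ + j < N →
    tl N (ℓ + j) * embed (ℓ + j) N (b j) * tl N (ℓ + j) =
      ((d j : ℂ) / (d (j - 1) : ℂ)) • (embed (ℓ + (j - 1)) N (b (j - 1)) * tl N (ℓ + j))

/-- The unital subalgebra of `End(V^{⊗k})` generated by `e_i`, `1 ≤ i < k`, and `b_j`,
`1 ≤ j ≤ M`. -/
def generatedAlg (ℓ k M : ℕ) (b : (j : ℕ) → TensorEnd (ℓ + j)) : Subalgebra ℂ (TensorEnd k) :=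
  Algebra.adjoin ℂ ({x | ∃ i, 1 ≤ i ∧ i < k ∧ x = tl k i} ∪
    {x | ∃ j, 1 ≤ j ∧ j ≤ M ∧ x = embed (ℓ + j) k (b j)})

end McKay

end

/-! Call an endomorphism of V^{⊗k} old if it is a combination of maps x e_{k-1} y with x, y in Z_k,
that is, if it factors through V^{⊗(k-2)}. Since e_{k-1} is the rank-one operator made from the
invariant antisymmetric tensor, a strand can be bent: x e_{k-1} = (x' ⊗ 1) e_{k-1} with x' in
Z_{k-1} (`mul_topE_eq`). Hence the old ideal lies in the algebra generated by Z_{k-1} and e_{k-1},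
and only the quotient of Z_k by it has to be controlled. This is the task of a `Fam`: orthogonal
idempotents c_i, minimal or zero and pairwise inequivalent, killed by the old ideal and with sum 1
modulo it. The quotient is then spanned by the c_i. Every projection onto an irreducible module that
is new at level k is one of the c_i (`Fam.exists_projection`), which gives existence and uniqueness
of b_j. If there are at most two c_i, then Z_{k-1}, e_{k-1} and one of them generate Z_k
(`Fam.centralizerAlg_le`).

The passage from one level to the next is a recursion of Jones–Wenzl type. If p is a minimal
idempotent and c ≤ p ⊗ 1, Schur's lemma gives e (c ⊗ 1) e = (tr c / tr p) (p ⊗ 1 ⊗ 1) e. Therefore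
`child c p`, which is c ⊗ 1 minus (tr p / tr c) c e c, is an idempotent killed by e, of trace 2 tr c
- tr p: the module of c tensored with V, with one copy of the parent removed. The children of a
`Fam` again have all the properties of a `Fam` except minimality and inequivalence
(`Fam.preFam_child`). Traces of idempotents are dimensions, so along the path relation (e) is the
displayed identity. Relation (c) says that b_{j+2} is the child of b_{j+1}, which follows from d_j +
d_{j+2} = 2 d_{j+1}. Relation (f) says that b_m has the child 0, because 2 d_m = d_{m-1}. At such an
end 1 is old, so no generators besides the e_i are needed beyond it.

What is left is minimality, and here the types differ. Up to the branch node the idempotent is the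
symmetrizer `jw k`, and an endomorphism of Sym^k V is, modulo scalars, an invariant binary form of
degree 2k (`exists_harmonic`, `formInv_polyCoeff`). For T, O, I there are no nonzero invariant forms
in the degrees 2, 4, …, 2ℓ, and a line of them in degree 2(ℓ+1) = 6, 8, 12. So Sym^{ℓ+1} V is the
sum of two inequivalent irreducible modules (`exists_fam_two`), and from there on integrality and
positivity of traces settle everything. For the cyclic and binary dihedral groups the new modules
are cut out by v_{-1}^{⊗k} and v_1^{⊗k}, whose weights differ from all other weights of V^{⊗k} in
the range considered; the one exception is an additional one-dimensional module in V^{⊗2} for the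
dihedral groups. -/

noncomputable section

namespace McKay

/-! ### Matrix entries in terms of the last tensor positions -/

/-- The index `r` followed by the letter `a`. -/
def snoc {k : ℕ} (r : Fin k → Fin 2) (a : Fin 2) : Fin (k + 1) → Fin 2 :=
  Fin.snoc (α := fun _ => Fin 2) r a

lemma snoc_castSucc {k : ℕ} (r : Fin k → Fin 2) (a : Fin 2) (i : Fin k) :
    snoc r a i.castSucc = r i := by simp [snoc]

lemma snoc_last {k : ℕ} (r : Fin k → Fin 2) (a : Fin 2) : snoc r a (Fin.last k) = a := by
  simp [snoc]

lemma exists_snoc {k : ℕ} (r : Fin (k + 1) → Fin 2) : ∃ r' a, r = snoc r' a :=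
  ⟨fun i => r i.castSucc, r (Fin.last k), by simp only [snoc]; exact (Fin.snoc_init_self r).symm⟩

lemma snoc_inj {k : ℕ} {r s : Fin k → Fin 2} {a b : Fin 2} :
    snoc r a = snoc s b ↔ r = s ∧ a = b := by
  constructor
  · intro h
    refine ⟨funext fun i => ?_, ?_⟩
    · rw [← snoc_castSucc r a, h, snoc_castSucc]
    · rw [← snoc_last r a, h, snoc_last]
  · rintro ⟨rfl, rfl⟩
    rfl

lemma sum_snoc {k : ℕ} {M : Type*} [AddCommMonoid M] (f : (Fin (k + 1) → Fin 2) → M) :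
    ∑ r, f r = ∑ r, ∑ a, f (snoc r a) := by
  rw [← Fintype.sum_prod_type']
  symm
  refine Fintype.sum_equiv (Equiv.ofBijective
    (fun p : (Fin k → Fin 2) × Fin 2 => snoc p.1 p.2) ⟨?_, ?_⟩) _ _ (fun _ => rfl)
  · rintro ⟨r, a⟩ ⟨s, b⟩ h
    obtain ⟨h1, h2⟩ := snoc_inj.mp h
    exact Prod.ext h1 h2
  · intro r
    obtain ⟨r', a, h⟩ := exists_snoc r
    exact ⟨(r', a), h.symm⟩

lemma ext_snoc {k : ℕ} {x y : TensorEnd (k + 1)}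
    (h : ∀ r a s b, x (snoc r a) (snoc s b) = y (snoc r a) (snoc s b)) : x = y := by
  ext r s
  obtain ⟨r, a, rfl⟩ := exists_snoc r
  obtain ⟨s, b, rfl⟩ := exists_snoc s
  exact h r a s b

lemma tensorPow_snoc (g : Matrix (Fin 2) (Fin 2) ℂ) {k : ℕ} (r s : Fin k → Fin 2) (a b : Fin 2) :
    tensorPow g (k + 1) (snoc r a) (snoc s b) = tensorPow g k r s * g a b := by
  simp [tensorPow, Fin.prod_univ_castSucc, snoc_castSucc, snoc_last]

/-! ### The embeddings -/

lemma embed_apply {p N : ℕ} (h : p ≤ N) (a : TensorEnd p) (r s : Fin N → Fin 2) :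
    embed p N a r s = if ∀ i : Fin N, p ≤ i.val → r i = s i then
        a (fun i => r (Fin.castLE h i)) (fun i => s (Fin.castLE h i)) else 0 := by
  simp [embed, h]

lemma embed_snoc {k : ℕ} (x : TensorEnd k) (r s : Fin k → Fin 2) (a b : Fin 2) :
    embed k (k + 1) x (snoc r a) (snoc s b) = if a = b then x r s else 0 := by
  rw [embed_apply (Nat.le_succ k)]
  have h : (∀ i : Fin (k + 1), k ≤ i.val → snoc r a i = snoc s b i) ↔ a = b := by
    constructor
    · intro h
      simpa [snoc_last] using h (Fin.last k) (by simp)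
    · rintro rfl i hi
      obtain rfl : i = Fin.last k := Fin.ext (by have := i.2; simp; omega)
      simp [snoc_last]
  simp only [h]
  congr 2 <;> (ext i; exact congrArg _ (snoc_castSucc _ _ i))

lemma embed_self (p : ℕ) (a : TensorEnd p) : embed p p a = a := by
  ext r s
  rw [embed_apply le_rfl, if_pos (fun i hi => absurd i.2 (by omega))]
  rfl

lemma embed_trans {p q N : ℕ} (h : p ≤ q) (h' : q ≤ N) (a : TensorEnd p) :
    embed q N (embed p q a) = embed p N a := by
  ext r s
  rw [embed_apply h', embed_apply h, embed_apply (h.trans h')]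
  by_cases h1 : ∀ i : Fin N, p ≤ i.val → r i = s i
  · rw [if_pos h1, if_pos (fun i hi => h1 i (h.trans hi)), if_pos (fun i hi => h1 _ (by simpa))]
    rfl
  · rw [if_neg h1]
    by_cases h2 : ∀ i : Fin N, q ≤ i.val → r i = s i
    · rw [if_pos h2, if_neg]
      contrapose! h1
      intro i hi
      by_cases h3 : q ≤ i.val
      · exact h2 i h3
      · exact h1 ⟨i.val, by omega⟩ hi
    · rw [if_neg h2]

lemma embed_succ_mul {k : ℕ} (x y : TensorEnd k) :
    embed k (k + 1) (x * y) = embed k (k + 1) x * embed k (k + 1) y := by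
  refine ext_snoc fun r a s b => ?_
  rw [embed_snoc, Matrix.mul_apply (M := embed k (k + 1) x), sum_snoc]
  simp only [embed_snoc, ite_mul, zero_mul, mul_ite, mul_zero, Matrix.mul_apply]
  split_ifs with h <;> simp [h]

lemma embed_one {p N : ℕ} (h : p ≤ N) : embed p N 1 = 1 := by
  ext r s
  rw [embed_apply h]
  by_cases h1 : r = s
  · subst h1; simp
  · rw [Matrix.one_apply_ne h1]
    split_ifs with h2
    · refine Matrix.one_apply_ne fun h3 => h1 (funext fun i => ?_)
      by_cases h4 : p ≤ i.val
      · exact h2 i h4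
      · exact congrFun h3 ⟨i.val, by omega⟩
    · rfl

lemma embed_mul {p N : ℕ} (h : p ≤ N) (x y : TensorEnd p) :
    embed p N (x * y) = embed p N x * embed p N y := by
  induction N, h using Nat.le_induction with
  | base => simp [embed_self]
  | succ N h ih =>
    rw [← embed_trans h (Nat.le_succ N), ih, embed_succ_mul, embed_trans h (Nat.le_succ N),
      embed_trans h (Nat.le_succ N)]

/-- The embedding `a ↦ a ⊗ 1 ⊗ ⋯ ⊗ 1` as a homomorphism of algebras. -/
def embedHom {p N : ℕ} (h : p ≤ N) : TensorEnd p →ₐ[ℂ] TensorEnd N where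
  toFun := embed p N
  map_one' := embed_one h
  map_mul' := embed_mul h
  map_zero' := by ext; simp [embed_apply h]
  map_add' x y := by ext; simp only [embed_apply h, Matrix.add_apply]; split_ifs <;> simp
  commutes' c := by
    rw [Algebra.algebraMap_eq_smul_one, Algebra.algebraMap_eq_smul_one, ← embed_one h]
    ext; simp only [embed_apply h, Matrix.smul_apply]; split_ifs <;> simp

/-- The embedding `a ↦ a ⊗ 1` of `End(V^{⊗k})` into `End(V^{⊗(k+1)})`. -/
abbrev ext1 (k : ℕ) : TensorEnd k →ₐ[ℂ] TensorEnd (k + 1) := embedHom (Nat.le_succ k)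

lemma embedHom_apply {p N : ℕ} (h : p ≤ N) (x : TensorEnd p) : embedHom h x = embed p N x := rfl

lemma ext1_snoc {k : ℕ} (x : TensorEnd k) (r s : Fin k → Fin 2) (a b : Fin 2) :
    ext1 k x (snoc r a) (snoc s b) = if a = b then x r s else 0 := embed_snoc x r s a b

lemma ext1_injective (k : ℕ) : Function.Injective (ext1 k) := by
  intro x y h
  ext r s
  simpa [ext1_snoc] using congrFun (congrFun h (snoc r 0)) (snoc s 0)

lemma embedHom_trans {p q N : ℕ} (h : p ≤ q) (h' : q ≤ N) (a : TensorEnd p) :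
    embedHom h' (embedHom h a) = embedHom (h.trans h') a := embed_trans h h' a

lemma trace_snoc {k : ℕ} (x : TensorEnd (k + 1)) :
    x.trace = ∑ r, ∑ a, x (snoc r a) (snoc r a) := by
  rw [Matrix.trace, sum_snoc]; rfl

lemma trace_ext1 {k : ℕ} (x : TensorEnd k) : (ext1 k x).trace = 2 * x.trace := by
  rw [trace_snoc, Matrix.trace, Finset.mul_sum]
  simp [ext1_snoc, two_mul]

lemma conjTranspose_ext1 {k : ℕ} (x : TensorEnd k) :
    (ext1 k x).conjTranspose = ext1 k x.conjTranspose := by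
  refine ext_snoc fun r a s b => ?_
  rw [Matrix.conjTranspose_apply, ext1_snoc, ext1_snoc]
  simp only [eq_comm (a := b)]
  split_ifs <;> simp

/-! ### The operator `e` on the last two tensor positions -/

/-- The coefficients of the invariant antisymmetric tensor. -/
def asym : Fin 2 → Fin 2 → ℂ := ![![0, 1], ![-1, 0]]

/-- The operator `e` on the last two positions of `V^{⊗(k+2)}`. -/
abbrev topE (k : ℕ) : TensorEnd (k + 2) := tl (k + 2) (k + 1)

/-- On V ⊗ V the operator 1 - s has rank one: it is the antisymmetric tensor times its own
transpose. All identities for `topE` below come from this factorization. -/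
lemma topE_snoc {k : ℕ} (r s : Fin k → Fin 2) (a b c d : Fin 2) :
    topE k (snoc (snoc r a) b) (snoc (snoc s c) d) =
      if r = s then asym a b * asym c d else 0 := by
  have hsw : (snoc (snoc s c) d) ∘ Equiv.swap (⟨k, by omega⟩ : Fin (k + 2)) ⟨k + 1, by omega⟩ =
      snoc (snoc s d) c := by
    funext i
    refine Fin.lastCases ?_ (fun i => ?_) i
    · rw [snoc_last, Function.comp, show Fin.last (k + 1) = ⟨k + 1, by omega⟩ from rfl,
        Equiv.swap_apply_right,
        show (⟨k, by omega⟩ : Fin (k + 2)) = (Fin.last k).castSucc from rfl, snoc_castSucc,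
        snoc_last]
    · refine Fin.lastCases ?_ (fun i => ?_) i
      · rw [snoc_castSucc, snoc_last, Function.comp,
          show (Fin.last k).castSucc = (⟨k, by omega⟩ : Fin (k + 2)) from rfl,
          Equiv.swap_apply_left, show (⟨k + 1, by omega⟩ : Fin (k + 2)) = Fin.last _ from rfl,
          snoc_last]
      · have := i.2
        rw [Function.comp, Equiv.swap_apply_of_ne_of_ne, snoc_castSucc, snoc_castSucc,
          snoc_castSucc, snoc_castSucc]
        · exact fun h => by have := congrArg Fin.val h; simp at this; omega
        · exact fun h => by have := congrArg Fin.val h; simp at this; omega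
  have h1 : 1 ≤ k + 1 ∧ k + 1 < k + 2 := by omega
  rw [topE, tl, dif_pos h1]
  simp only [Nat.add_sub_cancel, Matrix.sub_apply, Matrix.of_apply, hsw, Matrix.one_apply,
    snoc_inj]
  by_cases hrs : r = s
  · simp only [hrs, true_and, if_true]
    fin_cases a <;> fin_cases b <;> fin_cases c <;> fin_cases d <;> simp [asym]
  · simp [hrs]

lemma asym_sum_right (a b : Fin 2) : ∑ c, asym a c * asym b c = if a = b then 1 else 0 := by
  fin_cases a <;> fin_cases b <;> simp [asym]

/-- The entries of `x e`. -/
lemma mul_topE_snoc {k : ℕ} (x : TensorEnd (k + 2)) (t : Fin (k + 2) → Fin 2)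
    (s : Fin k → Fin 2) (c d : Fin 2) :
    (x * topE k) t (snoc (snoc s c) d) =
      (∑ a, ∑ b, x t (snoc (snoc s a) b) * asym a b) * asym c d := by
  rw [Matrix.mul_apply, sum_snoc, sum_snoc]
  simp only [topE_snoc, mul_ite, mul_zero, Fin.sum_univ_two, ite_add_ite, add_zero]
  rw [Finset.sum_ite_eq' Finset.univ s]
  simp only [Finset.mem_univ, if_true]
  ring

/-- The entries of `e x`. -/
lemma topE_mul_snoc {k : ℕ} (x : TensorEnd (k + 2)) (t : Fin (k + 2) → Fin 2)
    (s : Fin k → Fin 2) (c d : Fin 2) :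
    (topE k * x) (snoc (snoc s c) d) t =
      asym c d * ∑ a, ∑ b, asym a b * x (snoc (snoc s a) b) t := by
  rw [Matrix.mul_apply, sum_snoc, sum_snoc]
  simp only [topE_snoc, ite_mul, zero_mul, Fin.sum_univ_two, ite_add_ite, add_zero]
  rw [Finset.sum_ite_eq Finset.univ s]
  simp only [Finset.mem_univ, if_true]
  ring

lemma conjTranspose_topE (k : ℕ) : (topE k).conjTranspose = topE k := by
  refine ext_snoc fun r a s b => ?_
  obtain ⟨r, a', rfl⟩ := exists_snoc r
  obtain ⟨s, b', rfl⟩ := exists_snoc s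
  rw [Matrix.conjTranspose_apply, topE_snoc, topE_snoc]
  by_cases h : r = s
  · subst h
    fin_cases a <;> fin_cases b <;> fin_cases a' <;> fin_cases b' <;> simp [asym]
  · simp [h, Ne.symm h]

/-- The trace over the last tensor position. -/
def ptr {k : ℕ} (x : TensorEnd (k + 1)) : TensorEnd k :=
  Matrix.of fun r s => ∑ a, x (snoc r a) (snoc s a)

lemma ptr_apply {k : ℕ} (x : TensorEnd (k + 1)) (r s : Fin k → Fin 2) :
    ptr x r s = ∑ a, x (snoc r a) (snoc s a) := rfl

lemma trace_ptr {k : ℕ} (x : TensorEnd (k + 1)) : (ptr x).trace = x.trace := by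
  rw [trace_snoc]; rfl

lemma ptr_ext1_mul {k : ℕ} (p : TensorEnd k) (x : TensorEnd (k + 1)) :
    ptr (ext1 k p * x) = p * ptr x := by
  ext r s
  simp only [ptr_apply, Matrix.mul_apply, sum_snoc, ext1_snoc, ite_mul, zero_mul,
    Finset.sum_ite_eq, Finset.mem_univ, if_true, Finset.mul_sum]
  exact Finset.sum_comm

lemma ptr_mul_ext1 {k : ℕ} (p : TensorEnd k) (x : TensorEnd (k + 1)) :
    ptr (x * ext1 k p) = ptr x * p := by
  ext r s
  simp only [ptr_apply, Matrix.mul_apply, sum_snoc, ext1_snoc, mul_ite, mul_zero,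
    Finset.sum_ite_eq', Finset.mem_univ, if_true, Finset.sum_mul]
  exact Finset.sum_comm

/-- In diagrams: the cup and the cap of the two outer e's close the last strand of x into a loop,
which is the partial trace. -/
lemma topE_mul_ext1_mul_topE {k : ℕ} (x : TensorEnd (k + 1)) :
    topE k * ext1 (k + 1) x * topE k = ext1 (k + 1) (ext1 k (ptr x)) * topE k := by
  refine ext_snoc fun r b s d => ?_
  obtain ⟨r, a, rfl⟩ := exists_snoc r
  obtain ⟨s, c, rfl⟩ := exists_snoc s
  rw [mul_topE_snoc, mul_topE_snoc]
  congr 1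
  simp only [topE_mul_snoc, ext1_snoc, ptr_apply]
  simp [Fin.sum_univ_two]
  fin_cases a <;> fin_cases b <;> simp [asym] <;> ring

/-- Frobenius reciprocity. Since e factors through V^{⊗k}, the product x e is a map V^{⊗k} →
V^{⊗(k+2)} followed by a fixed cap, and bending one strand turns that map into an endomorphism of
V^{⊗(k+1)}. This keeps the old ideal within reach of the previous level. -/
lemma mul_topE_eq {k : ℕ} (x : TensorEnd (k + 2)) :
    x * topE k = ext1 (k + 1) (ptr (x * topE k)) * topE k := by
  refine ext_snoc fun r b s d => ?_
  obtain ⟨s, c, rfl⟩ := exists_snoc s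
  rw [mul_topE_snoc _ _ s, mul_topE_snoc _ _ s]
  congr 1
  simp only [ext1_snoc, ptr_apply, mul_topE_snoc]
  simp [Fin.sum_univ_two]
  fin_cases b <;> simp [asym]

lemma topE_mul_eq {k : ℕ} (x : TensorEnd (k + 2)) :
    topE k * x = topE k * ext1 (k + 1) (ptr (topE k * x)) := by
  refine ext_snoc fun r b s d => ?_
  obtain ⟨r, a, rfl⟩ := exists_snoc r
  rw [topE_mul_snoc, topE_mul_snoc]
  congr 1
  simp only [ext1_snoc, ptr_apply, topE_mul_snoc]
  simp [Fin.sum_univ_two]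
  fin_cases d <;> simp [asym]

lemma topE_comm {k : ℕ} (x : TensorEnd k) :
    topE k * ext1 (k + 1) (ext1 k x) = ext1 (k + 1) (ext1 k x) * topE k := by
  refine ext_snoc fun r b s d => ?_
  obtain ⟨r, a, rfl⟩ := exists_snoc r
  obtain ⟨s, c, rfl⟩ := exists_snoc s
  rw [topE_mul_snoc, mul_topE_snoc]
  simp only [ext1_snoc]
  simp [Fin.sum_univ_two]
  fin_cases a <;> fin_cases b <;> fin_cases c <;> fin_cases d <;> simp [asym]

/-- The injective half of Frobenius reciprocity: up to sign, the entries of x occur among those of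
(x ⊗ 1) e. -/
lemma eq_zero_of_mul_topE {k : ℕ} {x : TensorEnd (k + 1)}
    (h : ext1 (k + 1) x * topE k = 0) : x = 0 := by
  ext t s
  obtain ⟨s, c, rfl⟩ := exists_snoc s
  have h1 : ∀ b d, _ := fun b d =>
    congrFun (congrFun h (snoc t b)) (snoc (snoc s 0) d)
  have h2 : ∀ b d, _ := fun b d =>
    congrFun (congrFun h (snoc t b)) (snoc (snoc s 1) d)
  simp only [mul_topE_snoc, ext1_snoc] at h1 h2
  have h3 := h1 0 1
  have h4 := h1 1 1
  simp [asym] at h3 h4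
  fin_cases c
  · exact h4
  · exact h3

lemma trace_ext1_mul_topE {k : ℕ} (x : TensorEnd (k + 1)) :
    (ext1 (k + 1) x * topE k).trace = x.trace := by
  rw [trace_snoc, sum_snoc, trace_snoc]
  simp only [mul_topE_snoc, ext1_snoc]
  simp [asym, Fin.sum_univ_two, add_comm]

lemma topE_sq (k : ℕ) : topE k * topE k = 2 • topE k := by
  refine ext_snoc fun r b s d => ?_
  obtain ⟨r, a, rfl⟩ := exists_snoc r
  obtain ⟨s, c, rfl⟩ := exists_snoc s
  rw [mul_topE_snoc, Matrix.smul_apply]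
  simp only [topE_snoc]
  by_cases h : r = s
  · simp [h, asym, Fin.sum_univ_two]; ring
  · simp [h]

lemma ptr_topE (k : ℕ) : ptr (topE k) = 1 := by
  refine ext_snoc fun r a s c => ?_
  simp only [ptr_apply, topE_snoc, Matrix.one_apply, snoc_inj]
  by_cases h : r = s
  · simp only [h, if_true, true_and, asym_sum_right]
  · simp [h]

lemma topE_braid (k : ℕ) :
    topE (k + 1) * ext1 (k + 2) (topE k) * topE (k + 1) = topE (k + 1) := by
  rw [topE_mul_ext1_mul_topE, ptr_topE, map_one, map_one, one_mul]

lemma topE_braid' (k : ℕ) :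
    ext1 (k + 2) (topE k) * topE (k + 1) * ext1 (k + 2) (topE k) = ext1 (k + 2) (topE k) := by
  refine ext_snoc fun r c s f => ?_
  obtain ⟨r, b, rfl⟩ := exists_snoc r
  obtain ⟨r, a, rfl⟩ := exists_snoc r
  obtain ⟨s, e, rfl⟩ := exists_snoc s
  obtain ⟨s, d, rfl⟩ := exists_snoc s
  simp only [Matrix.mul_apply (M := ext1 (k + 2) (topE k) * topE (k + 1)), sum_snoc]
  simp only [mul_topE_snoc, ext1_snoc, topE_snoc]
  by_cases h : r = s
  · subst h
    simp [asym, Fin.sum_univ_two]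
    fin_cases f <;> simp <;> fin_cases c <;> simp
  · simp [h]

/-! ### The Temperley–Lieb relations -/

/-- Every e_i is the operator on the last two positions of a shorter tensor power, extended by the
identity. So it suffices to compute with `topE`. -/
lemma tl_eq_embed {N i : ℕ} (h : i + 2 ≤ N) : tl N (i + 1) = embedHom h (topE i) := by
  induction N, h using Nat.le_induction with
  | base => rw [embedHom_apply, embed_self]
  | succ N h ih =>
    rw [← embedHom_trans h (Nat.le_succ N), ← ih]
    refine ext_snoc fun r a s b => ?_
    have hs : ∀ (x y : Fin N), (snoc s b) ∘ Equiv.swap x.castSucc y.castSucc =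
        snoc (s ∘ Equiv.swap x y) b := by
      intro x y
      funext j
      refine Fin.lastCases ?_ (fun j => ?_) j
      · rw [snoc_last, Function.comp, Equiv.swap_apply_of_ne_of_ne (Fin.castSucc_lt_last x).ne'
          (Fin.castSucc_lt_last y).ne', snoc_last]
      · rw [snoc_castSucc, Function.comp, Function.comp]
        by_cases h1 : j = x
        · subst h1; simp [snoc_castSucc]
        · by_cases h2 : j = y
          · subst h2; simp [snoc_castSucc]
          · rw [Equiv.swap_apply_of_ne_of_ne h1 h2, Equiv.swap_apply_of_ne_of_ne
              (by simpa using h1) (by simpa using h2), snoc_castSucc]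
    have h1 : 1 ≤ i + 1 ∧ i + 1 < N := by omega
    have h2 : 1 ≤ i + 1 ∧ i + 1 < N + 1 := by omega
    rw [ext1_snoc, tl, tl, dif_pos h1, dif_pos h2]
    have h3 := hs ⟨i, by omega⟩ ⟨i + 1, by omega⟩
    simp only [Fin.castSucc_mk] at h3
    simp only [Nat.add_sub_cancel, Matrix.sub_apply, Matrix.of_apply, Matrix.one_apply, h3,
      snoc_inj]
    by_cases hab : a = b <;> simp [hab]

lemma tl_embed {p N i : ℕ} (h : p ≤ N) (hi : 1 ≤ i) (hip : i < p) :
    embedHom h (tl p i) = tl N i := by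
  obtain ⟨i, rfl⟩ := Nat.exists_eq_add_of_le' hi
  rw [tl_eq_embed (show i + 2 ≤ p by omega), tl_eq_embed (show i + 2 ≤ N by omega),
    embedHom_trans]

lemma tl_comm_embed {p N i : ℕ} (hp : p < i) (hi : i < N) (x : TensorEnd p) :
    tl N i * embed p N x = embed p N x * tl N i := by
  obtain ⟨i, rfl⟩ := Nat.exists_eq_add_of_le' (show 1 ≤ i by omega)
  have h1 : p ≤ i := by omega
  have h2 : i + 2 ≤ N := by omega
  have h3 : embed p N x = embedHom h2 (ext1 (i + 1) (ext1 i (embedHom h1 x))) := by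
    rw [embedHom_trans, embedHom_trans, embedHom_trans]; rfl
  rw [tl_eq_embed h2, h3, ← map_mul, topE_comm, map_mul]

lemma relA (N : ℕ) : RelA N where
  sq i h1 h2 := by
    obtain ⟨i, rfl⟩ := Nat.exists_eq_add_of_le' h1
    rw [tl_eq_embed (show i + 2 ≤ N by omega), ← map_mul, topE_sq, map_nsmul]
  braid_succ i h1 h2 := by
    obtain ⟨i, rfl⟩ := Nat.exists_eq_add_of_le' h1
    have h3 : i + 1 + 2 ≤ N := by omega
    rw [tl_eq_embed h3, tl_eq_embed (show i + 2 ≤ N by omega),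
      ← embedHom_trans (Nat.le_succ (i + 2)) h3, ← map_mul, ← map_mul, topE_braid']
  braid_pred i h1 h2 := by
    obtain ⟨i, rfl⟩ := Nat.exists_eq_add_of_le' h1
    have h3 : i + 1 + 2 ≤ N := by omega
    rw [tl_eq_embed h3, tl_eq_embed (show i + 2 ≤ N by omega),
      ← embedHom_trans (Nat.le_succ (i + 2)) h3, ← map_mul, ← map_mul, topE_braid]
  comm i j h1 h2 h3 := by
    rw [← tl_embed (show i + 1 ≤ N by omega) h1 (Nat.lt_succ_self i)]
    exact (tl_comm_embed h2 h3 _).symm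

/-! ### The centralizer algebras -/

lemma mem_centralizerAlg {G : Subgroup SU2} {k : ℕ} {x : TensorEnd k} :
    x ∈ centralizerAlg G k ↔
      ∀ g ∈ G, tensorPow (g : SU2).1 k * x = x * tensorPow g.1 k := by
  simp only [centralizerAlg, Subalgebra.mem_centralizer_iff, Set.forall_mem_range, Subtype.forall]

lemma ext1_comm_tensorPow {g : Matrix (Fin 2) (Fin 2) ℂ} {k : ℕ} {x : TensorEnd k}
    (h : tensorPow g k * x = x * tensorPow g k) :
    tensorPow g (k + 1) * ext1 k x = ext1 k x * tensorPow g (k + 1) := by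
  refine ext_snoc fun r a s b => ?_
  have h1 := congrFun (congrFun h r) s
  simp only [Matrix.mul_apply] at h1
  simp only [Matrix.mul_apply, sum_snoc, ext1_snoc, tensorPow_snoc, mul_ite, mul_zero, ite_mul,
    zero_mul, Finset.sum_ite_eq, Finset.sum_ite_eq', Finset.mem_univ, if_true]
  calc _ = (∑ i, tensorPow g k r i * x i s) * g a b := by
        rw [Finset.sum_mul]; exact Finset.sum_congr rfl fun _ _ => by ring
    _ = _ := by rw [h1, Finset.sum_mul]; exact Finset.sum_congr rfl fun _ _ => by ring

lemma ext1_mem {G : Subgroup SU2} {k : ℕ} {x : TensorEnd k} (h : x ∈ centralizerAlg G k) :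
    ext1 k x ∈ centralizerAlg G (k + 1) := by
  rw [mem_centralizerAlg] at h ⊢
  exact fun g hg => ext1_comm_tensorPow (h g hg)

lemma embedHom_mem {G : Subgroup SU2} {p N : ℕ} (h : p ≤ N) {x : TensorEnd p}
    (hx : x ∈ centralizerAlg G p) : embedHom h x ∈ centralizerAlg G N := by
  induction N, h using Nat.le_induction with
  | base => rwa [embedHom_apply, embed_self]
  | succ N h ih => rw [← embedHom_trans h (Nat.le_succ N)]; exact ext1_mem ih

/-- The antisymmetric tensor is an eigenvector of g ⊗ g with eigenvalue det g. Arbitrary matrices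
are allowed because the axes of the polyhedra, used further on, need not have determinant 1. -/
lemma tensorPow_mul_topE_det (g : Matrix (Fin 2) (Fin 2) ℂ) (k : ℕ) : tensorPow g (k + 2) * topE k =
    g.det • (ext1 (k + 1) (ext1 k (tensorPow g k)) * topE k) := by
  refine ext_snoc fun r b s d => ?_
  obtain ⟨r, a, rfl⟩ := exists_snoc r
  obtain ⟨s, c, rfl⟩ := exists_snoc s
  rw [Matrix.smul_apply, mul_topE_snoc, mul_topE_snoc, smul_eq_mul, ← mul_assoc, Matrix.det_fin_two]
  congr 1
  simp only [tensorPow_snoc, ext1_snoc]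
  fin_cases a <;> fin_cases b <;> simp [asym, Fin.sum_univ_two] <;> ring

lemma topE_mul_tensorPow_det (g : Matrix (Fin 2) (Fin 2) ℂ) (k : ℕ) : topE k * tensorPow g (k + 2) =
    g.det • (topE k * ext1 (k + 1) (ext1 k (tensorPow g k))) := by
  refine ext_snoc fun r b s d => ?_
  obtain ⟨r, a, rfl⟩ := exists_snoc r
  obtain ⟨s, c, rfl⟩ := exists_snoc s
  rw [Matrix.smul_apply, topE_mul_snoc, topE_mul_snoc, smul_eq_mul, mul_left_comm,
    Matrix.det_fin_two]
  congr 1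
  simp only [tensorPow_snoc, ext1_snoc]
  fin_cases c <;> fin_cases d <;> simp [asym, Fin.sum_univ_two] <;> ring

lemma det_SU2 (g : SU2) : g.1.det = 1 := (Matrix.mem_specialUnitaryGroup_iff.mp g.2).2

lemma tensorPow_mul_topE (g : SU2) (k : ℕ) :
    tensorPow g.1 (k + 2) * topE k = ext1 (k + 1) (ext1 k (tensorPow g.1 k)) * topE k := by
  rw [tensorPow_mul_topE_det, det_SU2, one_smul]

lemma topE_mul_tensorPow (g : SU2) (k : ℕ) :
    topE k * tensorPow g.1 (k + 2) = topE k * ext1 (k + 1) (ext1 k (tensorPow g.1 k)) := by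
  rw [topE_mul_tensorPow_det, det_SU2, one_smul]

lemma topE_mem (G : Subgroup SU2) (k : ℕ) : topE k ∈ centralizerAlg G (k + 2) := by
  rw [mem_centralizerAlg]
  intro g _
  rw [tensorPow_mul_topE, topE_mul_tensorPow, topE_comm]

lemma tl_mem (G : Subgroup SU2) {N i : ℕ} (h1 : 1 ≤ i) (h2 : i < N) :
    tl N i ∈ centralizerAlg G N := by
  obtain ⟨i, rfl⟩ := Nat.exists_eq_add_of_le' h1
  rw [tl_eq_embed (show i + 2 ≤ N by omega)]
  exact embedHom_mem _ (topE_mem G i)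

/-- By `topE_mul_ext1_mul_topE` the partial trace of x is visible in e (x ⊗ 1) e, which commutes
with the group; `eq_zero_of_mul_topE` then removes the factor e. -/
lemma ptr_mem {G : Subgroup SU2} {k : ℕ} {x : TensorEnd (k + 1)}
    (h : x ∈ centralizerAlg G (k + 1)) : ptr x ∈ centralizerAlg G k := by
  rw [mem_centralizerAlg]
  intro g hg
  rw [← sub_eq_zero]
  apply ext1_injective k
  rw [map_zero]
  apply eq_zero_of_mul_topE
  have hx := mem_centralizerAlg.mp (ext1_mem h) g hg
  have h1 := tensorPow_mul_topE g k
  have h2 := topE_mul_tensorPow g k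
  have h3 := topE_comm (tensorPow g.1 k)
  have h4 := topE_mul_ext1_mul_topE x
  rw [map_sub, map_sub, sub_mul, sub_eq_zero, map_mul, map_mul, map_mul, map_mul]
  generalize ext1 (k + 1) (ext1 k (tensorPow g.1 k)) = a at *
  generalize ext1 (k + 1) (ext1 k (ptr x)) = y at *
  generalize ext1 (k + 1) x = z at *
  calc a * y * topE k = a * (topE k * z * topE k) := by rw [h4, mul_assoc]
    _ = topE k * a * z * topE k := by rw [h3]; simp only [mul_assoc]
    _ = topE k * (z * (a * topE k)) := by rw [← h2, mul_assoc (topE k), hx, ← h1]; simp only [mul_assoc]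
    _ = y * a * topE k := by rw [← h3, ← mul_assoc, ← mul_assoc, h4, mul_assoc, h3, mul_assoc]

end McKay

/-! ### The old ideal, families of idempotents and their children -/

namespace McKay

variable {G : Subgroup SU2} {k : ℕ}

/-! ### Idempotents and adjoints -/

lemma trace_eq_finrank {n : Type} [Fintype n] [DecidableEq n] {x : Matrix n n ℂ}
    (hx : x * x = x) : x.trace = (Module.finrank ℂ (LinearMap.range (Matrix.toLin' x)) : ℂ) := by
  have h : LinearMap.IsProj (LinearMap.range (Matrix.toLin' x)) (Matrix.toLin' x) :=
    LinearMap.IsIdempotentElem.isProj_range _ (by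
      rw [IsIdempotentElem, Module.End.mul_eq_comp, ← Matrix.toLin'_mul, hx])
  rw [← Matrix.trace_toLin'_eq, h.trace]

/-- The trace of an idempotent is its rank. Most equalities of idempotents below are obtained by
showing that their difference is an idempotent of trace zero. -/
lemma eq_zero_of_trace {n : Type} [Fintype n] [DecidableEq n] {x : Matrix n n ℂ}
    (hx : x * x = x) (h : x.trace = 0) : x = 0 := by
  rw [trace_eq_finrank hx, Nat.cast_eq_zero, Submodule.finrank_eq_zero, LinearMap.range_eq_bot] at h
  simpa using h

lemma exists_trace_eq_nat {n : Type} [Fintype n] [DecidableEq n] {x : Matrix n n ℂ}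
    (hx : x * x = x) : ∃ m : ℕ, x.trace = m := ⟨_, trace_eq_finrank hx⟩

lemma conjTranspose_tensorPow (g : Matrix (Fin 2) (Fin 2) ℂ) (k : ℕ) :
    (tensorPow g k).conjTranspose = tensorPow g.conjTranspose k := by
  ext r s
  simp [tensorPow, Matrix.conjTranspose_apply]

lemma coe_inv_SU2 (g : SU2) : (g⁻¹ : SU2).1 = g.1.conjTranspose := rfl

lemma tensorPow_inv_mul (g : SU2) (k : ℕ) : tensorPow (g⁻¹).1 k * tensorPow g.1 k = 1 := by
  rw [← tensorPow_mul, ← Submonoid.coe_mul, inv_mul_cancel, Submonoid.coe_one, tensorPow_one]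

lemma tensorPow_mul_inv (g : SU2) (k : ℕ) : tensorPow g.1 k * tensorPow (g⁻¹).1 k = 1 := by
  rw [← tensorPow_mul, ← Submonoid.coe_mul, mul_inv_cancel, Submonoid.coe_one, tensorPow_one]

lemma conjTranspose_mem {x : TensorEnd k} (hx : x ∈ centralizerAlg G k) :
    x.conjTranspose ∈ centralizerAlg G k := by
  rw [mem_centralizerAlg] at hx ⊢
  intro g hg
  have h := congrArg Matrix.conjTranspose (hx g⁻¹ (inv_mem hg))
  rw [Matrix.conjTranspose_mul, Matrix.conjTranspose_mul, conjTranspose_tensorPow, coe_inv_SU2,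
    Matrix.conjTranspose_conjTranspose] at h
  exact h.symm

/-! ### The ideal of endomorphisms that factor through `V^{⊗(k-2)}` -/

/-- The endomorphisms of `V^{⊗k}` that factor through `V^{⊗(k-2)}`. -/
def oldIdeal (G : Subgroup SU2) (k : ℕ) : Submodule ℂ (TensorEnd k) :=
  Submodule.span ℂ {z | ∃ x ∈ centralizerAlg G k, ∃ y ∈ centralizerAlg G k,
    z = x * tl k (k - 1) * y}

lemma tl_last_mem (G : Subgroup SU2) (k : ℕ) : tl k (k - 1) ∈ centralizerAlg G k := by
  by_cases h : 1 ≤ k - 1 ∧ k - 1 < k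
  · exact tl_mem G h.1 h.2
  · rw [tl, dif_neg h]; exact zero_mem _

/-- There is no tensor power V^{⊗(-1)} to factor through; in the code, `tl 1 0` has the default
value 0. -/
lemma oldIdeal_one : oldIdeal G 1 = ⊥ := by
  rw [oldIdeal, Submodule.span_eq_bot]
  rintro _ ⟨x, -, y, -, rfl⟩
  simp [tl]

lemma mul_mem_oldIdeal {x u : TensorEnd k} (hx : x ∈ centralizerAlg G k)
    (hu : u ∈ oldIdeal G k) : x * u ∈ oldIdeal G k := by
  induction hu using Submodule.span_induction with
  | mem u hu =>
    obtain ⟨y, hy, z, hz, rfl⟩ := hu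
    exact Submodule.subset_span ⟨x * y, mul_mem hx hy, z, hz, by simp only [mul_assoc]⟩
  | zero => rw [mul_zero]; exact zero_mem _
  | add u v _ _ hu hv => rw [mul_add]; exact add_mem hu hv
  | smul a u _ hu => rw [mul_smul_comm]; exact Submodule.smul_mem _ _ hu

lemma mem_oldIdeal_mul {x u : TensorEnd k} (hx : x ∈ centralizerAlg G k)
    (hu : u ∈ oldIdeal G k) : u * x ∈ oldIdeal G k := by
  induction hu using Submodule.span_induction with
  | mem u hu =>
    obtain ⟨y, hy, z, hz, rfl⟩ := hu
    exact Submodule.subset_span ⟨y, hy, z * x, mul_mem hz hx, by simp only [mul_assoc]⟩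
  | zero => rw [zero_mul]; exact zero_mem _
  | add u v _ _ hu hv => rw [add_mul]; exact add_mem hu hv
  | smul a u _ hu => rw [smul_mul_assoc]; exact Submodule.smul_mem _ _ hu

lemma mul_topE_mul_mem {x y : TensorEnd (k + 2)} (hx : x ∈ centralizerAlg G (k + 2))
    (hy : y ∈ centralizerAlg G (k + 2)) : x * topE k * y ∈ oldIdeal G (k + 2) :=
  Submodule.subset_span ⟨x, hx, y, hy, rfl⟩

/-- Old endomorphisms stay old after tensoring with 1, because the braid relation puts the new last
e between two copies of the previous one. -/
lemma ext1_mem_oldIdeal {u : TensorEnd (k + 1)} (hu : u ∈ oldIdeal G (k + 1)) :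
    ext1 (k + 1) u ∈ oldIdeal G (k + 2) := by
  cases k with
  | zero =>
    rw [oldIdeal_one, Submodule.mem_bot] at hu
    rw [hu, map_zero]
    exact zero_mem _
  | succ k =>
    induction hu using Submodule.span_induction with
    | mem u hu =>
      obtain ⟨y, hy, z, hz, rfl⟩ := hu
      have h : ext1 (k + 2) (y * topE k * z) = (ext1 (k + 2) y * ext1 (k + 2) (topE k)) *
          topE (k + 1) * (ext1 (k + 2) (topE k) * ext1 (k + 2) z) := by
        have h1 := topE_braid' k
        rw [map_mul, map_mul]
        have h2 := congrArg (fun t => ext1 (k + 2) y * t * ext1 (k + 2) z) h1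
        simpa only [mul_assoc] using h2.symm
      refine h ▸ mul_topE_mul_mem ?_ ?_
      · exact mul_mem (ext1_mem hy) (ext1_mem (topE_mem G k))
      · exact mul_mem (ext1_mem (topE_mem G k)) (ext1_mem hz)
    | zero => rw [map_zero]; exact zero_mem _
    | add u v _ _ hu hv => rw [map_add]; exact add_mem hu hv
    | smul a u _ hu => rw [map_smul]; exact Submodule.smul_mem _ _ hu

/-- Bending strands on both sides writes x e y as a product (x' ⊗ 1) e (y' ⊗ 1) with x', y' in the
preceding centralizer algebra. -/
lemma oldIdeal_le_of_mem {A : Subalgebra ℂ (TensorEnd (k + 2))}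
    (hA : ∀ x ∈ centralizerAlg G (k + 1), ext1 (k + 1) x ∈ A) (he : topE k ∈ A) :
    oldIdeal G (k + 2) ≤ Subalgebra.toSubmodule A := by
  refine Submodule.span_le.mpr ?_
  rintro _ ⟨x, hx, y, hy, rfl⟩
  have h : x * topE k * y = ext1 (k + 1) (ptr (x * topE k)) * topE k *
      ext1 (k + 1) (ptr (topE k * y)) := by
    rw [← mul_topE_eq, mul_assoc, mul_assoc, ← topE_mul_eq y]
  change x * topE k * y ∈ A
  rw [h]
  exact mul_mem (mul_mem (hA _ (ptr_mem (mul_mem hx (topE_mem G k)))) he)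
    (hA _ (ptr_mem (mul_mem (topE_mem G k) hy)))

/-! ### Families of idempotents for the new summands -/

/-- Orthogonal idempotents of `Z_k` that are killed by the old endomorphisms and whose sum is `1`
modulo the old endomorphisms. -/
structure PreFam (G : Subgroup SU2) (k : ℕ) {ι : Type} [Fintype ι] [DecidableEq ι]
    (c : ι → TensorEnd k) : Prop where
  mem : ∀ i, c i ∈ centralizerAlg G k
  mul : ∀ i j, c i * c j = if i = j then c i else 0
  left : ∀ i, ∀ x ∈ centralizerAlg G k, c i * x * tl k (k - 1) = 0
  right : ∀ i, ∀ x ∈ centralizerAlg G k, tl k (k - 1) * x * c i = 0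
  one : 1 - ∑ i, c i ∈ oldIdeal G k

/-- A family as in `PreFam` whose members are minimal (or zero) and pairwise not equivalent. -/
structure Fam (G : Subgroup SU2) (k : ℕ) {ι : Type} [Fintype ι] [DecidableEq ι]
    (c : ι → TensorEnd k) : Prop extends PreFam G k c where
  min : ∀ i, ∀ x ∈ centralizerAlg G k, ∃ a : ℂ, c i * x * c i = a • c i
  orth : ∀ i j, i ≠ j → ∀ x ∈ centralizerAlg G k, c i * x * c j = 0

section
variable {ι : Type} [Fintype ι] [DecidableEq ι] {c : ι → TensorEnd k}

lemma PreFam.idem (h : PreFam G k c) (i : ι) : c i * c i = c i := by simp [h.mul]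

lemma PreFam.mul_old (h : PreFam G k c) (i : ι) {u : TensorEnd k} (hu : u ∈ oldIdeal G k) :
    c i * u = 0 := by
  induction hu using Submodule.span_induction with
  | mem u hu =>
    obtain ⟨y, hy, z, hz, rfl⟩ := hu
    rw [← mul_assoc, ← mul_assoc, h.left i y hy, zero_mul]
  | zero => rw [mul_zero]
  | add u v _ _ hu hv => rw [mul_add, hu, hv, add_zero]
  | smul a u _ hu => rw [mul_smul_comm, hu, smul_zero]

lemma PreFam.old_mul (h : PreFam G k c) (i : ι) {u : TensorEnd k} (hu : u ∈ oldIdeal G k) :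
    u * c i = 0 := by
  induction hu using Submodule.span_induction with
  | mem u hu =>
    obtain ⟨y, hy, z, hz, rfl⟩ := hu
    rw [mul_assoc, mul_assoc, ← mul_assoc (tl k (k - 1)), h.right i z hz, mul_zero]
  | zero => rw [zero_mul]
  | add u v _ _ hu hv => rw [add_mul, hu, hv, add_zero]
  | smul a u _ hu => rw [smul_mul_assoc, hu, smul_zero]

/-- Modulo old endomorphisms, which c i kills, 1 is the sum of the c j. Inserting this next to x
leaves only c i x c i, by inequivalence, and that is a multiple of c i, by minimality. -/
lemma Fam.central (h : Fam G k c) (i : ι) {x : TensorEnd k} (hx : x ∈ centralizerAlg G k) :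
    ∃ a : ℂ, c i * x = a • c i ∧ x * c i = a • c i := by
  obtain ⟨a, ha⟩ := h.min i x hx
  refine ⟨a, ?_, ?_⟩
  · have h1 : c i * x * (1 - ∑ j, c j) = 0 := by
      rw [mul_assoc, h.mul_old i (mul_mem_oldIdeal hx h.one)]
    rw [mul_sub, mul_one, sub_eq_zero, Finset.mul_sum,
      Finset.sum_eq_single i (fun j _ hj => h.orth i j hj.symm x hx) (by simp), ha] at h1
    exact h1
  · have h1 : (1 - ∑ j, c j) * (x * c i) = 0 := by
      rw [← mul_assoc, h.old_mul i (mem_oldIdeal_mul hx h.one)]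
    rw [sub_mul, one_mul, sub_eq_zero, Finset.sum_mul, Finset.sum_eq_single i (fun j _ hj => by
      rw [← mul_assoc, h.orth j i hj x hx]) (by simp), ← mul_assoc, ha] at h1
    exact h1

/-- The quotient of Z_k by the old ideal is commutative and spanned by the classes of the c i. -/
lemma Fam.decomp (h : Fam G k c) {x : TensorEnd k} (hx : x ∈ centralizerAlg G k) :
    ∃ a : ι → ℂ, (∀ i, c i * x = a i • c i) ∧ x - ∑ i, a i • c i ∈ oldIdeal G k := by
  choose a ha _ using fun i => h.central i hx
  refine ⟨a, ha, ?_⟩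
  have h1 := mem_oldIdeal_mul hx h.one
  rw [sub_mul, one_mul, Finset.sum_mul] at h1
  simpa only [ha] using h1

end

/-! ### Parents and children -/

/-- `p` is a minimal idempotent of `Z_k` and `c ≤ p ⊗ 1`. -/
structure IsParent (G : Subgroup SU2) (k : ℕ) (p : TensorEnd k) (c : TensorEnd (k + 1)) :
    Prop where
  mem : p ∈ centralizerAlg G k
  idem : p * p = p
  min : ∀ x ∈ centralizerAlg G k, ∃ a : ℂ, p * x * p = a • p
  left : ext1 k p * c = c
  right : c * ext1 k p = c

/-- As c lies under p ⊗ 1, its partial trace lies in p Z_k p, which consists of multiples of p.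
Comparing traces gives the scalar. -/
lemma IsParent.ptr_eq {p : TensorEnd k} {c : TensorEnd (k + 1)} (h : IsParent G k p c)
    (hc : c ∈ centralizerAlg G (k + 1)) : ptr c = (c.trace / p.trace) • p := by
  by_cases hp : p = 0
  · have h1 := h.left
    rw [hp, map_zero, zero_mul] at h1
    rw [← h1, hp]
    ext
    simp [ptr]
  · have hp' : p.trace ≠ 0 := fun h1 => hp (eq_zero_of_trace h.idem h1)
    obtain ⟨a, ha⟩ := h.min _ (ptr_mem hc)
    rw [← ptr_ext1_mul, ← ptr_mul_ext1, h.left, h.right] at ha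
    have h1 := congrArg Matrix.trace ha
    rw [trace_ptr, Matrix.trace_smul, smul_eq_mul] at h1
    rw [ha, h1, mul_div_cancel_right₀ _ hp']

/-- The part of `c ⊗ 1` complementary to the copy of the parent `p` of `c`. -/
def child (c : TensorEnd (k + 1)) (p : TensorEnd k) : TensorEnd (k + 2) :=
  ext1 (k + 1) c - (p.trace / c.trace) • (ext1 (k + 1) c * topE k * ext1 (k + 1) c)

lemma IsParent.topE_mul_mul {p : TensorEnd k} {c : TensorEnd (k + 1)} (h : IsParent G k p c)
    (hc : c ∈ centralizerAlg G (k + 1)) : topE k * ext1 (k + 1) c * topE k =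
      (c.trace / p.trace) • (ext1 (k + 1) (ext1 k p) * topE k) := by
  rw [topE_mul_ext1_mul_topE, h.ptr_eq hc, map_smul, map_smul, smul_mul_assoc]

lemma IsParent.mul_topE_mul_sq {p : TensorEnd k} {c : TensorEnd (k + 1)} (h : IsParent G k p c)
    (hc : c ∈ centralizerAlg G (k + 1)) : ext1 (k + 1) c * (topE k * ext1 (k + 1) c * topE k) =
      (c.trace / p.trace) • (ext1 (k + 1) c * topE k) := by
  rw [h.topE_mul_mul hc, mul_smul_comm, ← mul_assoc, ← map_mul, h.right]

section
variable {p : TensorEnd k} {c : TensorEnd (k + 1)}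

lemma IsParent.trace_ne_zero (h : IsParent G k p c) (hc0 : c ≠ 0) : p.trace ≠ 0 := by
  intro h1
  have h2 := h.left
  rw [eq_zero_of_trace h.idem h1, map_zero, zero_mul] at h2
  exact hc0 h2.symm

lemma child_mem (hc : c ∈ centralizerAlg G (k + 1)) (p : TensorEnd k) :
    child c p ∈ centralizerAlg G (k + 2) :=
  sub_mem (ext1_mem hc) (Subalgebra.smul_mem _
    (mul_mem (mul_mem (ext1_mem hc) (topE_mem G k)) (ext1_mem hc)) _)

lemma ext1_mul_child (hcc : c * c = c) (p : TensorEnd k) :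
    ext1 (k + 1) c * child c p = child c p := by
  have h1 : ext1 (k + 1) c * ext1 (k + 1) c = ext1 (k + 1) c := by rw [← map_mul, hcc]
  rw [child, mul_sub, mul_smul_comm, ← mul_assoc, ← mul_assoc, h1]

lemma child_mul_ext1 (hcc : c * c = c) (p : TensorEnd k) :
    child c p * ext1 (k + 1) c = child c p := by
  have h1 : ext1 (k + 1) c * ext1 (k + 1) c = ext1 (k + 1) c := by rw [← map_mul, hcc]
  rw [child, sub_mul, smul_mul_assoc, mul_assoc (_ * _), h1]

/-- The coefficient in `child` is the inverse of the scalar in `IsParent.topE_mul_mul`, so that the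
two terms cancel against e. -/
lemma IsParent.child_mul_topE (h : IsParent G k p c)
    (hc : c ∈ centralizerAlg G (k + 1)) (hcc : c * c = c) : child c p * topE k = 0 := by
  rw [child, sub_mul, smul_mul_assoc, mul_assoc, mul_assoc, ← mul_assoc (topE k),
    h.mul_topE_mul_sq hc, smul_smul]
  -- For c = 0 the quotient of traces is a division by zero with value 0 and does not cancel, but
  -- then both terms vanish.
  by_cases hc0 : c = 0
  · simp [hc0]
  · have h1 : c.trace ≠ 0 := fun h1 => hc0 (eq_zero_of_trace hcc h1)
    have h2 := h.trace_ne_zero hc0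
    rw [div_mul_div_cancel₀ h1, div_self h2, one_smul, sub_self]

lemma IsParent.topE_mul_child (h : IsParent G k p c)
    (hc : c ∈ centralizerAlg G (k + 1)) (hcc : c * c = c) : topE k * child c p = 0 := by
  have h0 : topE k * ext1 (k + 1) (ext1 k p) * ext1 (k + 1) c = topE k * ext1 (k + 1) c := by
    rw [mul_assoc, ← map_mul, h.left]
  rw [child, mul_sub, mul_smul_comm, ← mul_assoc, ← mul_assoc, h.topE_mul_mul hc, ← topE_comm,
    smul_mul_assoc, h0, smul_smul]
  by_cases hc0 : c = 0
  · simp [hc0]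
  · have h1 : c.trace ≠ 0 := fun h1 => hc0 (eq_zero_of_trace hcc h1)
    have h2 := h.trace_ne_zero hc0
    rw [div_mul_div_cancel₀ h1, div_self h2, one_smul, sub_self]

lemma IsParent.child_idem (h : IsParent G k p c)
    (hc : c ∈ centralizerAlg G (k + 1)) (hcc : c * c = c) : child c p * child c p = child c p := by
  conv_lhs => rw [child.eq_def c p, sub_mul]
  rw [← child, ext1_mul_child hcc, smul_mul_assoc, mul_assoc, ext1_mul_child hcc,
    mul_assoc, h.topE_mul_child hc hcc, mul_zero, smul_zero, sub_zero]

/-- This is the dimension of the module of c tensored with V, minus that of the parent. Since traces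
of idempotents are natural numbers, it serves below as a bound and as a test for vanishing. -/
lemma trace_child (hcc : c * c = c) (p : TensorEnd k) (hc0 : c ≠ 0) :
    (child c p).trace = 2 * c.trace - p.trace := by
  have h1 : c.trace ≠ 0 := fun h1 => hc0 (eq_zero_of_trace hcc h1)
  have h2 : (ext1 (k + 1) c * topE k * ext1 (k + 1) c).trace = c.trace := by
    rw [Matrix.trace_mul_comm, ← mul_assoc, ← map_mul, hcc, trace_ext1_mul_topE]
  rw [child, Matrix.trace_sub, trace_ext1, Matrix.trace_smul, h2, smul_eq_mul,
    div_mul_cancel₀ _ h1]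

end

section
variable {ι : Type} [Fintype ι] [DecidableEq ι]

lemma Fam.isParent {c : ι → TensorEnd k} (h : Fam G k c) (i : ι) {y : TensorEnd (k + 1)}
    (h1 : ext1 k (c i) * y = y) (h2 : y * ext1 k (c i) = y) : IsParent G k (c i) y :=
  ⟨h.mem i, h.idem i, h.min i, h1, h2⟩

/-- For x in the centralizer algebra, x e = (y ⊗ 1) e by bending. The idempotent c i passes through
y up to a scalar by `Fam.central`, and its child kills e. The sum condition holds because the
correction terms c e c are old. -/
lemma Fam.preFam_child {c : ι → TensorEnd (k + 1)} (h : Fam G (k + 1) c) {p : ι → TensorEnd k}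
    (hp : ∀ i, IsParent G k (p i) (c i)) : PreFam G (k + 2) fun i => child (c i) (p i) where
  mem i := child_mem (h.mem i) _
  mul i j := by
    split_ifs with hij
    · subst hij
      exact (hp i).child_idem (h.mem i) (h.idem i)
    · rw [← child_mul_ext1 (h.idem i),
        ← ext1_mul_child (h.idem j), mul_assoc, ← mul_assoc (ext1 _ _),
        ← map_mul, h.mul, if_neg hij, map_zero, zero_mul, mul_zero]
  left i x hx := by
    change _ * topE k = 0
    obtain ⟨a, ha, -⟩ := h.central i (ptr_mem (mul_mem hx (topE_mem G k)))
    rw [mul_assoc, mul_topE_eq, ← mul_assoc, ← child_mul_ext1 (h.idem i),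
      mul_assoc (child _ _), ← map_mul, ha, map_smul, mul_smul_comm,
      child_mul_ext1 (h.idem i), smul_mul_assoc,
      (hp i).child_mul_topE (h.mem i) (h.idem i), smul_zero]
  right i x hx := by
    change topE k * _ * _ = 0
    obtain ⟨a, -, ha⟩ := h.central i (ptr_mem (mul_mem (topE_mem G k) hx))
    rw [topE_mul_eq, mul_assoc, ← ext1_mul_child (h.idem i),
      ← mul_assoc (ext1 _ _), ← map_mul, ha, map_smul, smul_mul_assoc,
      ext1_mul_child (h.idem i), mul_smul_comm,
      (hp i).topE_mul_child (h.mem i) (h.idem i), smul_zero]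
  one := by
    have h1 : 1 - ∑ i, child (c i) (p i) = ext1 (k + 1) (1 - ∑ i, c i) +
        ∑ i, ((p i).trace / (c i).trace) •
          (ext1 (k + 1) (c i) * topE k * ext1 (k + 1) (c i)) := by
      simp only [child, Finset.sum_sub_distrib, map_sub, map_one, map_sum]
      abel
    rw [h1]
    exact add_mem (ext1_mem_oldIdeal h.one) (sum_mem fun i _ => Submodule.smul_mem _ _
      (mul_topE_mul_mem (ext1_mem (h.mem i)) (ext1_mem (h.mem i))))

/-- Only the last generator is killed by definition. The others follow by descending induction,
since e_j = e_j e_{j+1} e_j. -/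
lemma PreFam.tl_mul_mul {c : ι → TensorEnd k} (h : PreFam G k c) (i : ι) {j : ℕ} (hj : 1 ≤ j)
    (hjk : j < k) {x : TensorEnd k} (hx : x ∈ centralizerAlg G k) : tl k j * x * c i = 0 := by
  -- Induction on the distance d of j from the last position.
  obtain ⟨d, hd⟩ : ∃ d, j + d = k - 1 := ⟨k - 1 - j, by omega⟩
  induction d generalizing j x with
  | zero => obtain rfl : j = k - 1 := by omega
            exact h.right i x hx
  | succ d ih =>
    have h1 := ih (j := j + 1) (by omega) (by omega) (mul_mem (tl_mem G hj hjk) hx) (by omega)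
    rw [← (relA k).braid_succ j hj (by omega)]
    simp only [mul_assoc] at h1 ⊢
    rw [h1, mul_zero]

lemma PreFam.mul_mul_tl {c : ι → TensorEnd k} (h : PreFam G k c) (i : ι) {j : ℕ} (hj : 1 ≤ j)
    (hjk : j < k) {x : TensorEnd k} (hx : x ∈ centralizerAlg G k) : c i * x * tl k j = 0 := by
  obtain ⟨d, hd⟩ : ∃ d, j + d = k - 1 := ⟨k - 1 - j, by omega⟩
  induction d generalizing j x with
  | zero => obtain rfl : j = k - 1 := by omega
            exact h.left i x hx
  | succ d ih =>
    have h1 := ih (j := j + 1) (by omega) (by omega) (mul_mem hx (tl_mem G hj hjk)) (by omega)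
    rw [← (relA k).braid_succ j hj (by omega)]
    simp only [← mul_assoc] at h1 ⊢
    rw [h1, zero_mul]

lemma PreFam.tl_mul {c : ι → TensorEnd k} (h : PreFam G k c) (i : ι) {j : ℕ} (hj : 1 ≤ j)
    (hjk : j < k) : tl k j * c i = 0 := by
  simpa using h.tl_mul_mul i hj hjk (one_mem _)

lemma PreFam.mul_tl {c : ι → TensorEnd k} (h : PreFam G k c) (i : ι) {j : ℕ} (hj : 1 ≤ j)
    (hjk : j < k) : c i * tl k j = 0 := by
  simpa using h.mul_mul_tl i hj hjk (one_mem _)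

end

end McKay

namespace McKay

variable {G : Subgroup SU2} {k : ℕ}

/-! ### Irreducible modules inside tensor powers -/

/-- The matrix of the action of `g` on `G^ν`. -/
def Irrep.mat (ν : Irrep G) (g : G) : Matrix (Fin ν.dim) (Fin ν.dim) ℂ :=
  LinearMap.toMatrix' (ν.rep g)

lemma Irrep.toLin'_mat (ν : Irrep G) (g : G) : Matrix.toLin' (ν.mat g) = ν.rep g :=
  Matrix.toLin'_toMatrix' _

lemma Irrep.dim_ne_zero (ν : Irrep G) : ν.dim ≠ 0 := by
  intro h
  have := ν.irreducible
  obtain ⟨x, y, hxy⟩ := exists_pair_ne (Subrepresentation ν.rep)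
  apply hxy
  ext v
  have : IsEmpty (Fin ν.dim) := by rw [h]; infer_instance
  rw [Subsingleton.elim v 0]
  exact iff_of_true x.toSubmodule.zero_mem y.toSubmodule.zero_mem

lemma Irrep.schur (ν : Irrep G) {A : Matrix (Fin ν.dim) (Fin ν.dim) ℂ}
    (hA : ∀ g, ν.mat g * A = A * ν.mat g) : ∃ a : ℂ, A = a • 1 := by
  have := ν.irreducible
  let f : Representation.IntertwiningMap ν.rep ν.rep := ⟨Matrix.toLin' A, fun g => by
    rw [← ν.toLin'_mat, ← Matrix.toLin'_mul, ← Matrix.toLin'_mul, hA]⟩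
  obtain ⟨a, ha⟩ :=
    (Representation.IsIrreducible.algebraMap_intertwiningMap_bijective_of_isAlgClosed
      (ρ := ν.rep)).2 f
  refine ⟨a, Matrix.toLin'.injective ?_⟩
  have h1 : f.toLinearMap = Matrix.toLin' A := rfl
  rw [← h1, ← ha, map_smul, Matrix.toLin'_one]
  rfl

/-- `F` is the matrix of an embedding of `G^ν` into `V^{⊗k}`. -/
structure Embeds (ν : Irrep G) (k : ℕ) (F : Matrix (Fin k → Fin 2) (Fin ν.dim) ℂ) : Prop where
  inj : Function.Injective (Matrix.toLin' F)
  comm : ∀ g : G, tensorPow g.1.1 k * F = F * ν.mat g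

variable {ν : Irrep G} {F : Matrix (Fin k → Fin 2) (Fin ν.dim) ℂ}

lemma exists_intertwiningMap (h : ∀ g : G, tensorPow g.1.1 k * F = F * ν.mat g) :
    ∃ f : Representation.IntertwiningMap ν.rep (tensorRep G k),
      f.toLinearMap = Matrix.toLin' F :=
  ⟨⟨Matrix.toLin' F, fun g => by
    rw [← ν.toLin'_mat, ← Matrix.toLin'_mul, ← h, Matrix.toLin'_mul]; rfl⟩, rfl⟩

lemma comm_of_intertwiningMap (f : Representation.IntertwiningMap ν.rep (tensorRep G k)) (g : G) :
    tensorPow g.1.1 k * LinearMap.toMatrix' f.toLinearMap =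
      LinearMap.toMatrix' f.toLinearMap * ν.mat g := by
  apply Matrix.toLin'.injective
  rw [Matrix.toLin'_mul, Matrix.toLin'_mul, Matrix.toLin'_toMatrix', ν.toLin'_mat, f.2 g]
  rfl

lemma embeds_of_injective {f : Representation.IntertwiningMap ν.rep (tensorRep G k)}
    (hf : Function.Injective f) : Embeds ν k (LinearMap.toMatrix' f.toLinearMap) :=
  ⟨by rw [Matrix.toLin'_toMatrix']; exact hf, comm_of_intertwiningMap f⟩

lemma inLevel_or_eq_zero (h : ∀ g : G, tensorPow g.1.1 k * F = F * ν.mat g) :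
    InLevel ν k ∨ F = 0 := by
  have := ν.irreducible
  obtain ⟨f, hf⟩ := exists_intertwiningMap h
  rcases Representation.IsIrreducible.injective_or_eq_zero f with h1 | h1
  · exact Or.inl ⟨f, h1⟩
  · right
    apply Matrix.toLin'.injective
    rw [← hf, h1, map_zero]
    rfl

open scoped ComplexOrder in
/-- The equivariant left inverse of an embedding. -/
lemma Embeds.exists_leftInverse (h : Embeds ν k F) :
    ∃ L : Matrix (Fin ν.dim) (Fin k → Fin 2) ℂ, L * F = 1 ∧
      ∀ g : G, L * tensorPow g.1.1 k = ν.mat g * L := by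
  -- The Gram matrix of the embedding. As the action on V^{⊗k} is unitary, D intertwines ν with its
  -- conjugate dual, and so D⁻¹ F* is equivariant. No averaging is involved, since G may be
  -- infinite.
  set D := F.conjTranspose * F with hD
  have hdet : IsUnit D.det := by
    rw [isUnit_iff_ne_zero]
    intro h0
    obtain ⟨v, hv, hv0⟩ := Matrix.exists_mulVec_eq_zero_iff.mpr h0
    rw [hD, Matrix.conjTranspose_mul_self_mulVec_eq_zero] at hv0
    exact hv (h.inj (by simpa using hv0))
  have hinv : D⁻¹ * D = 1 := Matrix.nonsing_inv_mul D hdet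
  have hinv' : D * D⁻¹ = 1 := Matrix.mul_nonsing_inv D hdet
  refine ⟨D⁻¹ * F.conjTranspose, by rw [Matrix.mul_assoc, hinv], fun g => ?_⟩
  -- the action on `V^{⊗k}` is unitary
  have h1 : F.conjTranspose * tensorPow g.1.1 k =
      (ν.mat g⁻¹).conjTranspose * F.conjTranspose := by
    have h2 := congrArg Matrix.conjTranspose (h.comm g⁻¹)
    rw [Matrix.conjTranspose_mul, Matrix.conjTranspose_mul, conjTranspose_tensorPow,
      show (g⁻¹ : G).1 = (g.1)⁻¹ from rfl, coe_inv_SU2, Matrix.conjTranspose_conjTranspose] at h2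
    exact h2
  have h3 : D * ν.mat g = (ν.mat g⁻¹).conjTranspose * D := by
    rw [hD, Matrix.mul_assoc, ← h.comm, ← Matrix.mul_assoc, h1, Matrix.mul_assoc]
  rw [Matrix.mul_assoc, h1]
  calc D⁻¹ * ((ν.mat g⁻¹).conjTranspose * F.conjTranspose)
      = D⁻¹ * ((ν.mat g⁻¹).conjTranspose * D) * D⁻¹ * F.conjTranspose := by
        simp only [Matrix.mul_assoc]
        rw [← Matrix.mul_assoc D, hinv', Matrix.one_mul]
    _ = _ := by rw [← h3, ← Matrix.mul_assoc D⁻¹, hinv, Matrix.one_mul, Matrix.mul_assoc]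

/-- An embedding of `G^ν` into `V^{⊗k}` together with an equivariant left inverse. -/
structure Split (ν : Irrep G) (k : ℕ) (F : Matrix (Fin k → Fin 2) (Fin ν.dim) ℂ)
    (L : Matrix (Fin ν.dim) (Fin k → Fin 2) ℂ) : Prop extends Embeds ν k F where
  inv : L * F = 1
  comm' : ∀ g : G, L * tensorPow g.1.1 k = ν.mat g * L

lemma Embeds.exists_split (h : Embeds ν k F) : ∃ L, Split ν k F L := by
  obtain ⟨L, h1, h2⟩ := h.exists_leftInverse
  exact ⟨L, h, h1, h2⟩

section
variable {L : Matrix (Fin ν.dim) (Fin k → Fin 2) ℂ}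

lemma Split.idem (h : Split ν k F L) : F * L * (F * L) = F * L := by
  rw [Matrix.mul_assoc, ← Matrix.mul_assoc L, h.inv, Matrix.one_mul]

lemma Split.mul_mem (h : Split ν k F L) : F * L ∈ centralizerAlg G k := by
  rw [mem_centralizerAlg]
  intro g hg
  rw [← Matrix.mul_assoc, h.comm ⟨g, hg⟩, Matrix.mul_assoc, ← h.comm' ⟨g, hg⟩, Matrix.mul_assoc]

/-- The inner factor L x F is an endomorphism of an irreducible module, hence a scalar. -/
lemma Split.min (h : Split ν k F L) {x : TensorEnd k} (hx : x ∈ centralizerAlg G k) :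
    ∃ a : ℂ, F * L * x * (F * L) = a • (F * L) := by
  obtain ⟨a, ha⟩ := ν.schur (A := L * x * F) (fun g => by
    have h1 := mem_centralizerAlg.mp hx g.1 g.2
    rw [← Matrix.mul_assoc, ← Matrix.mul_assoc, ← h.comm', Matrix.mul_assoc L, h1,
      ← Matrix.mul_assoc, Matrix.mul_assoc _ _ F, h.comm, ← Matrix.mul_assoc])
  refine ⟨a, ?_⟩
  calc F * L * x * (F * L) = F * (L * x * F) * L := by simp only [Matrix.mul_assoc]
    _ = _ := by rw [ha, Matrix.mul_smul, Matrix.mul_one, Matrix.smul_mul]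

lemma Split.trace (h : Split ν k F L) : (F * L).trace = ν.dim := by
  rw [Matrix.trace_mul_comm, h.inv, Matrix.trace_one, Fintype.card_fin]

lemma Split.ne_zero (h : Split ν k F L) : F * L ≠ 0 := by
  intro h0
  have h1 := h.trace
  rw [h0, Matrix.trace_zero] at h1
  exact ν.dim_ne_zero (by exact_mod_cast h1.symm)

lemma Split.isProjectionOnto (h : Split ν k F L) : IsProjectionOnto ν k (F * L) := by
  refine ⟨h.mul_mem, h.idem, ?_⟩
  obtain ⟨f, hf⟩ := exists_intertwiningMap h.comm
  refine ⟨f, ?_, ?_⟩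
  · have h1 := h.inj
    rw [← hf] at h1
    exact h1
  · rw [hf, Matrix.toLin'_mul, LinearMap.range_comp_of_range_eq_top]
    rw [LinearMap.range_eq_top]
    intro v
    exact ⟨Matrix.toLin' F v, by rw [← Matrix.toLin'_mul_apply, h.inv]; simp⟩

end

/-- A projection onto a copy of G^ν need not be the orthogonal one, so its right factor is not yet
known to be an equivariant left inverse of the Gram type. That it is follows only in
`Fam.exists_projection`. -/
lemma IsProjectionOnto.exists_embeds {b : TensorEnd k} (hb : IsProjectionOnto ν k b) :
    ∃ (F : Matrix (Fin k → Fin 2) (Fin ν.dim) ℂ) (M : Matrix (Fin ν.dim) (Fin k → Fin 2) ℂ),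
      Embeds ν k F ∧ b * F = F ∧ b = F * M := by
  obtain ⟨f, hf, hr⟩ := hb.range
  have hE := embeds_of_injective hf
  refine ⟨LinearMap.toMatrix' f.toLinearMap, ?_⟩
  obtain ⟨L, hL⟩ := hE.exists_split
  set F := LinearMap.toMatrix' f.toLinearMap
  have hF : Matrix.toLin' F = f.toLinearMap := Matrix.toLin'_toMatrix' _
  refine ⟨L * b, hE, ?_, ?_⟩
  · apply Matrix.toLin'.injective
    refine LinearMap.ext fun v => ?_
    have : Matrix.toLin' F v ∈ LinearMap.range (Matrix.toLin' b) := by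
      rw [← hr, hF]; exact ⟨v, rfl⟩
    obtain ⟨w, hw⟩ := this
    rw [Matrix.toLin'_mul_apply, ← hw, ← Matrix.toLin'_mul_apply, hb.idem]
  · apply Matrix.toLin'.injective
    refine LinearMap.ext fun v => ?_
    have : Matrix.toLin' b v ∈ LinearMap.range (Matrix.toLin' F) := by
      rw [hF, hr]; exact ⟨v, rfl⟩
    obtain ⟨w, hw⟩ := this
    rw [← Matrix.mul_assoc, Matrix.toLin'_mul_apply, ← hw, ← Matrix.toLin'_mul_apply,
      Matrix.mul_assoc, hL.inv, Matrix.mul_one]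

/-! ### New modules -/

lemma ext1_ext1_mul_apply {n : Type} [Fintype n] (x : TensorEnd k)
    (Y : Matrix (Fin (k + 2) → Fin 2) n ℂ) (s : Fin k → Fin 2) (a b : Fin 2) (j : n) :
    (ext1 (k + 1) (ext1 k x) * Y) (snoc (snoc s a) b) j =
      ∑ r, x s r * Y (snoc (snoc r a) b) j := by
  rw [Matrix.mul_apply, sum_snoc, sum_snoc]
  simp [ext1_snoc]

/-- The image of e is V^{⊗k} tensored with the invariant antisymmetric tensor. So e x F amounts to
an equivariant map from G^ν to V^{⊗k}, which vanishes if ν does not occur there. -/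
lemma topE_mul_mul_eq_zero {F : Matrix (Fin (k + 2) → Fin 2) (Fin ν.dim) ℂ}
    (hF : ∀ g : G, tensorPow g.1.1 (k + 2) * F = F * ν.mat g) (hν : ¬ InLevel ν k)
    {x : TensorEnd (k + 2)} (hx : x ∈ centralizerAlg G (k + 2)) : topE k * x * F = 0 := by
  set Y := topE k * x * F with hY
  have hYc : ∀ g : G, ext1 (k + 1) (ext1 k (tensorPow g.1.1 k)) * Y = Y * ν.mat g := by
    intro g
    have h1 := mem_centralizerAlg.mp hx g.1 g.2
    rw [hY, Matrix.mul_assoc, ← Matrix.mul_assoc, ← tensorPow_mul_topE,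
      mem_centralizerAlg.mp (topE_mem G k) g.1 g.2, Matrix.mul_assoc, ← Matrix.mul_assoc _ x, h1,
      Matrix.mul_assoc x, hF]
    simp only [Matrix.mul_assoc]
  have hYe : ∀ r a b j, Y (snoc (snoc r a) b) j = asym a b * Y (snoc (snoc r 0) 1) j := by
    intro r a b j
    have h1 : ∀ a b, Y (snoc (snoc r a) b) j = asym a b *
        ∑ a', ∑ b', asym a' b' * (x * F) (snoc (snoc r a') b') j := by
      intro a b
      rw [hY, Matrix.mul_assoc, Matrix.mul_apply, sum_snoc, sum_snoc]
      simp only [topE_snoc, ite_mul, zero_mul, Fin.sum_univ_two, ite_add_ite, add_zero]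
      rw [Finset.sum_ite_eq Finset.univ r]
      simp only [Finset.mem_univ, if_true]
      ring
    rw [h1 a b, h1 0 1]
    simp [asym]
  -- The coordinates with last two letters 0, 1 determine the whole map, and they form its component
  -- in V^{⊗k}.
  rcases inLevel_or_eq_zero (ν := ν) (k := k)
    (F := Matrix.of fun r j => Y (snoc (snoc r 0) 1) j) (fun g => by
      ext r j
      have h1 := congrFun (congrFun (hYc g) (snoc (snoc r 0) 1)) j
      rw [ext1_ext1_mul_apply] at h1
      exact h1) with h | h
  · exact absurd h hν
  · ext t j
    obtain ⟨t, b, rfl⟩ := exists_snoc t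
    obtain ⟨r, a, rfl⟩ := exists_snoc t
    rw [hYe]
    have h1 := congrFun (congrFun h r) j
    simp only [Matrix.of_apply, Matrix.zero_apply] at h1
    rw [h1, mul_zero, Matrix.zero_apply]

lemma IsNew.old_mul (hν : IsNew ν k) (hF : ∀ g : G, tensorPow g.1.1 k * F = F * ν.mat g)
    {u : TensorEnd k} (hu : u ∈ oldIdeal G k) : u * F = 0 := by
  induction hu using Submodule.span_induction with
  | mem u hu =>
    obtain ⟨y, hy, z, hz, rfl⟩ := hu
    -- For k = 0 and k = 1 the last generator has the default value 0.
    match k, hν, F, hF, y, hy, z, hz with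
    | 0, _, _, _, _, _, _, _ => simp [tl]
    | 1, _, _, _, _, _, _, _ => simp [tl]
    | k + 2, hν, F, hF, y, hy, z, hz =>
      have h1 := topE_mul_mul_eq_zero hF (hν.2 k rfl) hz
      change y * topE k * z * F = 0
      rw [Matrix.mul_assoc y, Matrix.mul_assoc y, h1, Matrix.mul_zero]
  | zero => rw [Matrix.zero_mul]
  | add u v _ _ hu hv => rw [Matrix.add_mul, hu, hv, add_zero]
  | smul a u _ hu => rw [Matrix.smul_mul, hu, smul_zero]

section
variable {ι : Type} [Fintype ι] [DecidableEq ι] {c : ι → TensorEnd k}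

lemma PreFam.sum_mul (h : PreFam G k c) (hν : IsNew ν k)
    (hF : ∀ g : G, tensorPow g.1.1 k * F = F * ν.mat g) : ∑ i, c i * F = F := by
  have h1 := hν.old_mul hF h.one
  rw [Matrix.sub_mul, Matrix.one_mul, Matrix.sum_mul, sub_eq_zero] at h1
  exact h1.symm

/-- The projection P = F L is a combination of the c i, by `Fam.central`. If c i occurs with a
nonzero coefficient, then P c i P is on the one hand a nonzero multiple of c i and on the other a
multiple of P. Two proportional nonzero idempotents are equal. -/
lemma Fam.exists_eq (h : Fam G k c) (hν : IsNew ν k)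
    {L : Matrix (Fin ν.dim) (Fin k → Fin 2) ℂ} (hS : Split ν k F L) : ∃ i, F * L = c i := by
  have hP := hS.mul_mem
  choose a ha ha' using fun i => h.central i hP
  have h1 : F * L = ∑ i, a i • c i := by
    conv_lhs => rw [← h.toPreFam.sum_mul hν hS.comm, Matrix.sum_mul]
    exact Finset.sum_congr rfl fun i _ => by rw [Matrix.mul_assoc, ha]
  obtain ⟨i, hi⟩ : ∃ i, a i • c i ≠ 0 := by
    by_contra! h2
    exact hS.ne_zero (by rw [h1, Finset.sum_eq_zero fun i _ => h2 i])
  obtain ⟨e, he⟩ := hS.min (h.mem i)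
  have h2 : a i ≠ 0 := fun h2 => hi (by rw [h2, zero_smul])
  rw [ha' i, smul_mul_assoc, ha, smul_smul] at he
  have h3 : e ≠ 0 := by
    rintro rfl
    rw [zero_smul, mul_smul] at he
    exact hi ((smul_eq_zero.mp he).resolve_left h2)
  have h4 : F * L = (e⁻¹ * (a i * a i)) • c i := by
    rw [mul_smul, he, smul_smul, inv_mul_cancel₀ h3, one_smul]
  refine ⟨i, ?_⟩
  have h5 := hS.idem
  set t := e⁻¹ * (a i * a i) with ht
  have h6 : t ≠ 0 := by rw [ht]; exact mul_ne_zero (inv_ne_zero h3) (mul_ne_zero h2 h2)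
  rw [h4, smul_mul_smul_comm, h.idem, mul_smul] at h5
  have h7 := smul_right_injective _ h6 h5
  rw [h4]
  exact h7

/-- Uniqueness: two projections onto copies of ν are members c i and c j of the family, and for i ≠
j the isomorphism between the two copies would be a nonzero element of c j Z_k c i. -/
lemma Fam.exists_projection (h : Fam G k c) (hν : IsNew ν k) :
    ∃ i, IsProjectionOnto ν k (c i) ∧ (∀ b, IsProjectionOnto ν k b → b = c i) ∧
      (c i).trace = ν.dim := by
  -- Here `Fam.central` does the work: b commutes with F L, and as the two have the same image they
  -- coincide.
  have key : ∀ b, IsProjectionOnto ν k b → ∃ (F : Matrix (Fin k → Fin 2) (Fin ν.dim) ℂ)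
      (L : Matrix (Fin ν.dim) (Fin k → Fin 2) ℂ), Split ν k F L ∧ b = F * L := by
    intro b hb
    obtain ⟨F, M, hE, h1, h2⟩ := hb.exists_embeds
    obtain ⟨L, hL⟩ := hE.exists_split
    refine ⟨F, L, hL, ?_⟩
    obtain ⟨i, hi⟩ := h.exists_eq hν hL
    obtain ⟨a, ha, ha'⟩ := h.central i hb.mem
    rw [← hi] at ha ha'
    have h3 : F * L * b = b := by
      rw [h2, Matrix.mul_assoc, ← Matrix.mul_assoc L, hL.inv, Matrix.one_mul]
    have h4 : b * (F * L) = F * L := by rw [← Matrix.mul_assoc, h1]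
    rw [← h3, ha, ← ha', h4]
  obtain ⟨f, hf⟩ := hν.1
  obtain ⟨L, hL⟩ := (embeds_of_injective hf).exists_split
  obtain ⟨i, hi⟩ := h.exists_eq hν hL
  refine ⟨i, hi ▸ hL.isProjectionOnto, fun b hb => ?_, hi ▸ hL.trace⟩
  obtain ⟨F', L', hS', hb'⟩ := key b hb
  obtain ⟨j, hj⟩ := h.exists_eq hν hS'
  by_contra hne
  have hji : j ≠ i := by
    rintro rfl
    exact hne (hb'.trans hj)
  set F := LinearMap.toMatrix' f.toLinearMap
  have hx : F' * L ∈ centralizerAlg G k := by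
    rw [mem_centralizerAlg]
    intro g hg
    rw [← Matrix.mul_assoc, hS'.comm ⟨g, hg⟩, Matrix.mul_assoc, ← hL.comm' ⟨g, hg⟩,
      Matrix.mul_assoc]
  have h1 := h.orth j i hji _ hx
  rw [← hi, ← hj] at h1
  have h2 : F' * L' * (F' * L) * (F * L) = F' * L := by
    calc _ = F' * (L' * F') * (L * F) * L := by simp only [Matrix.mul_assoc]
      _ = _ := by rw [hS'.inv, hL.inv, Matrix.mul_one, Matrix.mul_one]
  rw [h2] at h1
  have h3 : F' * L * F = 0 := by rw [h1, Matrix.zero_mul]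
  rw [Matrix.mul_assoc, hL.inv, Matrix.mul_one] at h3
  exact hS'.ne_zero (by rw [h3, Matrix.zero_mul])

end

/-! ### Edges of the representation graph -/

/-- An embedding F of G^ν induces an embedding T of G^ν ⊗ V with image that of F L ⊗ 1, and a left
inverse of T is built from L one last letter at a time. A copy of ν' inside G^ν ⊗ V is transported
along T. -/
lemma Edge.exists_embeds {ν' : Irrep G} (hE : Edge ν ν') {L : Matrix (Fin ν.dim) (Fin k → Fin 2) ℂ}
    (hS : Split ν k F L) : ∃ F', Embeds ν' (k + 1) F' ∧ ext1 k (F * L) * F' = F' := by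
  obtain ⟨f, hf⟩ := hE
  let T : TensorProduct ℂ (Fin ν.dim → ℂ) (Fin 2 → ℂ) →ₗ[ℂ] ((Fin (k + 1) → Fin 2) → ℂ) :=
    TensorProduct.lift (LinearMap.mk₂ ℂ
      (fun x v r => F.mulVec x (fun i => r i.castSucc) * v (r (Fin.last k)))
      (fun x y v => by ext; simp [Matrix.mulVec_add, add_mul])
      (fun a x v => by ext; simp [Matrix.mulVec_smul, mul_assoc])
      (fun x v w => by ext; simp [mul_add])
      (fun a x v => by ext; simp [mul_left_comm]))
  have hT : ∀ x v r a, T (TensorProduct.tmul ℂ x v) (snoc r a) = F.mulVec x r * v a := by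
    intro x v r a
    simp [T, snoc_castSucc, snoc_last]
  let S : ((Fin (k + 1) → Fin 2) → ℂ) →ₗ[ℂ] TensorProduct ℂ (Fin ν.dim → ℂ) (Fin 2 → ℂ) :=
    ∑ a : Fin 2, ((TensorProduct.mk ℂ (Fin ν.dim → ℂ) (Fin 2 → ℂ)).flip (Pi.single a 1)) ∘ₗ
      (Matrix.toLin' L ∘ₗ LinearMap.funLeft ℂ ℂ (fun r : Fin k → Fin 2 => snoc r a))
  have hST : S ∘ₗ T = LinearMap.id := by
    refine TensorProduct.ext' fun x v => ?_
    have h1 : ∀ a, L.mulVec (fun r => T (TensorProduct.tmul ℂ x v) (snoc r a)) = v a • x := by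
      intro a
      have : (fun r => T (TensorProduct.tmul ℂ x v) (snoc r a)) = v a • F.mulVec x := by
        ext r
        rw [hT, Pi.smul_apply, smul_eq_mul, mul_comm]
      rw [this, Matrix.mulVec_smul, Matrix.mulVec_mulVec, hS.inv, Matrix.one_mulVec]
    have h2 : S (T (TensorProduct.tmul ℂ x v)) = ∑ a : Fin 2, TensorProduct.tmul ℂ
        (L.mulVec (fun r => T (TensorProduct.tmul ℂ x v) (snoc r a))) (Pi.single a 1) := by
      simp only [S, LinearMap.sum_apply]
      rfl
    rw [LinearMap.comp_apply, h2, LinearMap.id_apply]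
    simp only [h1, TensorProduct.smul_tmul, ← TensorProduct.tmul_sum]
    congr 1
    ext a
    fin_cases a <;> simp
  have hTc : ∀ g : G, T ∘ₗ (ν.rep.tprod (natRep G)) g =
      Matrix.toLin' (tensorPow g.1.1 (k + 1)) ∘ₗ T := by
    intro g
    refine TensorProduct.ext' fun x v => ?_
    ext t
    obtain ⟨r, a, rfl⟩ := exists_snoc t
    have h1 : (ν.rep.tprod (natRep G)) g (TensorProduct.tmul ℂ x v) =
        TensorProduct.tmul ℂ ((ν.mat g).mulVec x) (g.1.1.mulVec v) := by
      rw [Representation.tprod_apply, TensorProduct.map_tmul, ← ν.toLin'_mat]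
      rfl
    rw [LinearMap.comp_apply, h1, hT, LinearMap.comp_apply, Matrix.toLin'_apply,
      Matrix.mulVec_mulVec, ← hS.comm, ← Matrix.mulVec_mulVec, Matrix.mulVec, Matrix.mulVec,
      Matrix.mulVec, dotProduct, dotProduct, dotProduct, sum_snoc, Finset.sum_mul_sum]
    simp only [tensorPow_snoc, hT]
    exact Finset.sum_congr rfl fun _ _ => Finset.sum_congr rfl fun _ _ => by ring
  let f' : Representation.IntertwiningMap ν'.rep (tensorRep G (k + 1)) :=
    ⟨T ∘ₗ f.toLinearMap, fun g => by
      rw [LinearMap.comp_assoc, f.2 g, ← LinearMap.comp_assoc, hTc]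
      rfl⟩
  have hTi : Function.Injective T := by
    intro x y hxy
    have h1 := congrArg S hxy
    rw [← LinearMap.comp_apply, ← LinearMap.comp_apply, hST] at h1
    exact h1
  have hf' : Function.Injective f' := hTi.comp hf
  refine ⟨_, embeds_of_injective hf', ?_⟩
  have hbT : Matrix.toLin' (ext1 k (F * L)) ∘ₗ T = T := by
    refine TensorProduct.ext' fun x v => ?_
    ext t
    obtain ⟨r, a, rfl⟩ := exists_snoc t
    have h1 : (F * L).mulVec (F.mulVec x) = F.mulVec x := by
      rw [Matrix.mulVec_mulVec, Matrix.mul_assoc, hS.inv, Matrix.mul_one]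
    rw [LinearMap.comp_apply, hT, Matrix.toLin'_apply, Matrix.mulVec, dotProduct, sum_snoc]
    simp only [hT, ext1_snoc, ite_mul, zero_mul, Finset.sum_ite_eq, Finset.mem_univ, if_true]
    conv_rhs => rw [← h1, Matrix.mulVec, dotProduct, Finset.sum_mul]
    exact Finset.sum_congr rfl fun _ _ => by ring
  apply Matrix.toLin'.injective
  rw [Matrix.toLin'_mul, Matrix.toLin'_toMatrix']
  change _ ∘ₗ (T ∘ₗ f.toLinearMap) = T ∘ₗ f.toLinearMap
  rw [← LinearMap.comp_assoc, hbT]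

end McKay

namespace McKay

variable {G : Subgroup SU2} {k : ℕ}

/-! ### The symmetrizers -/

/-- The symmetrizer of `V^{⊗k}`, by the recursion of Jones and Wenzl. -/
def jw : (k : ℕ) → TensorEnd k
  | 0 => 1
  | k + 1 => ext1 k (jw k) -
      ((k : ℂ) / (k + 1)) • (ext1 k (jw k) * tl (k + 1) k * ext1 k (jw k))

lemma jw_zero : jw 0 = 1 := rfl

lemma jw_succ (k : ℕ) : jw (k + 1) = ext1 k (jw k) -
      ((k : ℂ) / (k + 1)) • (ext1 k (jw k) * tl (k + 1) k * ext1 k (jw k)) := rfl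

lemma jw_one : jw 1 = 1 := by
  rw [jw_succ, jw_zero, map_one, tl, dif_neg (by simp)]; simp

lemma tl_mem_temperleyLieb {k i : ℕ} (hi : 1 ≤ i) (hik : i < k) : tl k i ∈ temperleyLieb k :=
  Algebra.subset_adjoin ⟨i, hi, hik, rfl⟩

lemma ext1_mem_temperleyLieb {x : TensorEnd k} (hx : x ∈ temperleyLieb k) :
    ext1 k x ∈ temperleyLieb (k + 1) := by
  have h1 : (temperleyLieb k).map (ext1 k) ≤ temperleyLieb (k + 1) := by
    rw [temperleyLieb, AlgHom.map_adjoin, Algebra.adjoin_le_iff]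
    rintro _ ⟨_, ⟨i, hi, hik, rfl⟩, rfl⟩
    rw [SetLike.mem_coe]
    rw [tl_embed (Nat.le_succ k) hi hik]
    exact tl_mem_temperleyLieb hi (by omega)
  exact h1 ⟨x, hx, rfl⟩

lemma jw_mem_temperleyLieb (k : ℕ) : jw k ∈ temperleyLieb k := by
  induction k with
  | zero => exact one_mem _
  | succ k ih =>
    have h1 : tl (k + 1) k ∈ temperleyLieb (k + 1) := by
      cases k with
      | zero => rw [tl, dif_neg (by simp)]; exact zero_mem _
      | succ k => exact tl_mem_temperleyLieb (by omega) (by omega)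
    exact sub_mem (ext1_mem_temperleyLieb ih) (Subalgebra.smul_mem _ (mul_mem (mul_mem
      (ext1_mem_temperleyLieb ih) h1) (ext1_mem_temperleyLieb ih)) _)

/-- The symmetrizer is 1 plus terms ending in some e_i, so it fixes whatever the e_i kill. -/
lemma embed_jw_mul {N : ℕ} {y : TensorEnd N} (h : ∀ i, 1 ≤ i → i < N → tl N i * y = 0) (m : ℕ)
    (hm : m ≤ N) : embedHom hm (jw m) * y = y := by
  induction m with
  | zero => rw [jw_zero, map_one, one_mul]
  | succ m ih =>
    have h1 : embedHom hm (tl (m + 1) m) * y = 0 := by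
      cases m with
      | zero => simp [tl]
      | succ m => rw [tl_embed hm (by omega) (by omega), h _ (by omega) (by omega)]
    rw [jw_succ, map_sub, map_smul, map_mul, map_mul, embedHom_trans, sub_mul, ih (by omega),
      smul_mul_assoc, mul_assoc, ih (by omega), mul_assoc, h1, mul_zero, smul_zero, sub_zero]

lemma mul_embed_jw {N : ℕ} {y : TensorEnd N} (h : ∀ i, 1 ≤ i → i < N → y * tl N i = 0) (m : ℕ)
    (hm : m ≤ N) : y * embedHom hm (jw m) = y := by
  induction m with
  | zero => rw [jw_zero, map_one, mul_one]
  | succ m ih =>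
    have h1 : y * embedHom hm (tl (m + 1) m) = 0 := by
      cases m with
      | zero => simp [tl]
      | succ m => rw [tl_embed hm (by omega) (by omega), h _ (by omega) (by omega)]
    rw [jw_succ, map_sub, map_smul, map_mul, map_mul, embedHom_trans, mul_sub, ih (by omega),
      mul_smul_comm, ← mul_assoc, ← mul_assoc, ih (by omega), h1, zero_mul, smul_zero, sub_zero]

lemma conjTranspose_jw (k : ℕ) : (jw k).conjTranspose = jw k := by
  induction k with
  | zero => simp [jw_zero]
  | succ k ih =>
    have h1 : (tl (k + 1) k).conjTranspose = tl (k + 1) k := by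
      cases k with
      | zero => simp [tl]
      | succ k => exact conjTranspose_topE k
    rw [jw_succ, Matrix.conjTranspose_sub, Matrix.conjTranspose_smul, Matrix.conjTranspose_mul,
      Matrix.conjTranspose_mul, conjTranspose_ext1, ih, h1, ← mul_assoc]
    congr 2
    simp

/-- The tensor v_{-1} ⊗ ⋯ ⊗ v_{-1} is symmetric. One row of the symmetrizer is thus explicit, which
allows operators of the form `jw` X to be told from multiples of `jw` by a single entry. -/
lemma jw_row_zero (k : ℕ) (s : Fin k → Fin 2) :
    jw k (fun _ => 0) s = if (fun _ => 0) = s then 1 else 0 := by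
  induction k with
  | zero => rw [jw_zero, Matrix.one_apply]
  | succ k ih =>
    have h0 : (fun _ => 0 : Fin (k + 1) → Fin 2) = snoc (fun _ => 0) 0 := by
      funext i
      refine Fin.lastCases ?_ (fun i => ?_) i
      · rw [snoc_last]
      · rw [snoc_castSucc]
    have h1 : ∀ Y : TensorEnd (k + 1), (tl (k + 1) k * Y) (snoc (fun _ => 0) 0) s = 0 := by
      intro Y
      cases k with
      | zero => simp [tl]
      | succ k =>
        have h2 : (fun _ => 0 : Fin (k + 1) → Fin 2) = snoc (fun _ => 0) 0 := by
          funext i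
          refine Fin.lastCases ?_ (fun i => ?_) i
          · rw [snoc_last]
          · rw [snoc_castSucc]
        rw [h2]
        change (topE k * Y) _ _ = 0
        rw [topE_mul_snoc]
        simp [asym]
    have h3 : ∀ Y : TensorEnd (k + 1), (ext1 k (jw k) * Y) (snoc (fun _ => 0) 0) s =
        Y (snoc (fun _ => 0) 0) s := by
      intro Y
      rw [Matrix.mul_apply, sum_snoc]
      simp [ext1_snoc, ih]
    rw [h0, jw_succ, Matrix.sub_apply, Matrix.smul_apply, mul_assoc, h3, h1, smul_zero, sub_zero]
    obtain ⟨s, a, rfl⟩ := exists_snoc s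
    rw [ext1_snoc, ih]
    simp only [snoc_inj]
    by_cases h4 : (fun _ => 0) = s <;> by_cases h5 : 0 = a <;> simp [h4, h5]

/-- The symmetric power `Sym^k V` is irreducible (or zero) as a `G`-module. -/
def SymIrred (G : Subgroup SU2) (k : ℕ) : Prop :=
  ∀ x ∈ centralizerAlg G k, ∃ a : ℂ, jw k * x * jw k = a • jw k

lemma PreFam.toFam {c : TensorEnd k} (h : PreFam G k fun _ : Fin 1 => c)
    (h1 : ∀ x ∈ centralizerAlg G k, ∃ a : ℂ, c * x * c = a • c) : Fam G k fun _ : Fin 1 => c :=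
  ⟨h, fun _ => h1, fun i j hij => absurd (Subsingleton.elim i j) hij⟩

lemma child_jw {k : ℕ} (h1 : (jw k).trace = k + 1) (h2 : (jw (k + 1)).trace = (k + 1 : ℕ) + 1) :
    child (jw (k + 1)) (jw k) = jw (k + 2) := by
  rw [child, h1, h2, jw_succ (k + 1)]
  push_cast
  rfl

/-- The statements are proved together: the coefficient in `jw` agrees with the quotient of traces
in `child` only once the traces of the two preceding symmetrizers are known. Irreducibility is
needed strictly below n. -/
lemma jw_preFam_and_trace (n : ℕ) (hS : ∀ k < n, SymIrred G k) :
    PreFam G n (fun _ : Fin 1 => jw n) ∧ (jw n).trace = n + 1 ∧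
      (∀ m, n = m + 1 → ∀ x : TensorEnd m, x = jw m → ext1 m x * jw (m + 1) = jw (m + 1) ∧
        jw (m + 1) * ext1 m x = jw (m + 1)) := by
  induction n using Nat.strong_induction_on with
  | _ n ih =>
    have hpar : ∀ m, n = m + 1 → ∀ x : TensorEnd m, x = jw m → ext1 m x * jw (m + 1) = jw (m + 1) ∧
        jw (m + 1) * ext1 m x = jw (m + 1) := by
      rintro m rfl x rfl
      have h1 := ((ih m (by omega)) (fun k hk => hS k (by omega))).1.idem 0
      have h2 : ext1 m (jw m) * ext1 m (jw m) = ext1 m (jw m) := by rw [← map_mul, h1]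
      constructor
      · rw [jw_succ, mul_sub, mul_smul_comm, h2, ← mul_assoc, ← mul_assoc, h2]
      · rw [jw_succ, sub_mul, smul_mul_assoc, h2, mul_assoc (_ * _), h2]
    refine ⟨?_, ?_, hpar⟩
    · match n, ih, hS, hpar with
      | 0, _, _, _ =>
        refine ⟨fun _ => one_mem _, fun i j => ?_, fun _ x _ => ?_, fun _ x _ => ?_, ?_⟩
        · simp [jw_zero, Subsingleton.elim i j]
        · simp [tl]
        · simp [tl]
        · simp [jw_zero]
      | 1, _, _, _ =>
        refine ⟨fun _ => jw_one ▸ one_mem _, fun i j => ?_, fun _ x _ => ?_, fun _ x _ => ?_, ?_⟩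
        · simp [jw_one, Subsingleton.elim i j]
        · simp [tl]
        · simp [tl]
        · simp [jw_one]
      | n + 2, ih, hS, _ =>
        obtain ⟨h1, h2, -⟩ := ih n (by omega) fun k hk => hS k (by omega)
        obtain ⟨h3, h4, h5⟩ := ih (n + 1) (by omega) fun k hk => hS k (by omega)
        have h6 := (h3.toFam (hS (n + 1) (by omega))).preFam_child (p := fun _ => jw n)
          (fun _ => ⟨h1.mem 0, h1.idem 0, hS n (by omega), (h5 n rfl _ rfl).1, (h5 n rfl _ rfl).2⟩)
        simpa only [child_jw h2 h4] using h6
    · match n, ih, hS with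
      | 0, _, _ => simp [jw_zero]
      | 1, _, _ =>
        rw [jw_one, Matrix.trace_one]
        norm_num
      | n + 2, ih, hS =>
        obtain ⟨h1, h2, -⟩ := ih n (by omega) fun k hk => hS k (by omega)
        obtain ⟨h3, h4, h5⟩ := ih (n + 1) (by omega) fun k hk => hS k (by omega)
        rw [← child_jw h2 h4, trace_child (h3.idem 0), h2, h4]
        · push_cast; ring
        · intro h0
          rw [h0, Matrix.trace_zero] at h4
          have : ((n + 2 : ℕ) : ℂ) = 0 := by push_cast at h4 ⊢; linear_combination -h4
          exact absurd (Nat.cast_eq_zero.mp this) (by omega)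

/-! ### Symmetrizers below the branch node; harmonic endomorphisms and the splitting of Sym^{n+1} V
-/

section
variable {n : ℕ}

lemma jw_preFam (hS : ∀ k < n, SymIrred G k) : PreFam G n (fun _ : Fin 1 => jw n) :=
  (jw_preFam_and_trace n hS).1

lemma jw_fam (hS : ∀ k ≤ n, SymIrred G k) : Fam G n (fun _ : Fin 1 => jw n) :=
  (jw_preFam fun k hk => hS k hk.le).toFam (hS n le_rfl)

lemma trace_jw (hS : ∀ k < n, SymIrred G k) : (jw n).trace = n + 1 :=
  (jw_preFam_and_trace n hS).2.1

lemma jw_isParent (hS : ∀ k ≤ n, SymIrred G k) : IsParent G n (jw n) (jw (n + 1)) := by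
  have h := (jw_preFam_and_trace (n + 1) fun k hk => hS k (by omega)).2.2 n rfl _ rfl
  have h1 := jw_fam hS
  exact ⟨h1.mem 0, h1.idem 0, hS n le_rfl, h.1, h.2⟩

lemma jw_ne_zero (hS : ∀ k < n, SymIrred G k) : jw n ≠ 0 := by
  intro h
  have h1 := trace_jw hS
  rw [h, Matrix.trace_zero] at h1
  have : ((n + 1 : ℕ) : ℂ) = 0 := by push_cast; exact h1.symm
  exact absurd (Nat.cast_eq_zero.mp this) (by omega)

/-- The endomorphisms of `V^{⊗k}` that correspond to `G`-invariants in `Sym^{2k} V`. -/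
structure Harmonic (G : Subgroup SU2) (k : ℕ) (y : TensorEnd (k + 1)) : Prop where
  mem : y ∈ centralizerAlg G (k + 1)
  tl_mul : ∀ i, 1 ≤ i → i < k + 1 → tl (k + 1) i * y = 0
  mul_tl : ∀ i, 1 ≤ i → i < k + 1 → y * tl (k + 1) i = 0
  ptr_eq : ptr y = 0

/-- An endomorphism of `Sym^{n+1} V` is harmonic up to a multiple of the identity. -/
lemma exists_harmonic (hS : ∀ k ≤ n, SymIrred G k) {y : TensorEnd (n + 1)}
    (hy : y ∈ centralizerAlg G (n + 1)) (h1 : jw (n + 1) * y = y) (h2 : y * jw (n + 1) = y) :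
    ∃ a : ℂ, Harmonic G n (y - a • jw (n + 1)) := by
  have hF := jw_preFam (n := n + 1) fun k hk => hS k (by omega)
  have hP := jw_isParent hS
  -- The partial trace of y is fixed by `jw n` on both sides, so irreducibility of Sym^n V makes it
  -- a multiple of `jw n`.
  obtain ⟨a, ha⟩ := hS n le_rfl _ (ptr_mem hy)
  rw [← ptr_ext1_mul, ← ptr_mul_ext1, ← h1, ← mul_assoc, hP.left, h1, ← h2, mul_assoc, hP.right,
    h2] at ha
  have hn : ∀ m : ℕ, ((m + 1 : ℕ) : ℂ) ≠ 0 := fun m => Nat.cast_ne_zero.mpr (by omega)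
  have hr := hP.ptr_eq (hF.mem 0)
  rw [trace_jw fun k hk => hS k hk.le, trace_jw fun k hk => hS k (by omega)] at hr
  -- The partial trace of `jw (n + 1)` is (n + 2)/(n + 1) times `jw n`, a quotient of dimensions;
  -- its inverse occurs here.
  refine ⟨a * ((n + 1 : ℕ) / ((n + 1 : ℕ) + 1)), sub_mem hy (Subalgebra.smul_mem _ (hF.mem 0) _),
    fun i hi hi' => ?_, fun i hi hi' => ?_, ?_⟩
  · rw [mul_sub, mul_smul_comm, hF.tl_mul 0 hi hi', ← h1, ← mul_assoc, hF.tl_mul 0 hi hi']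
    simp
  · rw [sub_mul, smul_mul_assoc, hF.mul_tl 0 hi hi', ← h2, mul_assoc, hF.mul_tl 0 hi hi']
    simp
  · have h3 : ∀ (u v : TensorEnd (n + 1)) (z : ℂ), ptr (u - z • v) = ptr u - z • ptr v := by
      intro u v z
      ext r s
      simp only [ptr_apply, Matrix.sub_apply, Matrix.smul_apply, Finset.sum_sub_distrib,
        Finset.smul_sum]
    rw [h3, ha, hr, smul_smul, ← sub_smul]
    have h4 := hn n
    have h5 := hn (n + 1)
    push_cast at h4 h5 ⊢
    rw [mul_assoc, div_mul_div_cancel₀ (by rwa [add_assoc, one_add_one_eq_two] at *), div_self h4]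
    simp

lemma symIrred_succ (hS : ∀ k ≤ n, SymIrred G k) (h : ∀ y, Harmonic G n y → y = 0) :
    SymIrred G (n + 1) := by
  intro x hx
  have hF := jw_preFam (n := n + 1) fun k hk => hS k (by omega)
  obtain ⟨a, ha⟩ := exists_harmonic hS (mul_mem (mul_mem (hF.mem 0) hx) (hF.mem 0))
    (by rw [← mul_assoc, ← mul_assoc, hF.idem 0]) (by rw [mul_assoc, hF.idem 0])
  exact ⟨a, sub_eq_zero.mp (h _ ha)⟩

lemma Harmonic.jw_mul {y : TensorEnd (n + 1)} (h : Harmonic G n y) :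
    jw (n + 1) * y = y ∧ y * jw (n + 1) = y := by
  have h1 := embed_jw_mul h.tl_mul (n + 1) le_rfl
  have h2 := mul_embed_jw h.mul_tl (n + 1) le_rfl
  rw [embedHom_apply, embed_self] at h1 h2
  exact ⟨h1, h2⟩

lemma Harmonic.trace_eq {y : TensorEnd (n + 1)} (h : Harmonic G n y) : y.trace = 0 := by
  rw [← trace_ptr, h.ptr_eq, Matrix.trace_zero]

/-- If `Sym^k V` is irreducible for `k ≤ n` and its endomorphism algebra for `k = n + 1` is
two-dimensional, then `Sym^{n+1} V` is the sum of two inequivalent irreducible modules. -/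
lemma exists_fam_two (hS : ∀ k ≤ n, SymIrred G k)
    (hU : ∀ y z, Harmonic G n y → Harmonic G n z → y ≠ 0 → ∃ a : ℂ, z = a • y)
    {y : TensorEnd (n + 1)} (hy : Harmonic G n y) (hy0 : y ≠ 0) :
    ∃ b : Fin 2 → TensorEnd (n + 1), Fam G (n + 1) b ∧ b 0 + b 1 = jw (n + 1) ∧
      (∀ i, b i ≠ 0) := by
  have hF := jw_preFam (n := n + 1) fun k hk => hS k (by omega)
  set c := jw (n + 1) with hc
  have hcc : c * c = c := hF.idem 0
  obtain ⟨h1, h2⟩ : c * y = y ∧ y * c = y := hy.jw_mul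
  have hspan : ∀ x ∈ centralizerAlg G (n + 1), ∃ a a' : ℂ, c * x * c = a • c + a' • y := by
    intro x hx
    obtain ⟨a, ha⟩ := exists_harmonic hS (mul_mem (mul_mem (hF.mem 0) hx) (hF.mem 0))
      (by rw [← mul_assoc, ← mul_assoc, hF.idem 0]) (by rw [mul_assoc, hF.idem 0])
    obtain ⟨a', ha'⟩ := hU _ _ hy ha hy0
    exact ⟨a, a', by rw [← ha', add_sub_cancel]⟩
  -- A harmonic endomorphism has trace zero, and the symmetrizer has not.
  have hyc : ∀ a : ℂ, y ≠ a • c := by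
    intro a ha
    have h3 := hy.trace_eq
    rw [ha, Matrix.trace_smul, smul_eq_mul, mul_eq_zero] at h3
    rcases h3 with h3 | h3
    · rw [h3, zero_smul] at ha
      exact hy0 ha
    · exact jw_ne_zero (n := n + 1) (fun k hk => hS k (by omega)) (eq_zero_of_trace hcc h3)
  obtain ⟨p, q, hpq⟩ := hspan _ (mul_mem hy.mem hy.mem)
  rw [← mul_assoc, h1, mul_assoc, h2] at hpq
  -- the roots of the quadratic polynomial of `y`
  obtain ⟨s, hs⟩ := IsAlgClosed.exists_pow_nat_eq (q ^ 2 + 4 * p) (n := 2) two_pos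
  set u := (q + s) / 2 with hu
  set v := (q - s) / 2 with hv
  have huv : (y - u • c) * (y - v • c) = 0 := by
    have e1 : u + v = q := by rw [hu, hv]; ring
    have e2 : u * v = -p := by rw [hu, hv]; linear_combination -(1 / 4) * hs
    have : (y - u • c) * (y - v • c) = y * y - (u + v) • y + (u * v) • c := by
      simp only [sub_mul, mul_sub, smul_mul_assoc, mul_smul_comm, h1, h2, hcc, smul_smul, add_smul,
        smul_sub]
      rw [mul_comm v u]
      abel
    rw [this, hpq, e1, e2, neg_smul]
    abel
  have hcomm : (y - v • c) * (y - u • c) = (y - u • c) * (y - v • c) := by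
    simp only [sub_mul, mul_sub, smul_mul_assoc, mul_smul_comm, h1, h2, hcc, smul_smul, smul_sub]
    rw [mul_comm v u]
    abel
  -- A double root would make N = y - u c a nonzero element of square zero. But the corner c Z c,
  -- spanned by c and N, is closed under adjoints, so N* N is a multiple of N. It is self-adjoint of
  -- square zero, hence zero, and then N = 0.
  have hne : u ≠ v := by
    intro h
    rw [← h] at huv
    set N := y - u • c with hN
    have hNm : N ∈ centralizerAlg G (n + 1) :=
      sub_mem hy.mem (Subalgebra.smul_mem _ (hF.mem 0) _)
    have hcN : c * N = N := by rw [hN, mul_sub, mul_smul_comm, hcc, h1]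
    have hNc : N * c = N := by rw [hN, sub_mul, smul_mul_assoc, hcc, h2]
    obtain ⟨a, a', ha⟩ := hspan _ (conjTranspose_mem hNm)
    have h3 : c * N.conjTranspose * c = N.conjTranspose := by
      have : c.conjTranspose = c := conjTranspose_jw _
      rw [← this, mul_assoc, ← Matrix.conjTranspose_mul, hcN, ← Matrix.conjTranspose_mul, hNc]
    have h4 : N.conjTranspose = (a + a' * u) • c + a' • N := by
      rw [← h3, ha, hN, smul_sub, smul_smul, add_smul]
      abel
    have h5 : N.conjTranspose * N = (a + a' * u) • N := by
      rw [h4, add_mul, smul_mul_assoc, smul_mul_assoc, hcN, huv, smul_zero, add_zero]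
    have h6 : N.conjTranspose * N = 0 := by
      open scoped ComplexOrder in
      have h7 : (N.conjTranspose * N).conjTranspose * (N.conjTranspose * N) = 0 := by
        rw [Matrix.conjTranspose_mul, Matrix.conjTranspose_conjTranspose, h5, mul_smul_comm,
          smul_mul_assoc, huv, smul_zero, smul_zero]
      exact Matrix.conjTranspose_mul_self_eq_zero.mp h7
    have h8 : N = 0 := by
      open scoped ComplexOrder in
      exact Matrix.conjTranspose_mul_self_eq_zero.mp h6
    exact hyc u (sub_eq_zero.mp h8)
  have huv0 : u - v ≠ 0 := sub_ne_zero.mpr hne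
  -- The spectral idempotents of y, by Lagrange interpolation at its two eigenvalues.
  set b₀ := (u - v)⁻¹ • (y - v • c) with hb₀
  set b₁ := (v - u)⁻¹ • (y - u • c) with hb₁
  have hsum : b₀ + b₁ = c := by
    have h3 : (v - u)⁻¹ = -(u - v)⁻¹ := by rw [← neg_sub, inv_neg]
    rw [hb₀, hb₁, h3, neg_smul, ← sub_eq_add_neg, ← smul_sub, sub_sub_sub_cancel_left, ← sub_smul,
      smul_smul, inv_mul_cancel₀ huv0, one_smul]
  have h01 : b₀ * b₁ = 0 := by
    rw [hb₀, hb₁, smul_mul_smul_comm, hcomm, huv, smul_zero]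
  have h10 : b₁ * b₀ = 0 := by
    rw [hb₀, hb₁, smul_mul_smul_comm, huv, smul_zero]
  have hcb₀ : c * b₀ = b₀ := by rw [hb₀, mul_smul_comm, mul_sub, mul_smul_comm, hcc, h1]
  have hb₀c : b₀ * c = b₀ := by rw [hb₀, smul_mul_assoc, sub_mul, smul_mul_assoc, hcc, h2]
  have hcb₁ : c * b₁ = b₁ := by rw [hb₁, mul_smul_comm, mul_sub, mul_smul_comm, hcc, h1]
  have hb₁c : b₁ * c = b₁ := by rw [hb₁, smul_mul_assoc, sub_mul, smul_mul_assoc, hcc, h2]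
  have h00 : b₀ * b₀ = b₀ := by
    conv_rhs => rw [← hb₀c, ← hsum, mul_add, h01, add_zero]
  have h11 : b₁ * b₁ = b₁ := by
    conv_rhs => rw [← hb₁c, ← hsum, mul_add, h10, zero_add]
  have hyb : y = u • b₀ + v • b₁ := by
    have h3 : (v - u)⁻¹ = -(u - v)⁻¹ := by rw [← neg_sub, inv_neg]
    rw [hb₀, hb₁, h3]
    match_scalars
    · field_simp
      ring
    · ring
  have hcm : ∀ a : ℂ, y - a • c ∈ centralizerAlg G (n + 1) := fun a =>
    sub_mem hy.mem (Subalgebra.smul_mem _ (hF.mem 0) _)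
  have hb₀m : b₀ ∈ centralizerAlg G (n + 1) := Subalgebra.smul_mem _ (hcm v) _
  have hb₁m : b₁ ∈ centralizerAlg G (n + 1) := Subalgebra.smul_mem _ (hcm u) _
  have hall : ∀ x ∈ centralizerAlg G (n + 1), ∃ a a' : ℂ, c * x * c = a • b₀ + a' • b₁ := by
    intro x hx
    obtain ⟨a, a', ha⟩ := hspan x hx
    refine ⟨a + a' * u, a + a' * v, ?_⟩
    rw [ha, ← hsum, hyb]
    simp only [add_smul, smul_add, mul_smul]
    abel
  have hsand : ∀ (d d' x : TensorEnd (n + 1)), d * c = d → c * d' = d' →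
      d * x * d' = d * (c * x * c) * d' := by
    intro d d' x h h'
    conv_lhs => rw [← h, ← h']
    simp only [mul_assoc]
  refine ⟨![b₀, b₁], ⟨⟨?_, ?_, ?_, ?_, ?_⟩, ?_, ?_⟩, hsum, ?_⟩
  · intro i; fin_cases i
    · exact hb₀m
    · exact hb₁m
  · intro i j
    fin_cases i <;> fin_cases j
    · simpa using h00
    · simpa using h01
    · simpa using h10
    · simpa using h11
  · intro i x hx
    have h3 := hF.left 0 x hx
    have key : ∀ d, d * c = d → d * x * tl (n + 1) (n + 1 - 1) = 0 := fun d hd => by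
      rw [← hd, mul_assoc, mul_assoc, ← mul_assoc c, h3, mul_zero]
    fin_cases i
    · exact key _ hb₀c
    · exact key _ hb₁c
  · intro i x hx
    have h3 := hF.right 0 x hx
    have key : ∀ d, c * d = d → tl (n + 1) (n + 1 - 1) * x * d = 0 := fun d hd => by
      rw [← hd, ← mul_assoc, h3, zero_mul]
    fin_cases i
    · exact key _ hcb₀
    · exact key _ hcb₁
  · have h3 := hF.one
    simpa [← hsum] using h3
  · intro i x hx
    obtain ⟨a, a', ha⟩ := hall x hx
    fin_cases i
    · refine ⟨a, ?_⟩
      change b₀ * x * b₀ = a • b₀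
      rw [hsand _ _ _ hb₀c hcb₀, ha]
      simp [mul_add, add_mul, h00, h01]
    · refine ⟨a', ?_⟩
      change b₁ * x * b₁ = a' • b₁
      rw [hsand _ _ _ hb₁c hcb₁, ha]
      simp [mul_add, add_mul, h11, h10]
  · intro i j hij x hx
    obtain ⟨a, a', ha⟩ := hall x hx
    fin_cases i <;> fin_cases j
    · exact absurd rfl hij
    · change b₀ * x * b₁ = 0
      rw [hsand _ _ _ hb₀c hcb₁, ha]
      simp [mul_add, add_mul, h00, h01]
    · change b₁ * x * b₀ = 0
      rw [hsand _ _ _ hb₁c hcb₀, ha]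
      simp [mul_add, add_mul, h11, h10]
    · exact absurd rfl hij
  · intro i
    fin_cases i
    · intro h0
      change b₀ = 0 at h0
      rw [hb₀, smul_eq_zero, sub_eq_zero] at h0
      exact hyc v (h0.resolve_left (inv_ne_zero huv0))
    · intro h0
      change b₁ = 0 at h0
      rw [hb₁, smul_eq_zero, sub_eq_zero] at h0
      exact hyc u (h0.resolve_left (inv_ne_zero (by rw [← neg_sub]; exact neg_ne_zero.mpr huv0)))

end

end McKay

/-! ### Reduction to the standard groups and to invariant binary forms -/

namespace McKay

variable {k : ℕ}

/-! ### Conjugate subgroups -/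

section
variable {S : Subgroup SU2} (u : SU2)

/-- Conjugation by `u^{⊗k}`. -/
def conjBy (u : SU2) (k : ℕ) (x : TensorEnd k) : TensorEnd k :=
  tensorPow u.1 k * x * tensorPow (u⁻¹).1 k

lemma conjBy_mul (x y : TensorEnd k) : conjBy u k (x * y) = conjBy u k x * conjBy u k y := by
  simp only [conjBy, mul_assoc]
  rw [← mul_assoc (tensorPow (u⁻¹).1 k) (tensorPow u.1 k), tensorPow_inv_mul, one_mul]

lemma conjBy_one : conjBy u k 1 = 1 := by rw [conjBy, mul_one, tensorPow_mul_inv]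

lemma conjBy_add (x y : TensorEnd k) : conjBy u k (x + y) = conjBy u k x + conjBy u k y := by
  simp only [conjBy, mul_add, add_mul]

lemma conjBy_sub (x y : TensorEnd k) : conjBy u k (x - y) = conjBy u k x - conjBy u k y := by
  simp only [conjBy, mul_sub, sub_mul]

lemma conjBy_smul (a : ℂ) (x : TensorEnd k) : conjBy u k (a • x) = a • conjBy u k x := by
  simp only [conjBy, mul_smul_comm, smul_mul_assoc]

lemma conjBy_zero : conjBy u k 0 = 0 := by simp [conjBy]

lemma conjBy_sum {ι : Type} (s : Finset ι) (c : ι → TensorEnd k) :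
    conjBy u k (∑ i ∈ s, c i) = ∑ i ∈ s, conjBy u k (c i) := by
  simp only [conjBy, Finset.mul_sum, Finset.sum_mul]

lemma conjBy_inv (x : TensorEnd k) : conjBy u k (conjBy u⁻¹ k x) = x := by
  simp only [conjBy, inv_inv, mul_assoc]
  rw [tensorPow_mul_inv, mul_one, ← mul_assoc, tensorPow_mul_inv, one_mul]

lemma conjBy_injective : Function.Injective (conjBy u k) := by
  intro x y h
  have h1 := congrArg (conjBy u⁻¹ k) h
  have h2 := conjBy_inv (k := k) u⁻¹
  rw [inv_inv] at h2
  rwa [h2, h2] at h1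

lemma trace_conjBy (x : TensorEnd k) : (conjBy u k x).trace = x.trace := by
  rw [conjBy, Matrix.trace_mul_comm, ← mul_assoc, tensorPow_inv_mul, one_mul]

/-- Applied to the e_i and the symmetrizers, which commute with all of SU₂ and hence are the same
for conjugate subgroups. -/
lemma conjBy_of_mem_top {x : TensorEnd k} (hx : x ∈ centralizerAlg ⊤ k) : conjBy u k x = x := by
  rw [conjBy, mem_centralizerAlg.mp hx u (Subgroup.mem_top u), mul_assoc, tensorPow_mul_inv,
    mul_one]

lemma conjBy_mem {x : TensorEnd k} (hx : x ∈ centralizerAlg S k) :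
    conjBy u k x ∈ centralizerAlg (S.map (MulAut.conj u).toMonoidHom) k := by
  rw [mem_centralizerAlg] at hx ⊢
  rintro _ ⟨g, hg, rfl⟩
  have h1 : ((MulAut.conj u).toMonoidHom g : SU2).1 = u.1 * g.1 * (u⁻¹).1 := rfl
  have h2 : tensorPow ((MulAut.conj u).toMonoidHom g : SU2).1 k = conjBy u k (tensorPow g.1 k) := by
    rw [h1, tensorPow_mul, tensorPow_mul, conjBy]
  rw [h2, ← conjBy_mul, hx g hg, conjBy_mul]

lemma map_conj_inv : (S.map (MulAut.conj u).toMonoidHom).map (MulAut.conj u⁻¹).toMonoidHom = S := by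
  rw [Subgroup.map_map]
  convert Subgroup.map_id S using 2
  ext x : 1
  change u⁻¹ * (u * x * u⁻¹) * (u⁻¹)⁻¹ = x
  group

lemma exists_conjBy {x : TensorEnd k}
    (hx : x ∈ centralizerAlg (S.map (MulAut.conj u).toMonoidHom) k) :
    ∃ y ∈ centralizerAlg S k, x = conjBy u k y := by
  refine ⟨conjBy u⁻¹ k x, ?_, (conjBy_inv u x).symm⟩
  have h1 := conjBy_mem u⁻¹ hx
  rwa [map_conj_inv] at h1

lemma conjBy_tl_last : conjBy u k (tl k (k - 1)) = tl k (k - 1) :=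
  conjBy_of_mem_top u (tl_last_mem ⊤ k)

lemma conjBy_mem_oldIdeal {x : TensorEnd k} (hx : x ∈ oldIdeal S k) :
    conjBy u k x ∈ oldIdeal (S.map (MulAut.conj u).toMonoidHom) k := by
  induction hx using Submodule.span_induction with
  | mem x hx =>
    obtain ⟨y, hy, z, hz, rfl⟩ := hx
    exact Submodule.subset_span ⟨_, conjBy_mem u hy, _, conjBy_mem u hz, by
      rw [conjBy_mul, conjBy_mul, conjBy_tl_last]⟩
  | zero => rw [conjBy_zero]; exact zero_mem _
  | add x y _ _ hx hy => rw [conjBy_add]; exact add_mem hx hy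
  | smul a x _ hx => rw [conjBy_smul]; exact Submodule.smul_mem _ _ hx

lemma Fam.conj {ι : Type} [Fintype ι] [DecidableEq ι] {c : ι → TensorEnd k} (h : Fam S k c) :
    Fam (S.map (MulAut.conj u).toMonoidHom) k fun i => conjBy u k (c i) where
  mem i := conjBy_mem u (h.mem i)
  mul i j := by
    rw [← conjBy_mul, h.mul]
    split_ifs
    · rfl
    · exact conjBy_zero u
  left i x hx := by
    obtain ⟨y, hy, rfl⟩ := exists_conjBy u hx
    rw [← conjBy_tl_last u, ← conjBy_mul, ← conjBy_mul, h.left i y hy, conjBy_zero]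
  right i x hx := by
    obtain ⟨y, hy, rfl⟩ := exists_conjBy u hx
    rw [← conjBy_tl_last u, ← conjBy_mul, ← conjBy_mul, h.right i y hy, conjBy_zero]
  one := by
    rw [← conjBy_one u, ← conjBy_sum, ← conjBy_sub]
    exact conjBy_mem_oldIdeal u h.one
  min i x hx := by
    obtain ⟨y, hy, rfl⟩ := exists_conjBy u hx
    obtain ⟨a, ha⟩ := h.min i y hy
    exact ⟨a, by rw [← conjBy_mul, ← conjBy_mul, ha, conjBy_smul]⟩
  orth i j hij x hx := by
    obtain ⟨y, hy, rfl⟩ := exists_conjBy u hx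
    rw [← conjBy_mul, ← conjBy_mul, h.orth i j hij y hy, conjBy_zero]

lemma temperleyLieb_le (G : Subgroup SU2) (k : ℕ) : temperleyLieb k ≤ centralizerAlg G k := by
  rw [temperleyLieb, Algebra.adjoin_le_iff]
  rintro _ ⟨i, hi, hik, rfl⟩
  exact tl_mem G hi hik

lemma conjBy_jw : conjBy u k (jw k) = jw k :=
  conjBy_of_mem_top u (temperleyLieb_le ⊤ k (jw_mem_temperleyLieb k))

lemma SymIrred.conj (h : SymIrred S k) : SymIrred (S.map (MulAut.conj u).toMonoidHom) k := by
  intro x hx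
  obtain ⟨y, hy, rfl⟩ := exists_conjBy u hx
  obtain ⟨a, ha⟩ := h y hy
  refine ⟨a, ?_⟩
  rw [← conjBy_jw u, ← conjBy_mul, ← conjBy_mul, ha, conjBy_smul]

lemma mem_centralizerAlg_closure {T : Set SU2} {x : TensorEnd k} :
    x ∈ centralizerAlg (Subgroup.closure T) k ↔
      ∀ g ∈ T, tensorPow (g : SU2).1 k * x = x * tensorPow g.1 k := by
  rw [mem_centralizerAlg]
  refine ⟨fun h g hg => h g (Subgroup.subset_closure hg), fun h g hg => ?_⟩
  induction hg using Subgroup.closure_induction with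
  | mem g hg => exact h g hg
  | one => rw [Submonoid.coe_one, tensorPow_one, one_mul, mul_one]
  | mul g g' _ _ hg hg' =>
    rw [Submonoid.coe_mul, tensorPow_mul, mul_assoc, hg', ← mul_assoc, hg, mul_assoc]
  | inv g _ hg =>
    have h1 := congrArg (fun z => tensorPow (g⁻¹).1 k * z * tensorPow (g⁻¹).1 k) hg
    simp only [mul_assoc] at h1
    rw [tensorPow_mul_inv, mul_one, ← mul_assoc _ (tensorPow g.1 k), tensorPow_inv_mul,
      one_mul] at h1
    exact h1.symm

end

/-! ### Weights -/

/-- The number of letters `1` in the index `r`. -/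
def cnt (r : Fin k → Fin 2) : ℕ := ∑ i, (r i).val

lemma cnt_snoc (r : Fin k → Fin 2) (a : Fin 2) : cnt (snoc r a) = cnt r + a.val := by
  simp [cnt, Fin.sum_univ_castSucc, snoc_castSucc, snoc_last]

lemma cnt_le (r : Fin k → Fin 2) : cnt r ≤ k := by
  induction k with
  | zero => simp [cnt]
  | succ k ih =>
    obtain ⟨r, a, rfl⟩ := exists_snoc r
    have := ih r
    have := a.2
    rw [cnt_snoc]
    omega

lemma exists_cnt_eq {m : ℕ} (h : m ≤ k) : ∃ r : Fin k → Fin 2, cnt r = m := by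
  induction k generalizing m with
  | zero => exact ⟨fun _ => 0, by simp [cnt]; omega⟩
  | succ k ih =>
    cases m with
    | zero => exact ⟨fun _ => 0, by simp [cnt]⟩
    | succ m =>
      obtain ⟨r, hr⟩ := ih (show m ≤ k by omega)
      exact ⟨snoc r 1, by rw [cnt_snoc, hr]; rfl⟩

lemma prod_eq_pow (f : Fin 2 → ℂ) (r : Fin k → Fin 2) :
    ∏ i, f (r i) = f 0 ^ (k - cnt r) * f 1 ^ cnt r := by
  induction k with
  | zero => simp [cnt]
  | succ k ih =>
    obtain ⟨r, a, rfl⟩ := exists_snoc r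
    have h := cnt_le r
    simp only [Fin.prod_univ_castSucc, snoc_castSucc, snoc_last, ih, cnt_snoc]
    fin_cases a
    · simp only [Fin.zero_eta, Fin.val_zero, add_zero]
      rw [show k + 1 - cnt r = k - cnt r + 1 by omega, pow_succ]
      ring
    · simp only [Fin.mk_one, Fin.val_one]
      rw [show k + 1 - (cnt r + 1) = k - cnt r by omega, pow_succ]
      ring

/-- A vector killed by all e_i is a symmetric tensor, so a coordinate depends only on how many
letters of its index are 1. The induction compares indices with the same last letter and uses the
last e to change that letter. -/
lemma eq_of_cnt_eq {f : (Fin k → Fin 2) → ℂ}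
    (hf : ∀ i, 1 ≤ i → i < k → (tl k i).mulVec f = 0) {r r' : Fin k → Fin 2}
    (h : cnt r = cnt r') : f r = f r' := by
  induction k with
  | zero => rw [Subsingleton.elim r r']
  | succ k ih =>
    have hs : ∀ a : Fin 2, ∀ {r r' : Fin k → Fin 2}, cnt r = cnt r' →
        f (snoc r a) = f (snoc r' a) := by
      intro a r r' h
      refine ih (f := fun r => f (snoc r a)) (fun i hi hik => ?_) h
      ext t
      have h1 := congrFun (hf i hi (by omega)) (snoc t a)
      rw [← tl_embed (Nat.le_succ k) hi hik, Matrix.mulVec, dotProduct, sum_snoc] at h1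
      simpa [ext1_snoc, Matrix.mulVec, dotProduct] using h1
    have hsw : ∀ r r' : Fin k → Fin 2, cnt r' = cnt r + 1 → f (snoc r 1) = f (snoc r' 0) := by
      intro r r' h
      cases k with
      | zero => have := cnt_le r'; omega
      | succ k =>
        obtain ⟨t, ht⟩ := exists_cnt_eq (show cnt r ≤ k by have := cnt_le r'; omega)
        rw [hs 1 (r := r) (r' := snoc t 0) (by rw [cnt_snoc, ht]; rfl),
          hs 0 (r := r') (r' := snoc t 1) (by rw [cnt_snoc, ht, h]; rfl)]
        have h1 := congrFun (hf (k + 1) (by omega) (by omega)) (snoc (snoc t 0) 1)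
        rw [Matrix.mulVec, dotProduct, sum_snoc, sum_snoc] at h1
        simp only [topE_snoc, Fin.sum_univ_two, ite_mul, zero_mul, ite_add_ite, add_zero] at h1
        rw [Finset.sum_ite_eq Finset.univ t] at h1
        simp [asym] at h1
        linear_combination h1
    obtain ⟨r, a, rfl⟩ := exists_snoc r
    obtain ⟨r', a', rfl⟩ := exists_snoc r'
    rw [cnt_snoc, cnt_snoc] at h
    fin_cases a <;> fin_cases a'
    · exact hs 0 (by simpa using h)
    · exact (hsw r' r (by simpa using h)).symm
    · exact hsw r r' (by simpa using h.symm)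
    · exact hs 1 (by simpa using h)

lemma conjTranspose_tl {i : ℕ} (hi : 1 ≤ i) (hik : i < k) : (tl k i).conjTranspose = tl k i := by
  obtain ⟨i, rfl⟩ := Nat.exists_eq_add_of_le' hi
  obtain ⟨k, rfl⟩ : ∃ m, k = i + 2 + m := ⟨k - (i + 2), by omega⟩
  induction k with
  | zero => exact conjTranspose_topE i
  | succ k ih =>
    rw [← add_assoc, ← tl_embed (Nat.le_succ (i + 2 + k)) hi (by omega), conjTranspose_ext1,
      ih (by omega)]

/-! ### Invariant polynomials -/

section
variable {G : Subgroup SU2} {n : ℕ}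

lemma Harmonic.eq_of_cnt {y : TensorEnd (n + 1)} (h : Harmonic G n y)
    {r r' s s' : Fin (n + 1) → Fin 2} (hr : cnt r = cnt r') (hs : cnt s = cnt s') :
    y r s = y r' s' := by
  have h1 : y r s = y r' s := by
    refine eq_of_cnt_eq (f := fun r => y r s) (fun i hi hik => ?_) hr
    ext t
    exact congrFun (congrFun (h.tl_mul i hi hik) t) s
  have h2 : star (y r' s) = star (y r' s') := by
    refine eq_of_cnt_eq (f := fun s => star (y r' s)) (fun i hi hik => ?_) hs
    have h3 : tl (n + 1) i * y.conjTranspose = 0 := by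
      rw [← conjTranspose_tl hi hik, ← Matrix.conjTranspose_mul, h.mul_tl i hi hik,
        Matrix.conjTranspose_zero]
    ext t
    exact congrFun (congrFun h3 t) r'
  rw [h1, star_injective h2]

/-- A vanishing partial trace says that y(r0, s0) + y(r1, s1) = 0: raising both weights by one
changes the sign. Up to sign, an entry thus depends only on the difference of the two weights. -/
lemma Harmonic.eq_neg {y : TensorEnd (n + 1)} (h : Harmonic G n y)
    {r r' s s' : Fin (n + 1) → Fin 2} (d : ℕ) (hr : cnt r' = cnt r + d) (hs : cnt s' = cnt s + d) :
    y r' s' = (-1) ^ d * y r s := by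
  induction d generalizing r' s' with
  | zero => rw [pow_zero, one_mul]; exact h.eq_of_cnt hr hs
  | succ d ih =>
    obtain ⟨t, ht⟩ := exists_cnt_eq (k := n) (show cnt r + d ≤ n by have := cnt_le r'; omega)
    obtain ⟨v, hv⟩ := exists_cnt_eq (k := n) (show cnt s + d ≤ n by have := cnt_le s'; omega)
    have h1 := congrFun (congrFun h.ptr_eq t) v
    rw [ptr_apply, Fin.sum_univ_two, Matrix.zero_apply,
      ih (r' := snoc t 0) (s' := snoc v 0) (by rw [cnt_snoc, ht]; rfl) (by rw [cnt_snoc, hv]; rfl),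
      h.eq_of_cnt (r := snoc t 1) (r' := r') (s := snoc v 1) (s' := s')
        (by rw [cnt_snoc, ht, hr]; rfl) (by rw [cnt_snoc, hv, hs]; rfl)] at h1
    rw [pow_succ]
    linear_combination h1

/-- The coefficients of the polynomial that corresponds to a harmonic endomorphism. -/
def polyCoeff (y : TensorEnd k) (m : ℕ) : ℂ :=
  ∑ r, ∑ s, if cnt r + (k - cnt s) = m then (-1) ^ cnt r * y r s else 0

lemma polyCoeff_sub_smul (y z : TensorEnd k) (a : ℂ) (m : ℕ) :
    polyCoeff (z - a • y) m = polyCoeff z m - a * polyCoeff y m := by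
  simp only [polyCoeff, Finset.mul_sum, ← Finset.sum_sub_distrib]
  refine Finset.sum_congr rfl fun r _ => Finset.sum_congr rfl fun s _ => ?_
  split_ifs
  · simp only [Matrix.sub_apply, Matrix.smul_apply, smul_eq_mul]
    ring
  · ring

/-- All terms in one coefficient are equal by `Harmonic.eq_neg`, so nothing cancels: the coefficient
is a positive integer times any of its terms. -/
lemma Harmonic.eq_zero {y : TensorEnd (n + 1)} (h : Harmonic G n y)
    (h0 : ∀ m ≤ 2 * (n + 1), polyCoeff y m = 0) : y = 0 := by
  ext r s
  have hr := cnt_le r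
  have hs := cnt_le s
  have h1 := h0 (cnt r + (n + 1 - cnt s)) (by omega)
  have h2 : ∀ r' s' : Fin (n + 1) → Fin 2, cnt r' + (n + 1 - cnt s') = cnt r + (n + 1 - cnt s) →
      (-1) ^ cnt r' * y r' s' = (-1) ^ cnt r * y r s := by
    intro r' s' hrs
    have hr' := cnt_le r'
    have hs' := cnt_le s'
    have hsq : ∀ d : ℕ, (-1 : ℂ) ^ d * (-1) ^ d = 1 := fun d => by
      rw [← mul_pow]; norm_num
    rcases le_total (cnt r) (cnt r') with hle | hle
    · obtain ⟨d, hd⟩ := Nat.exists_eq_add_of_le hle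
      rw [h.eq_neg (r := r) (s := s) d hd (by omega), hd, pow_add]
      linear_combination ((-1) ^ cnt r * y r s) * hsq d
    · obtain ⟨d, hd⟩ := Nat.exists_eq_add_of_le hle
      rw [h.eq_neg (r := r') (s := s') (r' := r) (s' := s) d hd (by omega), hd, pow_add]
      linear_combination -((-1) ^ cnt r' * y r' s') * hsq d
  have h3 : polyCoeff y (cnt r + (n + 1 - cnt s)) = (∑ r' : Fin (n + 1) → Fin 2,
      ∑ s' : Fin (n + 1) → Fin 2,
        if cnt r' + (n + 1 - cnt s') = cnt r + (n + 1 - cnt s) then 1 else 0 : ℕ) *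
          ((-1) ^ cnt r * y r s) := by
    rw [polyCoeff]
    push_cast
    rw [Finset.sum_mul]
    refine Finset.sum_congr rfl fun r' _ => ?_
    rw [Finset.sum_mul]
    refine Finset.sum_congr rfl fun s' _ => ?_
    split_ifs with hif
    · rw [h2 r' s' hif, one_mul]
    · rw [zero_mul]
  rw [h1] at h3
  have h4 : (∑ r' : Fin (n + 1) → Fin 2, ∑ s' : Fin (n + 1) → Fin 2,
        if cnt r' + (n + 1 - cnt s') = cnt r + (n + 1 - cnt s) then 1 else 0 : ℕ) ≠ 0 := by
    intro h5
    have h6 := Finset.sum_eq_zero_iff.mp (Finset.sum_eq_zero_iff.mp h5 r (Finset.mem_univ r)) s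
      (Finset.mem_univ s)
    simp at h6
  rcases mul_eq_zero.mp h3.symm with h5 | h5
  · exact absurd (Nat.cast_eq_zero.mp h5) h4
  · exact (mul_eq_zero.mp h5).resolve_left (pow_ne_zero _ (by norm_num))

/-- The binary form of degree `n` with coefficients `A`. -/
def form (n : ℕ) (A : ℕ → ℂ) (x z : ℂ) : ℂ := ∑ m ∈ Finset.range (n + 1), A m * x ^ m * z ^ (n - m)

/-- The binary form of degree `n` with coefficients `A` is invariant under `G`. -/
def FormInv (G : Subgroup SU2) (n : ℕ) (A : ℕ → ℂ) : Prop :=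
  ∀ g ∈ G, ∀ x z : ℂ,
    form n A (g.1 0 0 * x + g.1 0 1 * z) (g.1 1 0 * x + g.1 1 1 * z) = form n A x z

/-- The tensor power of a vector. -/
def pureVec (k : ℕ) (v : Fin 2 → ℂ) : (Fin k → Fin 2) → ℂ := fun r => ∏ i, v (r i)

lemma tensorPow_mulVec_pureVec (g : Matrix (Fin 2) (Fin 2) ℂ) (v : Fin 2 → ℂ) :
    (tensorPow g k).mulVec (pureVec k v) = pureVec k (g.mulVec v) := by
  ext r
  simp only [Matrix.mulVec, dotProduct, tensorPow, pureVec, Matrix.of_apply,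
    ← Finset.prod_mul_distrib]
  rw [Finset.prod_univ_sum, Fintype.piFinset_univ]

lemma pureVec_vecMul_tensorPow (g : Matrix (Fin 2) (Fin 2) ℂ) (v : Fin 2 → ℂ) :
    Matrix.vecMul (pureVec k v) (tensorPow g k) = pureVec k (Matrix.vecMul v g) := by
  ext r
  simp only [Matrix.vecMul, dotProduct, tensorPow, pureVec, Matrix.of_apply,
    ← Finset.prod_mul_distrib]
  rw [Finset.prod_univ_sum, Fintype.piFinset_univ]

lemma form_polyCoeff (y : TensorEnd k) (x z : ℂ) :
    form (2 * k) (polyCoeff y) x z = pureVec k ![z, -x] ⬝ᵥ y.mulVec (pureVec k ![x, z]) := by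
  have h1 : ∀ r s : Fin k → Fin 2, pureVec k ![z, -x] r * (y r s * pureVec k ![x, z] s) =
      ∑ m ∈ Finset.range (2 * k + 1), if cnt r + (k - cnt s) = m then
        (-1) ^ cnt r * y r s * x ^ m * z ^ (2 * k - m) else 0 := by
    intro r s
    have hr := cnt_le r
    have hs := cnt_le s
    rw [Finset.sum_ite_eq, if_pos (Finset.mem_range.mpr (by omega)), pureVec, pureVec, prod_eq_pow,
      prod_eq_pow]
    simp only [Matrix.cons_val_zero, Matrix.cons_val_one]
    rw [show 2 * k - (cnt r + (k - cnt s)) = (k - cnt r) + cnt s by omega, neg_pow, pow_add, pow_add]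
    ring
  simp only [dotProduct, Matrix.mulVec, Finset.mul_sum]
  simp only [h1]
  simp only [form, polyCoeff, Finset.sum_mul]
  rw [Finset.sum_comm]
  refine Finset.sum_congr rfl fun r _ => ?_
  rw [Finset.sum_comm]
  refine Finset.sum_congr rfl fun s _ => Finset.sum_congr rfl fun m _ => ?_
  split_ifs
  · rfl
  · ring

/-- The form is the pairing of the tensor powers of (z, -x) and (x, z) through y. As det g = 1, the
vector (z, -x) transforms contragrediently to (x, z), and invariance is the commutation of y with g.
-/
lemma formInv_polyCoeff {y : TensorEnd k} (hy : y ∈ centralizerAlg G k) :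
    FormInv G (2 * k) (polyCoeff y) := by
  intro g hg x z
  have h1 := mem_centralizerAlg.mp hy g hg
  rw [form_polyCoeff, form_polyCoeff]
  have hdet := det_SU2 g
  rw [Matrix.det_fin_two] at hdet
  have h2 : pureVec k ![g.1 0 0 * x + g.1 0 1 * z, g.1 1 0 * x + g.1 1 1 * z] =
      (tensorPow g.1 k).mulVec (pureVec k ![x, z]) := by
    rw [tensorPow_mulVec_pureVec]
    congr 1
    ext i
    fin_cases i <;> simp [Matrix.mulVec, dotProduct, Fin.sum_univ_two]
  have h3 : Matrix.vecMul (pureVec k ![g.1 1 0 * x + g.1 1 1 * z,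
      -(g.1 0 0 * x + g.1 0 1 * z)]) (tensorPow g.1 k) = pureVec k ![z, -x] := by
    rw [pureVec_vecMul_tensorPow]
    congr 1
    ext i
    fin_cases i <;> simp [Matrix.vecMul, dotProduct, Fin.sum_univ_two]
    · linear_combination z * hdet
    · linear_combination -x * hdet
  rw [h2, Matrix.mulVec_mulVec, ← h1, ← Matrix.mulVec_mulVec, Matrix.dotProduct_mulVec, h3]

lemma symIrred_succ_of_form (hS : ∀ k ≤ n, SymIrred G k)
    (h : ∀ A, FormInv G (2 * (n + 1)) A → ∀ m ≤ 2 * (n + 1), A m = 0) : SymIrred G (n + 1) :=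
  symIrred_succ hS fun _ hy => hy.eq_zero (h _ (formInv_polyCoeff hy.mem))

/-- If one coefficient determines an invariant form, subtracting the multiple of y that removes this
coefficient from z leaves zero. -/
lemma Harmonic.eq_smul {m₀ : ℕ}
    (h : ∀ A, FormInv G (2 * (n + 1)) A → A m₀ = 0 → ∀ m ≤ 2 * (n + 1), A m = 0)
    {y z : TensorEnd (n + 1)} (hy : Harmonic G n y) (hz : Harmonic G n z) (hy0 : y ≠ 0) :
    ∃ a : ℂ, z = a • y := by
  have h1 : polyCoeff y m₀ ≠ 0 := fun h1 =>
    hy0 (hy.eq_zero (h _ (formInv_polyCoeff hy.mem) h1))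
  refine ⟨polyCoeff z m₀ / polyCoeff y m₀, ?_⟩
  set a := polyCoeff z m₀ / polyCoeff y m₀ with ha
  have h2 : Harmonic G n (z - a • y) := by
    refine ⟨sub_mem hz.mem (Subalgebra.smul_mem _ hy.mem _), fun i hi hik => ?_,
      fun i hi hik => ?_, ?_⟩
    · rw [mul_sub, mul_smul_comm, hy.tl_mul i hi hik, hz.tl_mul i hi hik]; simp
    · rw [sub_mul, smul_mul_assoc, hy.mul_tl i hi hik, hz.mul_tl i hi hik]; simp
    · have h3 : ptr (z - a • y) = ptr z - a • ptr y := by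
        ext r s
        simp only [ptr_apply, Matrix.sub_apply, Matrix.smul_apply, Finset.sum_sub_distrib,
          Finset.smul_sum]
      rw [h3, hy.ptr_eq, hz.ptr_eq]; simp
  rw [← sub_eq_zero]
  refine h2.eq_zero (h _ (formInv_polyCoeff h2.mem) ?_)
  rw [polyCoeff_sub_smul, ha, div_mul_cancel₀ _ h1, sub_self]

end

end McKay

namespace McKay

/-! ### Binary forms invariant under the binary polyhedral groups -/

open Complex (I)

lemma coeff_eq_zero {n : ℕ} {B : ℕ → ℂ} (h : ∀ x : ℂ, ∑ m ∈ Finset.range (n + 1), B m * x ^ m = 0)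
    {m : ℕ} (hm : m ≤ n) : B m = 0 := by
  have h1 : (∑ m ∈ Finset.range (n + 1), Polynomial.C (B m) * Polynomial.X ^ m) = 0 := by
    refine Polynomial.funext fun x => ?_
    simpa [Polynomial.eval_finsetSum] using h x
  have h2 := congrArg (fun p => Polynomial.coeff p m) h1
  simpa [Polynomial.finsetSum_coeff, Polynomial.coeff_C_mul_X_pow, Nat.lt_succ_iff, hm] using h2

lemma coeff_of_form_diag {n : ℕ} {A : ℕ → ℂ} {μ ν : ℂ}
    (h : ∀ x z, form n A (μ * x) (ν * z) = form n A x z) {m : ℕ} (hm : m ≤ n) :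
    A m * (μ ^ m * ν ^ (n - m)) = A m := by
  rw [← sub_eq_zero]
  refine coeff_eq_zero (B := fun m => A m * (μ ^ m * ν ^ (n - m)) - A m) (fun x => ?_) hm
  have h1 := h x 1
  simp only [form, mul_one, one_pow] at h1
  simp only [sub_mul, Finset.sum_sub_distrib]
  rw [← h1, sub_eq_zero]
  exact Finset.sum_congr rfl fun _ _ => by rw [mul_pow]; ring

lemma coeff_of_form_swap {n : ℕ} {A : ℕ → ℂ} (h : ∀ x z, form n A z (-x) = form n A x z) {m : ℕ}
    (hm : m ≤ n) : A (n - m) * (-1) ^ m = A m := by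
  rw [← sub_eq_zero]
  refine coeff_eq_zero (B := fun m => A (n - m) * (-1) ^ m - A m) (fun x => ?_) hm
  have h1 := h x 1
  simp only [form, one_pow, mul_one] at h1
  simp only [sub_mul, Finset.sum_sub_distrib]
  rw [← h1, sub_eq_zero, ← Finset.sum_range_reflect]
  refine Finset.sum_congr rfl fun j hj => ?_
  have hj' := Finset.mem_range.mp hj
  rw [show n + 1 - 1 - j = n - j by omega, show n - (n - j) = j by omega, neg_pow x]
  ring

lemma form_smul (n : ℕ) (A : ℕ → ℂ) (a x z : ℂ) :
    form n A (a * x) (a * z) = a ^ n * form n A x z := by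
  simp only [form, Finset.mul_sum]
  refine Finset.sum_congr rfl fun m hm => ?_
  have hm' := Finset.mem_range.mp hm
  obtain ⟨d, rfl⟩ : ∃ d, n = m + d := ⟨n - m, by omega⟩
  rw [Nat.add_sub_cancel_left, mul_pow, mul_pow, pow_add]
  ring

/-- The unit quaternion `j`. -/
def quatJ : SU2 := quat 0 0 1 0 (by norm_num)

lemma quat_coe (a b c d : ℝ) (h : a ^ 2 + b ^ 2 + c ^ 2 + d ^ 2 = 1) :
    (quat a b c d h).1 = !![(a : ℂ) + b * I, c + d * I; -c + d * I, a - b * I] := by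
  simp [quat, mkSU2]
  constructor <;> ring

/-- The conditions on a form of degree `2 K` to be invariant under `i`, `j` and `ω`. -/
structure TetInv (K : ℕ) (A : ℕ → ℂ) : Prop where
  diag : ∀ m ≤ 2 * K, A m * (-1) ^ (m + K) = A m
  swap : ∀ m ≤ 2 * K, A (2 * K - m) * (-1) ^ m = A m
  omega : ∀ x z : ℂ, (I / 2) ^ K * form (2 * K) A (x + z) (I * (x - z)) = form (2 * K) A x z

/-- Conjugation by ω carries i to j, so j may be used although it is not among the generators. -/
lemma quatJ_mul_omega : quatOmega * quatI = quatJ * quatOmega := by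
  apply Subtype.ext
  simp only [Submonoid.coe_mul, quatOmega, quatI, quatJ, quat_coe]
  ext i j
  fin_cases i <;> fin_cases j <;> simp [Matrix.mul_apply, Fin.sum_univ_two] <;>
    ring_nf <;> simp only [Complex.I_sq] <;> ring

lemma tetInv_of_formInv {S : Subgroup SU2} (hi : quatI ∈ S) (hω : quatOmega ∈ S) {K : ℕ}
    {A : ℕ → ℂ} (h : FormInv S (2 * K) A) : TetInv K A := by
  have hj : quatJ ∈ S := by
    have h1 : quatJ = quatOmega * quatI * quatOmega⁻¹ := by
      rw [quatJ_mul_omega, mul_assoc, mul_inv_cancel, mul_one]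
    rw [h1]
    exact mul_mem (mul_mem hω hi) (inv_mem hω)
  refine ⟨fun m hm => ?_, fun m hm => ?_, fun x z => ?_⟩
  · have h1 : ∀ x z, form (2 * K) A (I * x) (-I * z) = form (2 * K) A x z := by
      intro x z
      have := h _ hi x z
      simpa [quatI, quat_coe] using this
    have h2 := coeff_of_form_diag h1 hm
    have h3 : I ^ m * (-I) ^ (2 * K - m) = (-1) ^ (m + K) := by
      have h4 : (-I) ^ (2 * K - m) * I ^ (2 * K - m) = 1 := by rw [← mul_pow]; simp
      have h5 : I ^ m * I ^ (2 * K - m) = (-1) ^ K := by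
        rw [← pow_add, show m + (2 * K - m) = 2 * K by omega, pow_mul, Complex.I_sq]
      have h6 : I ^ m * I ^ m = (-1) ^ m := by rw [← mul_pow, Complex.I_mul_I]
      have h7 : I ^ (2 * K - m) * I ^ (2 * K - m) * (-1) ^ m = 1 := by
        calc _ = (I ^ m * I ^ (2 * K - m)) * (I ^ m * I ^ (2 * K - m)) := by rw [← h6]; ring
          _ = 1 := by rw [h5, ← mul_pow]; simp
      calc I ^ m * (-I) ^ (2 * K - m) = I ^ m * (-I) ^ (2 * K - m) *
            (I ^ (2 * K - m) * I ^ (2 * K - m) * (-1) ^ m) := by rw [h7, mul_one]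
        _ = ((-I) ^ (2 * K - m) * I ^ (2 * K - m)) * (I ^ m * I ^ (2 * K - m)) * (-1) ^ m := by ring
        _ = _ := by rw [h4, h5, pow_add]; ring
    rwa [h3] at h2
  · refine coeff_of_form_swap (fun x z => ?_) hm
    have := h _ hj x z
    simpa [quatJ, quat_coe] using this
  · have h1 := h _ hω x z
    rw [← h1]
    -- Both rows of ω contain the factor (1 + i)/2 up to a unit; its square i/2 is the constant in
    -- `TetInv.omega`.
    have e1 : quatOmega.1 0 0 * x + quatOmega.1 0 1 * z = ((1 + I) / 2) * (x + z) := by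
      simp [quatOmega, quat_coe]; ring
    have e2 : quatOmega.1 1 0 * x + quatOmega.1 1 1 * z = ((1 + I) / 2) * (I * (x - z)) := by
      simp [quatOmega, quat_coe]; ring_nf; rw [Complex.I_sq]; ring
    rw [e1, e2, form_smul, pow_mul]
    congr 2
    ring_nf
    rw [Complex.I_sq]
    ring

section
variable {A : ℕ → ℂ}

lemma eq_zero_of_mul_neg_one {a : ℂ} (h : a * (-1) = a) : a = 0 := by linear_combination -(1/2) * h

lemma TetInv.one (h : TetInv 1 A) : ∀ m ≤ 2, A m = 0 := by
  intro m hm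
  have h0 := h.diag m hm
  have h1 := h.swap m hm
  interval_cases m
  · exact eq_zero_of_mul_neg_one (by simpa using h0)
  · exact eq_zero_of_mul_neg_one (by simpa using h1)
  · exact eq_zero_of_mul_neg_one (by norm_num at h0 ⊢; exact h0)

lemma I_pow_three : I ^ 3 = -I := by rw [pow_succ, Complex.I_sq]; ring
lemma I_pow_five : I ^ 5 = I := by rw [pow_succ, Complex.I_pow_four]; ring
lemma I_pow_six : I ^ 6 = -1 := by rw [show I ^ 6 = (I ^ 2) ^ 3 by ring, Complex.I_sq]; norm_num
lemma I_pow_seven : I ^ 7 = -I := by rw [pow_succ, I_pow_six]; ring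
lemma I_pow_eight : I ^ 8 = 1 := by rw [show I ^ 8 = (I ^ 2) ^ 4 by ring, Complex.I_sq]; norm_num
lemma I_pow_nine : I ^ 9 = I := by rw [pow_succ, I_pow_eight]; ring
lemma I_pow_ten : I ^ 10 = -1 := by rw [show I ^ 10 = (I ^ 2) ^ 5 by ring, Complex.I_sq]; norm_num
lemma I_pow_twelve : I ^ 12 = 1 := by rw [show I ^ 12 = (I ^ 2) ^ 6 by ring, Complex.I_sq]; norm_num

lemma TetInv.odd {K : ℕ} (h : TetInv K A) {m : ℕ} (hm : m ≤ 2 * K) (hp : Odd (m + K)) :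
    A m = 0 := by
  have := h.diag m hm
  rw [hp.neg_one_pow] at this
  exact eq_zero_of_mul_neg_one this

/-- The symmetries leave the unknowns A 0 and A 2, and evaluation at (1, 0) and (1, 1) gives two
independent linear equations. -/
lemma TetInv.two (h : TetInv 2 A) : ∀ m ≤ 4, A m = 0 := by
  have h1 := h.odd (m := 1) (by norm_num) (by decide)
  have h3 := h.odd (m := 3) (by norm_num) (by decide)
  have h4 : A 4 = A 0 := by simpa using h.swap 0 (by norm_num)
  have e1 := h.omega 1 0
  have e2 := h.omega 1 1
  simp [form, Finset.sum_range_succ, h1, h3, h4, div_pow] at e1 e2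
  have h0 : A 0 = 0 := by linear_combination (-1/3) * e1 + (-1/12) * e2
  have h2 : A 2 = 0 := by linear_combination 4 * e1 + 6 * h0
  intro m hm
  interval_cases m <;> simp [*]

/-- Only the multiples of x z (x⁴ - z⁴) remain. -/
lemma TetInv.three (h : TetInv 3 A) :
    A 0 = 0 ∧ A 2 = 0 ∧ A 3 = 0 ∧ A 4 = 0 ∧ A 5 = -A 1 ∧
    A 6 = 0 := by
  have h3 := h.swap 3 (by norm_num)
  have h5 := h.swap 5 (by norm_num)
  exact ⟨h.odd (by norm_num) (by decide), h.odd (by norm_num) (by decide),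
    eq_zero_of_mul_neg_one (by norm_num at h3 ⊢; exact h3), h.odd (by norm_num) (by decide),
    by norm_num at h5; exact h5.symm, h.odd (by norm_num) (by decide)⟩

/-- Only the multiples of x⁸ + 14 x⁴ z⁴ + z⁸ remain. -/
lemma TetInv.four (h : TetInv 4 A) : A 2 = 0 ∧ A 6 = 0 ∧ A 4 = 14 * A 0 ∧ A 8 = A 0 := by
  have h1 := h.odd (m := 1) (by norm_num) (by decide)
  have h3 := h.odd (m := 3) (by norm_num) (by decide)
  have h5 := h.odd (m := 5) (by norm_num) (by decide)
  have h7 := h.odd (m := 7) (by norm_num) (by decide)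
  have h8 : A 8 = A 0 := by simpa using h.swap 0 (by norm_num)
  have h6 : A 6 = A 2 := by simpa using h.swap 2 (by norm_num)
  have e1 := h.omega 1 0
  have e2 := h.omega 1 1
  simp [form, Finset.sum_range_succ, h1, h3, h5, h6, h7, h8, div_pow, I_pow_six, I_pow_eight] at e1 e2
  have h2 : A 2 = 0 := by linear_combination (-4) * e1 + (-1/4) * e2
  exact ⟨h2, h6.trans h2, by linear_combination 16 * e1 + 2 * h2, h8⟩

lemma TetInv.five (h : TetInv 5 A) : ∀ m ≤ 10, A m = 0 := by
  have n9 : (-I) ^ 9 = -I := by rw [Odd.neg_pow (by decide), I_pow_nine]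
  have n7 : (-I) ^ 7 = I := by rw [Odd.neg_pow (by decide), I_pow_seven, neg_neg]
  have n5 : (-I) ^ 5 = -I := by rw [Odd.neg_pow (by decide), I_pow_five]
  have n3 : (-I) ^ 3 = I := by rw [Odd.neg_pow (by decide), I_pow_three, neg_neg]
  have m9 : (-(I * 2)) ^ 9 = -I * 512 := by rw [← neg_mul, mul_pow, n9]; norm_num
  have m7 : (-(I * 2)) ^ 7 = I * 128 := by rw [← neg_mul, mul_pow, n7]; norm_num
  have m5 : (-(I * 2)) ^ 5 = -I * 32 := by rw [← neg_mul, mul_pow, n5]; norm_num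
  have m3 : (-(I * 2)) ^ 3 = I * 8 := by rw [← neg_mul, mul_pow, n3]; norm_num
  have h0 := h.odd (m := 0) (by norm_num) (by decide)
  have h2 := h.odd (m := 2) (by norm_num) (by decide)
  have h4 := h.odd (m := 4) (by norm_num) (by decide)
  have h6 := h.odd (m := 6) (by norm_num) (by decide)
  have h8 := h.odd (m := 8) (by norm_num) (by decide)
  have h10 := h.odd (m := 10) (by norm_num) (by decide)
  have h9 := h.swap 9 (by norm_num)
  have h7 := h.swap 7 (by norm_num)
  have h5 := h.swap 5 (by norm_num)
  -- The remaining candidates are antisymmetric and divisible by x z, so the points (1, 0) and (1,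
  -- 1) would give no condition.
  have e1 := h.omega 1 2
  have e2 := h.omega 1 3
  norm_num [form, Finset.sum_range_succ, h0, h2, h4, h6, h8, h10, div_pow, mul_pow,
    I_pow_five, I_pow_seven, I_pow_three, I_pow_nine] at e1 e2 h9 h7 h5
  have h5' : A 5 = 0 := by linear_combination (-1/2) * h5
  rw [h5', ← h7, ← h9, n9, n7, n5, n3] at e1
  rw [h5', ← h7, ← h9, m9, m7, m5, m3] at e2
  have h1 : A 1 = 0 := by
    linear_combination (exp := 1) (-32/72000) * e1 - (1/72000) * e2 +
      (32/72000) * ((19680 * A 1 - 2160 * A 3) / 32) * Complex.I_sq +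
      (1/72000) * ((522240 * A 1 - 122880 * A 3) / 32) * Complex.I_sq
  have h3 : A 3 = 0 := by
    linear_combination (-2/105) * e1 + (2/105) * ((19680 * A 1 - 2160 * A 3) / 32) * Complex.I_sq
      - (2/105) * 1125 * h1
  intro m hm
  interval_cases m <;> simp [*, ← h7, ← h9]

/-- What remains is two-dimensional: x¹² - 33 x⁸ z⁴ - 33 x⁴ z⁸ + z¹² and the square of x z (x⁴ -
z⁴). -/
lemma TetInv.six (h : TetInv 6 A) : (∀ m ≤ 12, Odd m → A m = 0) ∧ A 12 = A 0 ∧ A 10 = A 2 ∧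
    A 8 = A 4 ∧ A 4 = -33 * A 0 ∧ A 6 = -2 * A 2 := by
  have h0 := h.odd (m := 1) (by norm_num) (by decide)
  have h2 := h.odd (m := 3) (by norm_num) (by decide)
  have h4 := h.odd (m := 5) (by norm_num) (by decide)
  have h6 := h.odd (m := 7) (by norm_num) (by decide)
  have h8 := h.odd (m := 9) (by norm_num) (by decide)
  have h10 := h.odd (m := 11) (by norm_num) (by decide)
  have h12 : A 12 = A 0 := by simpa using h.swap 0 (by norm_num)
  have h11 : A 10 = A 2 := by simpa using h.swap 2 (by norm_num)
  have h9 : A 8 = A 4 := by have := h.swap 4 (by norm_num); norm_num at this; exact this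
  have e1 := h.omega 1 0
  have e2 := h.omega 1 1
  norm_num [form, Finset.sum_range_succ, h0, h2, h4, h6, h8, h10, h9, h11, h12, div_pow, mul_pow,
    I_pow_six, I_pow_eight, I_pow_ten, I_pow_twelve] at e1 e2
  refine ⟨fun m hm ho => ?_, h12, h11, h9, by linear_combination (-16) * e1 - (1/4) * e2,
    by linear_combination 32 * e1 - (1/2) * e2⟩
  interval_cases m <;> first | assumption | exact absurd ho (by decide)

end

/-! ### Invariant forms of low degree for the three binary polyhedral groups -/

section
variable {S : Subgroup SU2} {A : ℕ → ℂ}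

lemma symIrred_of_tetInv (h0 : SymIrred S 0) (hi : quatI ∈ S) (hω : quatOmega ∈ S) :
    ∀ k ≤ 2, SymIrred S k := by
  have h1 : SymIrred S 1 := symIrred_succ_of_form (n := 0)
    (fun k hk => by obtain rfl : k = 0 := by omega
                    exact h0)
    fun A hA => (tetInv_of_formInv (K := 1) hi hω hA).one
  have h2 : SymIrred S 2 := symIrred_succ_of_form (n := 1)
    (fun k hk => by interval_cases k <;> assumption)
    fun A hA => (tetInv_of_formInv (K := 2) hi hω hA).two
  intro k hk
  interval_cases k <;> assumption

lemma form_tet_eq_zero (hi : quatI ∈ S) (hω : quatOmega ∈ S) (hA : FormInv S (2 * 3) A)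
    (h : A 1 = 0) : ∀ m ≤ 2 * 3, A m = 0 := by
  obtain ⟨a0, a2, a3, a4, a5, a6⟩ := (tetInv_of_formInv hi hω hA).three
  rw [h, neg_zero] at a5
  intro m hm
  have hm' : m ≤ 6 := hm
  interval_cases m <;> assumption

lemma quatOct_sq : quatOct * quatOct = quatI := by
  have hs : ((√2 : ℝ) : ℂ) * ((√2 : ℝ) : ℂ) = 2 := by
    rw [← Complex.ofReal_mul, Real.mul_self_sqrt (by norm_num)]; norm_num
  apply Subtype.ext
  simp only [Submonoid.coe_mul, quatOct, quatI, quat_coe]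
  ext i j
  fin_cases i <;> fin_cases j <;> simp [Matrix.mul_apply, Fin.sum_univ_two]
  · field_simp
    linear_combination Complex.I_sq - I * hs
  · field_simp
    linear_combination Complex.I_sq + I * hs

/-- The tetrahedral sextic x z (x⁴ - z⁴) changes sign under the element of order eight. The point
(1, 2), where the sextic is not zero, detects this. -/
lemma form_oct_three (hi : quatOct ∈ S) (hω : quatOmega ∈ S) (hA : FormInv S (2 * 3) A) :
    ∀ m ≤ 2 * 3, A m = 0 := by
  have hI : quatI ∈ S := quatOct_sq ▸ mul_mem hi hi
  refine form_tet_eq_zero hI hω hA ?_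
  obtain ⟨a0, a2, a3, a4, a5, a6⟩ := (tetInv_of_formInv hI hω hA).three
  have h1 := hA _ hi 1 2
  have e1 : quatOct.1 0 0 * 1 + quatOct.1 0 1 * 2 = ((√2 : ℝ) : ℂ)⁻¹ * (1 + I) := by
    simp [quatOct, quat_coe]; ring
  have e2 : quatOct.1 1 0 * 1 + quatOct.1 1 1 * 2 = ((√2 : ℝ) : ℂ)⁻¹ * (2 * (1 - I)) := by
    simp [quatOct, quat_coe]; ring
  have hs : (((√2 : ℝ) : ℂ)⁻¹) ^ (2 * 3) = 1 / 8 := by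
    rw [inv_pow, pow_mul, ← Complex.ofReal_pow, Real.sq_sqrt (by norm_num)]; norm_num
  have p1 : (1 + I) ^ 5 = -4 * (1 + I) := by
    linear_combination (I ^ 3 + 5 * I ^ 2 + 9 * I + 5) * Complex.I_sq
  have p2 : (1 - I) ^ 5 = -4 * (1 - I) := by
    linear_combination (-I ^ 3 + 5 * I ^ 2 - 9 * I + 5) * Complex.I_sq
  rw [e1, e2, form_smul, hs] at h1
  norm_num [form, Finset.sum_range_succ, a0, a2, a3, a4, a5, a6, mul_pow, p1, p2] at h1
  linear_combination (-1 / 60) * h1 + A 1 * (1 / 4) * Complex.I_sq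

lemma form_oct_four (hi : quatI ∈ S) (hω : quatOmega ∈ S) (hA : FormInv S (2 * 4) A)
    (h : A 0 = 0) : ∀ m ≤ 2 * 4, A m = 0 := by
  have hT := tetInv_of_formInv hi hω hA
  obtain ⟨a2, a6, a4, a8⟩ := hT.four
  rw [h, mul_zero] at a4
  rw [h] at a8
  intro m hm
  rcases Nat.even_or_odd m with hp | hp
  · have hm' : m ≤ 8 := hm
    interval_cases m <;> first | assumption | exact absurd hp (by decide)
  · exact hT.odd hm (hp.add_even (by decide))

/-- The upper left entry of `quatIcos`. -/
def icosEntry : ℂ := (Real.goldenRatio / 2 : ℝ) + (Real.goldenRatio⁻¹ / 2 : ℝ) * I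

lemma sqrt_five_sq : ((√5 : ℝ) : ℂ) ^ 2 = 5 := by
  rw [← Complex.ofReal_pow, Real.sq_sqrt (by norm_num)]; norm_num

lemma icosEntry_eq : icosEntry = ((1 + (√5 : ℝ)) + ((√5 : ℝ) - 1) * I) / 4 := by
  rw [icosEntry, Real.inv_goldenRatio, Real.goldenConj, Real.goldenRatio]
  push_cast
  ring

lemma icosEntry_sq : icosEntry ^ 2 = ((√5 : ℝ) + 2 * I) / 4 := by
  rw [icosEntry_eq]
  linear_combination (((√5 : ℝ) - 1) ^ 2 / 16 : ℂ) * Complex.I_sq + (I / 8) * sqrt_five_sq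

lemma icosEntry_pow_four : icosEntry ^ 4 = (1 + 4 * (√5 : ℝ) * I) / 16 := by
  rw [show icosEntry ^ 4 = (icosEntry ^ 2) ^ 2 by ring, icosEntry_sq]
  linear_combination (1 / 4) * Complex.I_sq + (1 / 16) * sqrt_five_sq

lemma icosEntry_ne_zero : icosEntry ≠ 0 := by
  intro h
  have h1 := icosEntry_pow_four
  rw [h] at h1
  have := congrArg Complex.re h1
  norm_num at this

lemma icosEntry_pow_four_sub : icosEntry ^ 4 - 1 / 16 ≠ 0 := by
  rw [icosEntry_pow_four]
  have h1 : (1 + 4 * ((√5 : ℝ) : ℂ) * I) / 16 - 1 / 16 = (√5 : ℝ) * I / 4 := by ring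
  rw [h1]
  simp

/-- The element `quatIcos` carries the point (1, 0), where a form takes the value of its top
coefficient, to its first column. -/
lemma form_icos (hi : quatIcos ∈ S) {K : ℕ} (hA : FormInv S (2 * K) A) :
    form (2 * K) A icosEntry (-(1 / 2)) = A (2 * K) := by
  have h := hA _ hi 1 0
  have h1 : form (2 * K) A 1 0 = A (2 * K) := by
    rw [form, Finset.sum_range_succ, Finset.sum_eq_zero]
    · simp
    · intro m hm
      have := Finset.mem_range.mp hm
      simp [show 2 * K - m ≠ 0 by omega]
  rw [h1] at h
  rw [← h]
  congr 1 <;> simp [quatIcos, quat_coe, icosEntry]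

/-- The sextic has top coefficient 0 but does not vanish at the first column of `quatIcos`. -/
lemma form_icos_three (hi : quatI ∈ S) (hω : quatOmega ∈ S) (hc : quatIcos ∈ S)
    (hA : FormInv S (2 * 3) A) : ∀ m ≤ 2 * 3, A m = 0 := by
  refine form_tet_eq_zero hi hω hA ?_
  obtain ⟨a0, a2, a3, a4, a5, a6⟩ := (tetInv_of_formInv hi hω hA).three
  have h1 := form_icos hc hA
  norm_num [form, Finset.sum_range_succ, a0, a2, a3, a4, a5, a6] at h1
  have h2 : A 1 * (icosEntry * (icosEntry ^ 4 - 1 / 16)) = 0 := by linear_combination 2 * h1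
  exact (mul_eq_zero.mp h2).resolve_right (mul_ne_zero icosEntry_ne_zero icosEntry_pow_four_sub)

/-- The octic has top coefficient 1 and a different value at the first column of `quatIcos`. -/
lemma form_icos_four (hi : quatI ∈ S) (hω : quatOmega ∈ S) (hc : quatIcos ∈ S)
    (hA : FormInv S (2 * 4) A) : ∀ m ≤ 2 * 4, A m = 0 := by
  refine form_oct_four hi hω hA ?_
  have hT := tetInv_of_formInv hi hω hA
  obtain ⟨a2, a6, a4, a8⟩ := hT.four
  have h1 := form_icos hc hA
  have o1 := hT.odd (m := 1) (by norm_num) (by decide)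
  have o3 := hT.odd (m := 3) (by norm_num) (by decide)
  have o5 := hT.odd (m := 5) (by norm_num) (by decide)
  have o7 := hT.odd (m := 7) (by norm_num) (by decide)
  norm_num [form, Finset.sum_range_succ, a2, a4, a6, a8, o1, o3, o5, o7] at h1
  rw [show icosEntry ^ 8 = (icosEntry ^ 4) ^ 2 by ring, icosEntry_pow_four] at h1
  have h2 : A 0 * ((-5 + (√5 : ℝ) * I) / 4) = 0 := by
    linear_combination h1 - A 0 * (16 * (√5 : ℝ) ^ 2 / 256) * Complex.I_sq +
      A 0 * (16 / 256) * sqrt_five_sq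
  refine (mul_eq_zero.mp h2).resolve_right fun h => ?_
  have := congrArg Complex.re h
  norm_num at this

lemma form_icos_five (hi : quatI ∈ S) (hω : quatOmega ∈ S)
    (hA : FormInv S (2 * 5) A) : ∀ m ≤ 2 * 5, A m = 0 :=
  (tetInv_of_formInv hi hω hA).five

/-- With A 0 = 0 only the square of the sextic remains. Its top coefficient is 0 and its value at
the first column of `quatIcos` is not. -/
lemma form_icos_six (hi : quatI ∈ S) (hω : quatOmega ∈ S) (hc : quatIcos ∈ S)
    (hA : FormInv S (2 * 6) A) (h : A 0 = 0) : ∀ m ≤ 2 * 6, A m = 0 := by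
  have hT := tetInv_of_formInv hi hω hA
  obtain ⟨o, a12, a10, a8, a4, a6⟩ := hT.six
  have h1 := form_icos hc hA
  rw [h, mul_zero] at a4
  rw [a4] at a8
  rw [h] at a12
  have o1 := o 1 (by norm_num) (by decide)
  have o3 := o 3 (by norm_num) (by decide)
  have o5 := o 5 (by norm_num) (by decide)
  have o7 := o 7 (by norm_num) (by decide)
  have o9 := o 9 (by norm_num) (by decide)
  have o11 := o 11 (by norm_num) (by decide)
  norm_num [form, Finset.sum_range_succ, a12, a10, a8, a6, a4, h, o1, o3, o5, o7, o9, o11] at h1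
  have h2 : A 2 * (icosEntry ^ 2 * (icosEntry ^ 4 - 1 / 16) ^ 2) = 0 := by
    linear_combination 4 * h1
  have a2 := (mul_eq_zero.mp h2).resolve_right
    (mul_ne_zero (pow_ne_zero 2 icosEntry_ne_zero) (pow_ne_zero 2 icosEntry_pow_four_sub))
  rw [a2, mul_zero] at a6
  rw [a2] at a10
  intro m hm
  have hm' : m ≤ 12 := hm
  interval_cases m <;> assumption

end

end McKay

namespace McKay

/-! ### The binary polyhedral groups at the branch node -/

open Complex (I)

section
variable {S : Subgroup SU2} {n : ℕ}

lemma symIrred_zero (S : Subgroup SU2) : SymIrred S 0 := by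
  intro x _
  refine ⟨x (fun i => i.elim0) (fun i => i.elim0), ?_⟩
  rw [jw_zero, one_mul, mul_one]
  ext r s
  rw [Subsingleton.elim r fun i => i.elim0, Subsingleton.elim s fun i => i.elim0]
  simp

lemma tensorPow_comm_topE (g : Matrix (Fin 2) (Fin 2) ℂ) (k : ℕ) :
    tensorPow g (k + 2) * topE k = topE k * tensorPow g (k + 2) := by
  rw [tensorPow_mul_topE_det, topE_mul_tensorPow_det, topE_comm]

lemma tensorPow_comm_jw (g : Matrix (Fin 2) (Fin 2) ℂ) (k : ℕ) :
    tensorPow g k * jw k = jw k * tensorPow g k := by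
  induction k with
  | zero => rw [jw_zero, one_mul, mul_one]
  | succ k ih =>
    have h1 : Commute (tensorPow g (k + 1)) (ext1 k (jw k)) := ext1_comm_tensorPow ih
    have h2 : Commute (tensorPow g (k + 1)) (tl (k + 1) k) := by
      cases k with
      | zero => rw [tl, dif_neg (by simp)]; exact Commute.zero_right _
      | succ k => exact tensorPow_comm_topE g k
    rw [jw_succ]
    exact h1.sub_right (((h1.mul_right h2).mul_right h1).smul_right _)

lemma tensorPow_smul (a : ℂ) (g : Matrix (Fin 2) (Fin 2) ℂ) (k : ℕ) :
    tensorPow (a • g) k = a ^ k • tensorPow g k := by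
  ext r s
  simp [tensorPow, Finset.prod_mul_distrib]

/-- If g permutes a set of matrices up to scalars that disappear in the k-th power, the sum of their
k-th tensor powers commutes with g. -/
lemma tensorPow_comm_sum {ι : Type} [Fintype ι] {g : Matrix (Fin 2) (Fin 2) ℂ}
    {A : ι → Matrix (Fin 2) (Fin 2) ℂ} {σ : ι → ι} (hσ : Function.Injective σ) {ε : ι → ℂ} {k : ℕ}
    (hε : ∀ i, ε i ^ k = 1) (h : ∀ i, g * A i = ε i • (A (σ i) * g)) :
    tensorPow g k * ∑ i, tensorPow (A i) k = (∑ i, tensorPow (A i) k) * tensorPow g k := by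
  rw [Finset.mul_sum, ← (Finite.injective_iff_bijective.mp hσ).sum_comp fun i => tensorPow (A i) k,
    Finset.sum_mul]
  refine Finset.sum_congr rfl fun i _ => ?_
  rw [← tensorPow_mul, h, tensorPow_smul, hε, one_smul, tensorPow_mul]

/-- The row of v_{-1} ⊗ ⋯ ⊗ v_{-1} in `jw` X is that of X. An off-diagonal entry there shows that
`jw` X is not a multiple of `jw`, so its harmonic part is not zero. -/
lemma exists_harmonic_ne_zero (hS : ∀ k ≤ n, SymIrred S k) {X : TensorEnd (n + 1)}
    (hX : X ∈ centralizerAlg S (n + 1)) (hc : X * jw (n + 1) = jw (n + 1) * X)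
    {s : Fin (n + 1) → Fin 2} (hs : (fun _ => 0) ≠ s) (h : X (fun _ => 0) s ≠ 0) :
    ∃ y, Harmonic S n y ∧ y ≠ 0 := by
  have hF := jw_preFam (n := n + 1) fun k hk => hS k (by omega)
  have hJ : jw (n + 1) * jw (n + 1) = jw (n + 1) := hF.idem 0
  obtain ⟨a, ha⟩ := exists_harmonic hS (mul_mem (hF.mem 0) hX)
    (by rw [← mul_assoc, hJ]) (by rw [mul_assoc, hc, ← mul_assoc, hJ])
  refine ⟨_, ha, fun h0 => h ?_⟩
  have h1 := congrFun (congrFun (sub_eq_zero.mp h0) fun _ => 0) s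
  simpa [Matrix.mul_apply, jw_row_zero, hs] using h1

/-- The pure quaternion `a i + b j + c k`. -/
def pureQuat (a b c : ℂ) : Matrix (Fin 2) (Fin 2) ℂ := !![a * I, b + c * I; -b + c * I, -a * I]

/-- The four diagonals of the cube. -/
def tetAxis : Fin 4 → Matrix (Fin 2) (Fin 2) ℂ :=
  ![pureQuat 1 1 1, pureQuat 1 (-1) (-1), pureQuat (-1) 1 (-1), pureQuat (-1) (-1) 1]

/-- The three axes of the octahedron. -/
def octAxis : Fin 3 → Matrix (Fin 2) (Fin 2) ℂ :=
  ![pureQuat 1 0 0, pureQuat 0 1 0, pureQuat 0 0 1]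

/-- The six axes of the icosahedron. -/
def icosAxis (f : ℂ) : Fin 6 → Matrix (Fin 2) (Fin 2) ℂ :=
  ![pureQuat 1 f 0, pureQuat 1 (-f) 0, pureQuat 0 1 f, pureQuat 0 1 (-f), pureQuat f 0 1,
    pureQuat (-f) 0 1]

lemma exists_harmonic_tet (hS : ∀ k ≤ 2, SymIrred (Subgroup.closure {quatI, quatOmega}) k) :
    ∃ y, Harmonic (Subgroup.closure {quatI, quatOmega}) 2 y ∧ y ≠ 0 := by
  -- Both generators permute the oriented axes without signs, so an odd power is possible. The index
  -- s is chosen to belong to the coefficient of x z⁵, one of the two monomials of the invariant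
  -- sextic.
  refine exists_harmonic_ne_zero hS (X := ∑ i, tensorPow (tetAxis i) 3) (s := ![0, 1, 1])
    (mem_centralizerAlg_closure.mpr ?_) ?_ (by decide) ?_
  · rintro g (rfl | rfl)
    · refine tensorPow_comm_sum (σ := ![1, 0, 3, 2]) (ε := fun _ => 1) (by decide) (by simp)
        fun i => ?_
      rw [one_smul]
      fin_cases i <;> ext i j <;> fin_cases i <;> fin_cases j <;>
        simp [quatI, quat_coe, tetAxis, pureQuat] <;> ring
    · refine tensorPow_comm_sum (σ := ![0, 2, 3, 1]) (ε := fun _ => 1) (by decide) (by simp)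
        fun i => ?_
      rw [one_smul]
      fin_cases i <;> ext i j <;> fin_cases i <;> fin_cases j <;>
        simp [quatOmega, quat_coe, tetAxis, pureQuat] <;> ring_nf <;>
        (try simp only [Complex.I_sq]) <;> ring_nf
  · rw [Finset.sum_mul, Finset.mul_sum]
    exact Finset.sum_congr rfl fun i _ => tensorPow_comm_jw _ _
  · simp [Matrix.sum_apply, Fin.sum_univ_four, tensorPow, Fin.prod_univ_three, tetAxis, pureQuat]
    intro h
    have : (-8 : ℂ) = 0 := by linear_combination h - 8 * Complex.I_sq
    norm_num at this

lemma exists_harmonic_oct (hS : ∀ k ≤ 3, SymIrred (Subgroup.closure {quatOct, quatOmega}) k) :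
    ∃ y, Harmonic (Subgroup.closure {quatOct, quatOmega}) 3 y ∧ y ≠ 0 := by
  -- The axes are permuted up to sign, and the signs disappear in the fourth power. The chosen entry
  -- belongs to the coefficient of z⁸.
  refine exists_harmonic_ne_zero hS (X := ∑ i, tensorPow (octAxis i) 4) (s := fun _ => 1)
    (mem_centralizerAlg_closure.mpr ?_) ?_ (by decide) ?_
  · rintro g (rfl | rfl)
    · refine tensorPow_comm_sum (σ := ![0, 2, 1]) (ε := ![1, 1, -1]) (by decide)
        (fun i => by fin_cases i <;> norm_num) fun i => ?_
      fin_cases i <;> ext i j <;> fin_cases i <;> fin_cases j <;>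
        simp [quatOct, quat_coe, octAxis, pureQuat] <;> ring_nf <;>
        (try simp only [Complex.I_sq]) <;> ring_nf
    · refine tensorPow_comm_sum (σ := ![1, 2, 0]) (ε := fun _ => 1) (by decide) (by simp)
        fun i => ?_
      rw [one_smul]
      fin_cases i <;> ext i j <;> fin_cases i <;> fin_cases j <;>
        simp [quatOmega, quat_coe, octAxis, pureQuat] <;> ring_nf <;>
        (try simp only [Complex.I_sq]) <;> ring_nf
  · rw [Finset.sum_mul, Finset.mul_sum]
    exact Finset.sum_congr rfl fun i _ => tensorPow_comm_jw _ _
  · simp [Matrix.sum_apply, Fin.sum_univ_three, tensorPow, octAxis, pureQuat]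

lemma goldenRatio_sq_complex :
    (Real.goldenRatio : ℂ) ^ 2 = Real.goldenRatio + 1 := by
  rw [← Complex.ofReal_pow, Real.goldenRatio_sq, Complex.ofReal_add, Complex.ofReal_one]

lemma quatIcos_coe :
    quatIcos.1 = !![(Real.goldenRatio : ℂ) / 2 + (Real.goldenRatio - 1) / 2 * I, 1 / 2;
      -1 / 2, (Real.goldenRatio : ℂ) / 2 - (Real.goldenRatio - 1) / 2 * I] := by
  have h : ∀ g : ℝ, g⁻¹ = g - 1 → ∀ h, (quat (g / 2) (g⁻¹ / 2) (1 / 2) 0 h).1 =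
      !![(g : ℂ) / 2 + (g - 1) / 2 * I, 1 / 2; -1 / 2, (g : ℂ) / 2 - (g - 1) / 2 * I] := by
    intro g hg h
    rw [quat_coe, hg]
    simp [neg_div]
  refine h _ ?_ _
  rw [Real.inv_goldenRatio, ← Real.one_sub_goldenRatio]
  ring

lemma exists_harmonic_icos (hS : ∀ k ≤ 5, SymIrred (Subgroup.closure {quatIcos, quatOmega}) k) :
    ∃ y, Harmonic (Subgroup.closure {quatIcos, quatOmega}) 5 y ∧ y ≠ 0 := by
  have hf := goldenRatio_sq_complex
  have hf0 : (Real.goldenRatio : ℂ) ≠ 0 := Complex.ofReal_ne_zero.mpr Real.goldenRatio_ne_zero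
  have hico := quatIcos_coe
  generalize hff : (Real.goldenRatio : ℂ) = f at *
  refine exists_harmonic_ne_zero hS (X := ∑ i, tensorPow (icosAxis f i) 6) (s := fun _ => 1)
    (mem_centralizerAlg_closure.mpr ?_) ?_ (by decide) ?_
  · rintro g (rfl | rfl)
    · refine tensorPow_comm_sum (σ := ![0, 2, 4, 1, 5, 3]) (ε := ![1, -1, 1, -1, -1, -1])
        (by decide) (fun i => by fin_cases i <;> norm_num) fun i => ?_
      fin_cases i <;> ext i j <;> fin_cases i <;> fin_cases j <;>
        simp [hico, icosAxis, pureQuat] <;> ring_nf <;>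
        (try simp only [hf, Complex.I_sq]) <;> ring_nf
    · refine tensorPow_comm_sum (σ := ![2, 3, 4, 5, 0, 1]) (ε := fun _ => 1) (by decide) (by simp)
        fun i => ?_
      rw [one_smul]
      fin_cases i <;> ext i j <;> fin_cases i <;> fin_cases j <;>
        simp [quatOmega, quat_coe, icosAxis, pureQuat] <;> ring_nf <;>
        (try simp only [Complex.I_sq]) <;> ring_nf
  · rw [Finset.sum_mul, Finset.mul_sum]
    exact Finset.sum_congr rfl fun i _ => tensorPow_comm_jw _ _
  · simp [Matrix.sum_apply, Fin.sum_univ_six, tensorPow, icosAxis, pureQuat]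
    intro h
    -- With f the golden ratio, the entries of the six axes add up to 30 (f⁴ - f²) = 30 f³.
    have : f ^ 3 * 30 = 0 := by
      linear_combination h - 30 * f ^ 2 * hf - (30 * f ^ 2 + 30 * f ^ 4 * (I ^ 2 - 1) +
        2 * f ^ 6 * (I ^ 4 - I ^ 2 + 1)) * Complex.I_sq
    simp [hf0] at this

/-- The situation at the branch node of a binary polyhedral group: `V^{⊗k}` has the same
endomorphisms as for `SU₂` for `k ≤ l`, and `Sym^{l+1} V` is the sum of two irreducible modules. -/
structure SplitsAt (G : Subgroup SU2) (l : ℕ) : Prop where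
  symIrred : ∀ k ≤ l, SymIrred G k
  fam : ∃ b : Fin 2 → TensorEnd (l + 1), Fam G (l + 1) b ∧ b 0 + b 1 = jw (l + 1) ∧ ∀ i, b i ≠ 0

lemma SplitsAt.conj {l : ℕ} (h : SplitsAt S l) (u : SU2) :
    SplitsAt (S.map (MulAut.conj u).toMonoidHom) l := by
  refine ⟨fun k hk => (h.symIrred k hk).conj u, ?_⟩
  obtain ⟨b, hb, h1, h0⟩ := h.fam
  refine ⟨_, hb.conj u, ?_,
    fun i hi => h0 i (conjBy_injective u (hi.trans (conjBy_zero u).symm))⟩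
  rw [← conjBy_add, h1, conjBy_jw]

lemma splitsAt_tetrahedral : SplitsAt (Subgroup.closure {quatI, quatOmega}) 2 := by
  have hi : quatI ∈ Subgroup.closure {quatI, quatOmega} := Subgroup.subset_closure (by simp)
  have hω : quatOmega ∈ Subgroup.closure {quatI, quatOmega} := Subgroup.subset_closure (by simp)
  have hS := symIrred_of_tetInv (symIrred_zero _) hi hω
  obtain ⟨y, hy, hy0⟩ := exists_harmonic_tet hS
  exact ⟨hS, exists_fam_two hS (fun _ _ h1 h2 h0 =>
    h1.eq_smul (fun A hA => form_tet_eq_zero hi hω hA) h2 h0) hy hy0⟩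

lemma splitsAt_octahedral : SplitsAt (Subgroup.closure {quatOct, quatOmega}) 3 := by
  have ho : quatOct ∈ Subgroup.closure {quatOct, quatOmega} := Subgroup.subset_closure (by simp)
  have hω : quatOmega ∈ Subgroup.closure {quatOct, quatOmega} := Subgroup.subset_closure (by simp)
  have hi := quatOct_sq ▸ mul_mem ho ho
  have hS := symIrred_of_tetInv (symIrred_zero _) hi hω
  have h3 := symIrred_succ_of_form hS fun A hA => form_oct_three ho hω hA
  have hS3 : ∀ k ≤ 3, SymIrred (Subgroup.closure {quatOct, quatOmega}) k := fun k hk =>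
    (Nat.le_succ_iff.mp hk).elim (hS k) (fun h => h ▸ h3)
  obtain ⟨y, hy, hy0⟩ := exists_harmonic_oct hS3
  exact ⟨hS3, exists_fam_two hS3 (fun _ _ h1 h2 h0 =>
    h1.eq_smul (fun A hA => form_oct_four hi hω hA) h2 h0) hy hy0⟩

/-- This relation expresses j, and then i, in the generators: the icosahedral group contains the
tetrahedral one, whose invariant forms are already known. -/
lemma omega_mul_quatIcos_sq : quatOmega * (quatIcos * quatIcos) = quatIcos * quatJ := by
  have hf := goldenRatio_sq_complex
  apply Subtype.ext
  rw [Submonoid.coe_mul, Submonoid.coe_mul, Submonoid.coe_mul, quatIcos_coe, quatOmega, quatJ,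
    quat_coe, quat_coe]
  generalize (Real.goldenRatio : ℂ) = f at *
  ext i j
  fin_cases i <;> fin_cases j <;> simp [Matrix.mul_apply, Fin.sum_univ_two] <;> ring_nf <;>
    simp only [hf, Complex.I_sq, I_pow_three] <;> ring_nf

lemma splitsAt_icosahedral : SplitsAt (Subgroup.closure {quatIcos, quatOmega}) 5 := by
  have hc : quatIcos ∈ Subgroup.closure {quatIcos, quatOmega} := Subgroup.subset_closure (by simp)
  have hω : quatOmega ∈ Subgroup.closure {quatIcos, quatOmega} := Subgroup.subset_closure (by simp)
  have hj : quatJ ∈ Subgroup.closure {quatIcos, quatOmega} := by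
    have h : quatJ = quatIcos⁻¹ * (quatOmega * (quatIcos * quatIcos)) := by
      rw [omega_mul_quatIcos_sq, inv_mul_cancel_left]
    rw [h]
    exact mul_mem (inv_mem hc) (mul_mem hω (mul_mem hc hc))
  have hi : quatI ∈ Subgroup.closure {quatIcos, quatOmega} := by
    have h : quatI = quatOmega⁻¹ * (quatJ * quatOmega) := by
      rw [← quatJ_mul_omega, inv_mul_cancel_left]
    rw [h]
    exact mul_mem (inv_mem hω) (mul_mem hj hω)
  have hS := symIrred_of_tetInv (symIrred_zero _) hi hω
  have h3 := symIrred_succ_of_form hS fun A hA => form_icos_three hi hω hc hA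
  have hS3 : ∀ k ≤ 3, SymIrred (Subgroup.closure {quatIcos, quatOmega}) k := fun k hk =>
    (Nat.le_succ_iff.mp hk).elim (hS k) (fun h => h ▸ h3)
  have h4 := symIrred_succ_of_form hS3 fun A hA => form_icos_four hi hω hc hA
  have hS4 : ∀ k ≤ 4, SymIrred (Subgroup.closure {quatIcos, quatOmega}) k := fun k hk =>
    (Nat.le_succ_iff.mp hk).elim (hS3 k) (fun h => h ▸ h4)
  have h5 := symIrred_succ_of_form hS4 fun A hA => form_icos_five hi hω hA
  have hS5 : ∀ k ≤ 5, SymIrred (Subgroup.closure {quatIcos, quatOmega}) k := fun k hk =>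
    (Nat.le_succ_iff.mp hk).elim (hS4 k) (fun h => h ▸ h5)
  obtain ⟨y, hy, hy0⟩ := exists_harmonic_icos hS5
  exact ⟨hS5, exists_fam_two hS5 (fun _ _ h1 h2 h0 =>
    h1.eq_smul (fun A hA => form_icos_six hi hω hc hA) h2 h0) hy hy0⟩

end

end McKay

namespace McKay

/-! ### Cyclic and binary dihedral groups -/

open Complex (I)

variable {k : ℕ}

/-- The projection onto the line spanned by `v_a ⊗ ⋯ ⊗ v_a`. -/
def cyc (k : ℕ) (a : Fin 2) : TensorEnd k := Matrix.single (fun _ => a) (fun _ => a) 1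

lemma const_eq_snoc (k : ℕ) (a : Fin 2) :
    (fun _ => a : Fin (k + 1) → Fin 2) = snoc (fun _ => a) a := by
  funext i
  refine Fin.lastCases ?_ (fun i => ?_) i
  · rw [snoc_last]
  · rw [snoc_castSucc]

lemma cyc_mul_cyc_self (k : ℕ) (a : Fin 2) : cyc k a * cyc k a = cyc k a := by
  simp [cyc, Matrix.single_mul_single_same]

lemma const_ne_const (k : ℕ) {a b : Fin 2} (h : a ≠ b) :
    (fun _ => a : Fin (k + 1) → Fin 2) ≠ fun _ => b := fun h1 => h (congrFun h1 0)

lemma cyc_mul_cyc (k : ℕ) (a b : Fin 2) :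
    cyc (k + 1) a * cyc (k + 1) b = if a = b then cyc (k + 1) a else 0 := by
  split_ifs with h
  · rw [← h, cyc_mul_cyc_self]
  · exact Matrix.single_mul_single_of_ne _ _ _ _ (const_ne_const k h) _

lemma trace_cyc (k : ℕ) (a : Fin 2) : (cyc k a).trace = 1 := by
  rw [cyc, Matrix.trace_single_eq_same]

lemma cyc_one : cyc 1 0 + cyc 1 1 = 1 := by
  ext r s
  have h : ∀ (t : Fin 1 → Fin 2) (a : Fin 2), ((fun _ => a) = t) ↔ a = t 0 := fun t a =>
    ⟨fun h => congrFun h 0, fun h => by funext i; rw [h, Subsingleton.elim i 0]⟩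
  have h' : r = s ↔ r 0 = s 0 := ⟨fun h => congrFun h 0, fun h => by
    funext i; rw [Subsingleton.elim i 0, h]⟩
  simp only [cyc, Matrix.single, Matrix.add_apply, Matrix.of_apply, h, Matrix.one_apply, h']
  generalize r 0 = a
  generalize s 0 = b
  fin_cases a <;> fin_cases b <;> simp

lemma ext1_single_mul (p q : Fin k → Fin 2) (x : TensorEnd (k + 1)) (r : Fin k → Fin 2)
    (b : Fin 2) (t : Fin (k + 1) → Fin 2) :
    (ext1 k (Matrix.single p q 1) * x) (snoc r b) t = if p = r then x (snoc q b) t else 0 := by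
  rw [Matrix.mul_apply, sum_snoc]
  simp only [ext1_snoc, Matrix.single, Matrix.of_apply, ite_mul, zero_mul, one_mul, ite_and]
  simp

lemma mul_ext1_single (p q : Fin k → Fin 2) (x : TensorEnd (k + 1)) (r : Fin k → Fin 2)
    (b : Fin 2) (t : Fin (k + 1) → Fin 2) :
    (x * ext1 k (Matrix.single p q 1)) t (snoc r b) = if q = r then x t (snoc p b) else 0 := by
  rw [Matrix.mul_apply, sum_snoc]
  simp only [ext1_snoc, Matrix.single, Matrix.of_apply, mul_ite, mul_zero, mul_one, ite_and]
  simp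

lemma ext1_cyc_mul_topE_mul (k : ℕ) (a b : Fin 2) (r s : Fin (k + 1) → Fin 2) (c d : Fin 2) :
    (ext1 (k + 1) (cyc (k + 1) a) * topE k * ext1 (k + 1) (cyc (k + 1) b)) (snoc r c) (snoc s d) =
      if (fun _ => a) = r ∧ (fun _ => b) = s ∧ (fun _ => a : Fin k → Fin 2) = (fun _ => b) then
        asym a c * asym b d else 0 := by
  rw [cyc, cyc, mul_ext1_single, ext1_single_mul, const_eq_snoc, const_eq_snoc, topE_snoc]
  by_cases h1 : snoc (fun _ => a) a = r
  · by_cases h2 : snoc (fun _ => b) b = s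
    · simp only [h1, h2, true_and, if_true]
    · simp only [h2, false_and, and_false, if_false]
  · simp only [h1, false_and, if_false, ite_self]

/-- With c the projection onto the line of v_a^{⊗(k+1)}, the operator c e c projects onto the line
of v_a^{⊗(k+1)} ⊗ v_b with b ≠ a. -/
lemma ext1_cyc_sub (k : ℕ) (a : Fin 2) : ext1 (k + 1) (cyc (k + 1) a) -
    ext1 (k + 1) (cyc (k + 1) a) * topE k * ext1 (k + 1) (cyc (k + 1) a) = cyc (k + 2) a := by
  refine ext_snoc fun r c s d => ?_
  rw [Matrix.sub_apply, ext1_cyc_mul_topE_mul, ext1_snoc]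
  simp only [cyc, Matrix.single, Matrix.of_apply, const_eq_snoc (k + 1), snoc_inj]
  by_cases h1 : (fun _ => a) = r
  swap
  · by_cases hs : r = s
    · simp only [h1, hs ▸ h1, false_and, if_false, and_false, sub_zero, ite_self]
    · simp only [h1, false_and, if_false, ite_self, sub_zero]
  subst h1
  by_cases h2 : (fun _ => a) = s
  swap
  · simp only [h2, true_and, false_and, and_false, if_false, ite_self, sub_zero]
  subst h2
  simp only [true_and, and_true, if_true]
  fin_cases a <;> fin_cases c <;> fin_cases d <;> simp [asym]

lemma child_cyc (k : ℕ) (a : Fin 2) : child (cyc (k + 1) a) (cyc k a) = cyc (k + 2) a := by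
  rw [child, trace_cyc, trace_cyc, div_one, one_smul, ext1_cyc_sub]

lemma ext1_cyc_mul (k : ℕ) (a : Fin 2) : ext1 k (cyc k a) * cyc (k + 1) a = cyc (k + 1) a := by
  refine ext_snoc fun r c s d => ?_
  rw [cyc, ext1_single_mul]
  simp only [cyc, Matrix.single, Matrix.of_apply, const_eq_snoc k, snoc_inj]
  by_cases h : (fun _ => a) = r <;> simp only [h, true_and, false_and, if_true, if_false]

lemma mul_ext1_cyc (k : ℕ) (a : Fin 2) : cyc (k + 1) a * ext1 k (cyc k a) = cyc (k + 1) a := by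
  refine ext_snoc fun r c s d => ?_
  rw [cyc, cyc, mul_ext1_single]
  simp only [Matrix.single, Matrix.of_apply, const_eq_snoc k, snoc_inj]
  by_cases h : (fun _ => a) = s <;>
    simp only [h, true_and, false_and, and_false, if_true, if_false]

/-! #### The action of a diagonal matrix -/

lemma diagElt_coe (ζ : Circle) : (diagElt ζ).1 = Matrix.diagonal ![((ζ⁻¹ : Circle) : ℂ), (ζ : ℂ)] := by
  have h : star ((ζ⁻¹ : Circle) : ℂ) = ζ := by
    rw [Circle.coe_inv_eq_conj]; simp
  ext i j
  fin_cases i <;> fin_cases j <;> simp [diagElt, mkSU2, -Circle.coe_inv, h]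

lemma tensorPow_diagonal (d : Fin 2 → ℂ) (k : ℕ) :
    tensorPow (Matrix.diagonal d) k = Matrix.diagonal fun r => ∏ i, d (r i) := by
  ext r s
  rw [tensorPow, Matrix.of_apply]
  by_cases h : r = s
  · subst h; simp
  · rw [Matrix.diagonal_apply_ne _ h]
    obtain ⟨i, hi⟩ := Function.ne_iff.mp h
    exact Finset.prod_eq_zero (Finset.mem_univ i) (by simp [hi])

/-- The weight of a simple tensor. -/
def weight (ζ : Circle) (r : Fin k → Fin 2) : ℂ := ∏ i, ![((ζ⁻¹ : Circle) : ℂ), (ζ : ℂ)] (r i)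

lemma tensorPow_diagElt_comm {ζ : Circle} {x : TensorEnd k} :
    tensorPow (diagElt ζ).1 k * x = x * tensorPow (diagElt ζ).1 k ↔
      ∀ r s, weight ζ r * x r s = x r s * weight ζ s := by
  rw [diagElt_coe, tensorPow_diagonal, ← Matrix.ext_iff]
  simp only [Matrix.diagonal_mul, Matrix.mul_diagonal, weight]

/-- The quotient of the two weights is ζ² or its inverse to the power m, where m is the number of
letters of t different from a; here 1 ≤ m ≤ k. -/
lemma weight_ne {ζ : Circle} (hζ : ∀ j, 1 ≤ j → j ≤ k → ζ ^ (2 * j) ≠ 1) {a : Fin 2}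
    {t : Fin k → Fin 2} (ht : t ≠ fun _ => a) : weight ζ t ≠ weight ζ (fun _ => a : Fin k → Fin 2) := by
  intro h
  set d : Fin 2 → Circle := ![ζ⁻¹, ζ] with hd
  have hw : ∀ r : Fin k → Fin 2, weight ζ r = ((∏ i, d (r i) : Circle) : ℂ) := by
    intro r
    refine Eq.trans ?_ (map_prod Circle.coeHom (fun i => d (r i)) Finset.univ).symm
    refine Finset.prod_congr rfl fun i _ => ?_
    generalize r i = b
    fin_cases b <;> simp [hd] <;> rfl
  rw [hw, hw] at h
  have h1 : ∏ i, d (t i) = ∏ _i : Fin k, d a := Subtype.ext h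
  have h2 : ∏ i, d (t i) / d a = 1 := by rw [Finset.prod_div_distrib, h1, div_self']
  have h3 : ∀ i, d (t i) / d a = if t i = a then 1 else d (a + 1) / d a := by
    intro i
    generalize t i = b
    fin_cases a <;> fin_cases b <;> simp
  rw [Finset.prod_congr rfl fun i _ => h3 i, Finset.prod_ite, Finset.prod_const_one, one_mul,
    Finset.prod_const] at h2
  set m := (Finset.univ.filter fun i => ¬ t i = a).card with hm
  have hm1 : 1 ≤ m := by
    obtain ⟨i, hi⟩ := Function.ne_iff.mp ht
    exact Finset.card_pos.mpr ⟨i, by simpa using hi⟩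
  have hmk : m ≤ k := (Finset.card_le_univ _).trans (by simp)
  refine hζ m hm1 hmk ?_
  fin_cases a
  · simpa [hd, div_eq_mul_inv, pow_mul, pow_two] using h2
  · rw [pow_mul, ← inv_eq_one, ← inv_pow]
    simpa [hd, div_eq_mul_inv, pow_two] using h2

lemma cyc_comm_diagElt (ζ : Circle) (k : ℕ) (a : Fin 2) :
    tensorPow (diagElt ζ).1 k * cyc k a = cyc k a * tensorPow (diagElt ζ).1 k := by
  rw [tensorPow_diagElt_comm]
  intro r s
  simp only [cyc, Matrix.single, Matrix.of_apply]
  split_ifs with h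
  · rw [← h.1, ← h.2, mul_comm]
  · simp

/-- The extreme weight has multiplicity one in V^{⊗k}, so an operator commuting with the diagonal
element has v_a^{⊗k} as an eigenvector, and so has its transpose. -/
lemma cyc_mul_of_comm {ζ : Circle} (hζ : ∀ j, 1 ≤ j → j ≤ k → ζ ^ (2 * j) ≠ 1) {x : TensorEnd k}
    (hx : tensorPow (diagElt ζ).1 k * x = x * tensorPow (diagElt ζ).1 k) (a : Fin 2) :
    cyc k a * x = x (fun _ => a) (fun _ => a) • cyc k a ∧
      x * cyc k a = x (fun _ => a) (fun _ => a) • cyc k a := by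
  rw [tensorPow_diagElt_comm] at hx
  constructor
  · ext r s
    rw [cyc, Matrix.smul_apply]
    by_cases hr : (fun _ => a) = r
    · subst hr
      rw [Matrix.single_mul_apply_same, one_mul]
      by_cases hs : s = fun _ => a
      · subst hs; simp
      · have h1 := hx (fun _ => a) s
        rw [mul_comm, ← sub_eq_zero, ← mul_sub, mul_eq_zero, sub_eq_zero] at h1
        rw [h1.resolve_right (weight_ne hζ hs).symm, Matrix.single_apply_of_ne, smul_zero]
        exact fun h => hs h.2.symm
    · rw [Matrix.single_mul_apply_of_ne _ _ _ _ _ (Ne.symm hr), Matrix.single_apply_of_ne, smul_zero]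
      exact fun h => hr h.1
  · ext r s
    rw [cyc, Matrix.smul_apply]
    by_cases hs : (fun _ => a) = s
    · subst hs
      rw [Matrix.mul_single_apply_same, mul_one]
      by_cases hr : r = fun _ => a
      · subst hr; simp
      · have h1 := hx r fun _ => a
        rw [mul_comm, ← sub_eq_zero, ← mul_sub, mul_eq_zero, sub_eq_zero] at h1
        rw [h1.resolve_right (weight_ne hζ hr), Matrix.single_apply_of_ne, smul_zero]
        exact fun h => hr h.1.symm
    · rw [Matrix.mul_single_apply_of_ne _ _ _ _ _ (Ne.symm hs), Matrix.single_apply_of_ne, smul_zero]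
      exact fun h => hs h.2

/-! #### Cyclic groups -/

section
variable {ζ : Circle}

lemma mem_centralizerAlg_diag {x : TensorEnd k} :
    x ∈ centralizerAlg (Subgroup.closure {diagElt ζ}) k ↔
      tensorPow (diagElt ζ).1 k * x = x * tensorPow (diagElt ζ).1 k := by
  rw [mem_centralizerAlg_closure]
  simp

lemma isParent_cyc (hζ : ∀ j, 1 ≤ j → j ≤ k → ζ ^ (2 * j) ≠ 1) (a : Fin 2) :
    IsParent (Subgroup.closure {diagElt ζ}) k (cyc k a) (cyc (k + 1) a) :=
  ⟨mem_centralizerAlg_diag.mpr (cyc_comm_diagElt ζ _ a), cyc_mul_cyc_self k a,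
    fun x hx => ⟨x (fun _ => a) (fun _ => a), by
      rw [(cyc_mul_of_comm hζ (mem_centralizerAlg_diag.mp hx) a).1, smul_mul_assoc,
        cyc_mul_cyc_self]⟩, ext1_cyc_mul k a, mul_ext1_cyc k a⟩

lemma PreFam.fam_cyc (hζ : ∀ j, 1 ≤ j → j ≤ k + 1 → ζ ^ (2 * j) ≠ 1)
    (h : PreFam (Subgroup.closure {diagElt ζ}) (k + 1) (cyc (k + 1))) :
    Fam (Subgroup.closure {diagElt ζ}) (k + 1) (cyc (k + 1)) := by
  refine ⟨h, fun a x hx => ?_, fun a b hab x hx => ?_⟩ <;>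
  rw [(cyc_mul_of_comm hζ (mem_centralizerAlg_diag.mp hx) a).1, smul_mul_assoc]
  · exact ⟨_, by rw [cyc_mul_cyc_self]⟩
  · rw [cyc_mul_cyc, if_neg hab, smul_zero]

lemma fam_cyc (n : ℕ) (hζ : ∀ j, 1 ≤ j → j ≤ n + 1 → ζ ^ (2 * j) ≠ 1) :
    Fam (Subgroup.closure {diagElt ζ}) (n + 1) (cyc (n + 1)) := by
  induction n with
  | zero =>
    refine PreFam.fam_cyc hζ ⟨fun a => mem_centralizerAlg_diag.mpr (cyc_comm_diagElt ζ _ a),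
      cyc_mul_cyc 0, fun i x _ => by simp [tl], fun i x _ => by simp [tl], ?_⟩
    rw [Fin.sum_univ_two, cyc_one, sub_self]
    exact zero_mem _
  | succ n ih =>
    have h := ih fun j h1 h2 => hζ j h1 (by omega)
    have h2 := h.preFam_child fun a => isParent_cyc (fun j h1 h2 => hζ j h1 (by omega)) a
    simp only [child_cyc] at h2
    exact h2.fam_cyc hζ

end

lemma topE_mul_cyc_two (a : Fin 2) : topE 0 * cyc 2 a = 0 ∧ cyc 2 a * topE 0 = 0 := by
  -- The identity does not involve ζ, and at level 0 the condition on ζ is empty, so ζ = 1 will do.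
  have hp := isParent_cyc (ζ := 1) (k := 0) (fun j _ _ => by omega) a
  have h := mem_centralizerAlg_diag.mpr (cyc_comm_diagElt 1 1 a)
  rw [← child_cyc]
  exact ⟨hp.topE_mul_child h (cyc_mul_cyc_self 1 a), hp.child_mul_topE h (cyc_mul_cyc_self 1 a)⟩

/-! #### Binary dihedral groups -/

lemma exists_smul_of_trace_eq_one {n : Type} [Fintype n] [DecidableEq n] {q : Matrix n n ℂ}
    (hq : q * q = q) (h : q.trace = 1) (x : Matrix n n ℂ) : ∃ a : ℂ, q * x * q = a • q := by
  rw [trace_eq_finrank hq, Nat.cast_eq_one, finrank_eq_one_iff'] at h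
  obtain ⟨⟨v, hv⟩, -, h⟩ := h
  have h1 : ∀ w, ∃ a : ℂ, a • v = q.mulVec w := fun w => by
    obtain ⟨a, ha⟩ := h ⟨q.mulVec w, w, rfl⟩
    exact ⟨a, congrArg Subtype.val ha⟩
  obtain ⟨a, ha⟩ := h1 (x.mulVec v)
  refine ⟨a, Matrix.toLin'.injective (LinearMap.ext fun w => ?_)⟩
  obtain ⟨b, hb⟩ := h1 w
  simp only [Matrix.toLin'_apply, Matrix.smul_mulVec, ← Matrix.mulVec_mulVec, ← hb,
    Matrix.mulVec_smul, ← ha]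
  rw [smul_comm]

section
variable {G : Subgroup SU2}

lemma PreFam.split {c u : TensorEnd k} (h : PreFam G k fun _ : Fin 1 => c)
    (hu : u ∈ centralizerAlg G k) (huu : u * u = u) (hcu : c * u = u) (huc : u * c = u) :
    PreFam G k ![u, c - u] := by
  have hc := h.mem 0
  have hcc : c * c = c := h.idem 0
  have hv : ∀ i, ![u, c - u] i ∈ centralizerAlg G k ∧ c * ![u, c - u] i = ![u, c - u] i ∧
      ![u, c - u] i * c = ![u, c - u] i := by
    intro i
    fin_cases i
    · exact ⟨hu, hcu, huc⟩
    · refine ⟨sub_mem hc hu, ?_, ?_⟩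
      · change c * (c - u) = c - u
        rw [mul_sub, hcc, hcu]
      · change (c - u) * c = c - u
        rw [sub_mul, hcc, huc]
  refine ⟨fun i => (hv i).1, fun i j => ?_, fun i x hx => ?_, fun i x hx => ?_, ?_⟩
  · fin_cases i <;> fin_cases j <;> simp [mul_sub, sub_mul, huu, hcu, huc, hcc]
  · rw [← (hv i).2.2, mul_assoc, mul_assoc, ← mul_assoc c, h.left 0 x hx, mul_zero]
  · rw [← (hv i).2.1, ← mul_assoc, h.right 0 x hx, zero_mul]
  · simpa using h.one

lemma PreFam.drop {c : Fin 2 → TensorEnd k} (h : PreFam G k c) (h1 : c 1 = 0) :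
    PreFam G k fun _ : Fin 1 => c 0 :=
  ⟨fun _ => h.mem 0, fun i j => by rw [if_pos (Subsingleton.elim i j), h.idem],
    fun _ => h.left 0, fun _ => h.right 0, by simpa [h1] using h.one⟩

end

/-- The projection onto the span of `v_{-1} ⊗ ⋯ ⊗ v_{-1}` and `v_1 ⊗ ⋯ ⊗ v_1`. -/
def dih (k : ℕ) : TensorEnd k := cyc k 0 + cyc k 1

lemma dih_one : dih 1 = 1 := cyc_one

lemma dih_mul_dih (k : ℕ) : dih (k + 1) * dih (k + 1) = dih (k + 1) := by
  simp [dih, mul_add, add_mul, cyc_mul_cyc]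

lemma trace_dih (k : ℕ) : (dih k).trace = 2 := by
  rw [dih, Matrix.trace_add, trace_cyc, trace_cyc]
  norm_num

/-- The mixed term survives only if the letters before the last of the two constant words agree.
Hence at least two letters are needed, and `child_dih` starts at `dih 2`. -/
lemma ext1_cyc_mul_topE_mul_of_ne (k : ℕ) {a b : Fin 2} (h : a ≠ b) :
    ext1 (k + 2) (cyc (k + 2) a) * topE (k + 1) * ext1 (k + 2) (cyc (k + 2) b) = 0 := by
  refine ext_snoc fun r c s d => ?_
  rw [ext1_cyc_mul_topE_mul, if_neg fun h1 => const_ne_const k h h1.2.2]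
  rfl

lemma child_dih (k : ℕ) : child (dih (k + 2)) (dih (k + 1)) = dih (k + 3) := by
  have h1 := ext1_cyc_sub (k + 1) 0
  have h2 := ext1_cyc_sub (k + 1) 1
  have h3 := ext1_cyc_mul_topE_mul_of_ne k (a := 0) (b := 1) (by decide)
  have h4 := ext1_cyc_mul_topE_mul_of_ne k (a := 1) (b := 0) (by decide)
  rw [child, trace_dih, trace_dih, div_self (by norm_num), one_smul, dih, dih, ← h1, ← h2, map_add,
    add_mul, add_mul, mul_add, mul_add, h3, h4, add_zero, zero_add]
  abel

lemma ext1_cyc_mul_of_ne (k : ℕ) {a b : Fin 2} (h : a ≠ b) :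
    ext1 (k + 1) (cyc (k + 1) a) * cyc (k + 2) b = 0 ∧
      cyc (k + 2) b * ext1 (k + 1) (cyc (k + 1) a) = 0 := by
  constructor
  · rw [← ext1_cyc_mul (k + 1) b, ← mul_assoc, ← map_mul, cyc_mul_cyc, if_neg h, map_zero, zero_mul]
  · rw [← mul_ext1_cyc (k + 1) b, mul_assoc, ← map_mul, cyc_mul_cyc, if_neg h.symm, map_zero, mul_zero]

lemma ext1_dih_mul (k : ℕ) : ext1 (k + 1) (dih (k + 1)) * dih (k + 2) = dih (k + 2) ∧
    dih (k + 2) * ext1 (k + 1) (dih (k + 1)) = dih (k + 2) := by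
  have h3 := ext1_cyc_mul_of_ne k (a := 0) (b := 1) (by decide)
  have h4 := ext1_cyc_mul_of_ne k (a := 1) (b := 0) (by decide)
  constructor <;> simp only [dih, map_add, mul_add, add_mul, h3, h4, ext1_cyc_mul, mul_ext1_cyc,
    add_zero, zero_add]

lemma tensorPow_quatK (k : ℕ) (r s : Fin k → Fin 2) :
    tensorPow quatK.1 k r s = if (fun i => r i + 1) = s then I ^ k else 0 := by
  have h : ∀ a b : Fin 2, quatK.1 a b = if a + 1 = b then I else 0 := by
    intro a b
    fin_cases a <;> fin_cases b <;> simp [quatK, quat_coe]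
  rw [tensorPow, Matrix.of_apply]
  split_ifs with h1
  · subst h1
    simp [h]
  · obtain ⟨i, hi⟩ := Function.ne_iff.mp h1
    exact Finset.prod_eq_zero (Finset.mem_univ i) (by rw [h, if_neg hi])

lemma tensorPow_quatK_comm {x : TensorEnd k} :
    tensorPow quatK.1 k * x = x * tensorPow quatK.1 k ↔
      ∀ r s, x (fun i => r i + 1) s = x r fun i => s i + 1 := by
  have hI : I ^ k ≠ 0 := pow_ne_zero _ Complex.I_ne_zero
  have hf : ∀ s t : Fin k → Fin 2, (fun i => t i + 1) = s ↔ t = fun i => s i + 1 := by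
    intro s t
    have h2 : ∀ a b : Fin 2, a + 1 = b ↔ a = b + 1 := by decide
    simp only [funext_iff, h2]
  rw [← Matrix.ext_iff]
  refine forall_congr' fun r => forall_congr' fun s => ?_
  simp only [Matrix.mul_apply, tensorPow_quatK, ite_mul, zero_mul, mul_ite, mul_zero,
    Finset.sum_ite_eq, Finset.mem_univ, if_true]
  simp only [hf, Finset.sum_ite_eq', Finset.mem_univ, if_true]
  rw [mul_comm, mul_left_inj' hI]

lemma dih_comm_quatK (k : ℕ) :
    tensorPow quatK.1 k * dih k = dih k * tensorPow quatK.1 k := by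
  rw [tensorPow_quatK_comm]
  intro r s
  have h1 : ∀ t : Fin k → Fin 2, ((fun _ => (0 : Fin 2)) = fun i => t i + 1) ↔ (fun _ => 1) = t := by
    intro t
    have h2 : ∀ a : Fin 2, 0 = a + 1 ↔ 1 = a := by decide
    simp only [funext_iff, h2]
  have h2 : ∀ t : Fin k → Fin 2, ((fun _ => (1 : Fin 2)) = fun i => t i + 1) ↔ (fun _ => 0) = t := by
    intro t
    have h2 : ∀ a : Fin 2, 1 = a + 1 ↔ 0 = a := by decide
    simp only [funext_iff, h2]
  simp only [dih, Matrix.add_apply, cyc, Matrix.single, Matrix.of_apply, h1, h2]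
  exact add_comm _ _

section
variable {ζ : Circle}

lemma mem_centralizerAlg_dih {x : TensorEnd k} :
    x ∈ centralizerAlg (Subgroup.closure {diagElt ζ, quatK}) k ↔
      tensorPow (diagElt ζ).1 k * x = x * tensorPow (diagElt ζ).1 k ∧
      tensorPow quatK.1 k * x = x * tensorPow quatK.1 k := by
  rw [mem_centralizerAlg_closure]
  simp

lemma dih_mem (k : ℕ) : dih k ∈ centralizerAlg (Subgroup.closure {diagElt ζ, quatK}) k := by
  refine mem_centralizerAlg_dih.mpr ⟨?_, dih_comm_quatK k⟩
  rw [dih, mul_add, add_mul, cyc_comm_diagElt, cyc_comm_diagElt]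

/-- The eigenvalues on v_{-1}^{⊗k} and v_1^{⊗k} agree because the generator `quatK` exchanges the
two lines. -/
lemma dih_mul_of_mem (hζ : ∀ j, 1 ≤ j → j ≤ k → ζ ^ (2 * j) ≠ 1) {x : TensorEnd k}
    (hx : x ∈ centralizerAlg (Subgroup.closure {diagElt ζ, quatK}) k) :
    ∃ a : ℂ, dih k * x = a • dih k ∧ x * dih k = a • dih k := by
  obtain ⟨h1, h2⟩ := mem_centralizerAlg_dih.mp hx
  have h3 := tensorPow_quatK_comm.mp h2 (fun _ => 0) (fun _ => 1)
  have h0 := cyc_mul_of_comm hζ h1 0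
  have h1 := cyc_mul_of_comm hζ h1 1
  simp only [zero_add, show (1 : Fin 2) + 1 = 0 from rfl] at h3
  rw [h3] at h1
  exact ⟨_, by rw [dih, add_mul, h0.1, h1.1, smul_add], by rw [dih, mul_add, h0.2, h1.2, smul_add]⟩

lemma symIrred_one_dih (hζ : ζ ^ 2 ≠ 1) :
    ∀ k ≤ 1, SymIrred (Subgroup.closure {diagElt ζ, quatK}) k := by
  intro k hk
  interval_cases k
  · exact symIrred_zero _
  · intro x hx
    obtain ⟨a, ha, -⟩ := dih_mul_of_mem
      (fun j h1 h2 => by obtain rfl : j = 1 := by omega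
                         exact hζ) hx
    rw [dih_one, one_mul] at ha
    exact ⟨a, by rw [jw_one, one_mul, mul_one, ha]⟩

/-- Sym² V is the span of the two extreme tensors plus the line of v_{-1} ⊗ v_1 + v_1 ⊗ v_{-1}. The
first part is minimal by `dih_mul_of_mem`, the second by its trace. -/
lemma fam_dih_two (hζ : ∀ j, 1 ≤ j → j ≤ 2 → ζ ^ (2 * j) ≠ 1) :
    Fam (Subgroup.closure {diagElt ζ, quatK}) 2 ![dih 2, jw 2 - dih 2] ∧
      (jw 2 - dih 2).trace = 1 := by
  have hS := symIrred_one_dih (ζ := ζ) (hζ 1 le_rfl (by norm_num))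
  have hJ := jw_preFam (n := 2) fun k hk => hS k (by omega)
  have ht : ∀ i, 1 ≤ i → i < 2 → tl 2 i * dih 2 = 0 ∧ dih 2 * tl 2 i = 0 := by
    intro i h1 h2
    obtain rfl : i = 1 := by omega
    rw [dih, mul_add, add_mul, (topE_mul_cyc_two 0).1, (topE_mul_cyc_two 1).1,
      (topE_mul_cyc_two 0).2, (topE_mul_cyc_two 1).2, add_zero]
    exact ⟨rfl, rfl⟩
  have h1 := embed_jw_mul (fun i hi hi' => (ht i hi hi').1) 2 le_rfl
  have h2 := mul_embed_jw (fun i hi hi' => (ht i hi hi').2) 2 le_rfl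
  rw [embedHom_apply, embed_self] at h1 h2
  have hP := hJ.split (dih_mem 2) (dih_mul_dih 1) h1 h2
  have htr : (jw 2 - dih 2).trace = 1 := by
    rw [Matrix.trace_sub, trace_dih, trace_jw fun k hk => hS k (by omega)]
    norm_num
  refine ⟨⟨hP, fun i x hx => ?_, fun i j hij x hx => ?_⟩, htr⟩
  · obtain ⟨a, ha, -⟩ := dih_mul_of_mem hζ hx
    fin_cases i
    · exact ⟨a, by change dih 2 * x * dih 2 = a • dih 2; rw [ha, smul_mul_assoc, dih_mul_dih]⟩
    · exact exists_smul_of_trace_eq_one (hP.idem 1) htr x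
  · obtain ⟨a, ha, ha'⟩ := dih_mul_of_mem hζ hx
    have h3 := hP.mul 0 1
    have h4 := hP.mul 1 0
    fin_cases i <;> fin_cases j
    · exact absurd rfl hij
    · change dih 2 * x * (jw 2 - dih 2) = 0
      rw [ha, smul_mul_assoc]
      exact smul_eq_zero_of_right a h3
    · change (jw 2 - dih 2) * x * dih 2 = 0
      rw [mul_assoc, ha', mul_smul_comm]
      exact smul_eq_zero_of_right a h4
    · exact absurd rfl hij

lemma PreFam.fam_dih (hζ : ∀ j, 1 ≤ j → j ≤ k + 1 → ζ ^ (2 * j) ≠ 1)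
    (h : PreFam (Subgroup.closure {diagElt ζ, quatK}) (k + 1) fun _ : Fin 1 => dih (k + 1)) :
    Fam (Subgroup.closure {diagElt ζ, quatK}) (k + 1) fun _ : Fin 1 => dih (k + 1) := by
  refine h.toFam fun x hx => ?_
  obtain ⟨a, ha, -⟩ := dih_mul_of_mem hζ hx
  exact ⟨a, by rw [ha, smul_mul_assoc, dih_mul_dih]⟩

lemma isParent_dih (hζ : ∀ j, 1 ≤ j → j ≤ k + 1 → ζ ^ (2 * j) ≠ 1) :
    IsParent (Subgroup.closure {diagElt ζ, quatK}) (k + 1) (dih (k + 1)) (dih (k + 2)) :=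
  ⟨dih_mem _, dih_mul_dih k, fun x hx => by
    obtain ⟨a, ha, -⟩ := dih_mul_of_mem hζ hx
    exact ⟨a, by rw [ha, smul_mul_assoc, dih_mul_dih]⟩, (ext1_dih_mul k).1, (ext1_dih_mul k).2⟩

lemma fam_dih (n : ℕ) (hζ : ∀ j, 1 ≤ j → j ≤ n + 3 → ζ ^ (2 * j) ≠ 1) :
    Fam (Subgroup.closure {diagElt ζ, quatK}) (n + 3) fun _ : Fin 1 => dih (n + 3) := by
  induction n with
  | zero =>
    obtain ⟨h, htr⟩ := fam_dih_two (ζ := ζ) fun j h1 h2 => hζ j h1 (by omega)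
    have hp1 := isParent_dih (ζ := ζ) (k := 0) fun j h1 h2 => hζ j h1 (by omega)
    have hp : ∀ i, IsParent (Subgroup.closure {diagElt ζ, quatK}) 1 (dih 1)
        (![dih 2, jw 2 - dih 2] i) := fun i =>
      ⟨hp1.mem, hp1.idem, hp1.min, by rw [dih_one, map_one, one_mul],
        by rw [dih_one, map_one, mul_one]⟩
    have h2 := h.preFam_child hp
    refine PreFam.fam_dih hζ ?_
    -- The one-dimensional module is a leaf: its child has trace 2 · 1 - 2 = 0.
    have h3 := h2.drop (eq_zero_of_trace (h2.idem 1) ?_)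
    · simpa [child_dih] using h3
    · refine (trace_child (h.idem 1) _ fun h0 => ?_).trans ?_
      · rw [show (![dih 2, jw 2 - dih 2] : Fin 2 → TensorEnd 2) 1 = jw 2 - dih 2 from rfl] at h0
        rw [h0, Matrix.trace_zero] at htr
        exact zero_ne_one htr
      · change 2 * (jw 2 - dih 2).trace - _ = 0
        rw [htr, trace_dih]
        norm_num
  | succ n ih =>
    have h := ih fun j h1 h2 => hζ j h1 (by omega)
    have h2 := h.preFam_child fun _ => isParent_dih (fun j h1 h2 => hζ j h1 (by omega))
    simp only [child_dih] at h2
    exact h2.fam_dih hζ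

end

end McKay

namespace McKay

/-! ### Passing from one level to the next -/

variable {G : Subgroup SU2} {k l : ℕ}

section
variable {ι : Type} [Fintype ι] [DecidableEq ι] {c : ι → TensorEnd (k + 1)} {p : ι → TensorEnd k}
  {ν ν' : Irrep G}

/-- The edge puts a copy of ν' into c i ⊗ 1. Being new it is killed by e, so it lies in the image of
the child. Multiplying its left inverse by the child puts the projection under the child on both
sides. -/
lemma Fam.exists_le_child (h : Fam G (k + 1) c) (hν : IsNew ν (k + 1)) (hν' : IsNew ν' (k + 2))
    (hE : Edge ν ν')
    (hp : ∀ i, IsParent G k (p i) (c i)) :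
    ∃ i y, (c i).trace = ν.dim ∧ y ∈ centralizerAlg G (k + 2) ∧ y * y = y ∧
      child (c i) (p i) * y = y ∧ y * child (c i) (p i) = y ∧
      (∀ x ∈ centralizerAlg G (k + 2), ∃ a : ℂ, y * x * y = a • y) ∧ y.trace = ν'.dim := by
  obtain ⟨f, hf⟩ := hν.1
  obtain ⟨L, hS⟩ := (embeds_of_injective hf).exists_split
  obtain ⟨i, hi⟩ := h.exists_eq hν hS
  obtain ⟨F', hF', hb⟩ := hE.exists_embeds hS
  rw [hi] at hb
  have he : topE k * F' = 0 := hν'.old_mul hF'.comm (by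
    simpa using mul_topE_mul_mem (one_mem (centralizerAlg G (k + 2))) (one_mem _))
  have hq : child (c i) (p i) * F' = F' := by
    rw [child, Matrix.sub_mul, Matrix.smul_mul, Matrix.mul_assoc, hb, Matrix.mul_assoc, he,
      Matrix.mul_zero, smul_zero, sub_zero]
  obtain ⟨L', hL'⟩ := hF'.exists_split
  have hS' : Split ν' (k + 2) F' (L' * child (c i) (p i)) :=
    ⟨hF', by rw [Matrix.mul_assoc, hq, hL'.inv], fun g => by
      rw [Matrix.mul_assoc, ← mem_centralizerAlg.mp (child_mem (h.mem i) _) g.1 g.2,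
        ← Matrix.mul_assoc, hL'.comm', Matrix.mul_assoc]⟩
  refine ⟨i, F' * (L' * child (c i) (p i)), by rw [← hi, hS.trace], hS'.mul_mem, hS'.idem, ?_, ?_,
    fun x hx => hS'.min hx, hS'.trace⟩
  · rw [← Matrix.mul_assoc, hq]
  · rw [Matrix.mul_assoc, Matrix.mul_assoc, (hp i).child_idem (h.mem i) (h.idem i)]

/-- The dimensions along an edge, and irreducibility if they are as large as possible. -/
lemma Fam.dim_edge (h : Fam G (k + 1) c) (hp : ∀ i, IsParent G k (p i) (c i))
    (hν : IsNew ν (k + 1)) (hν' : IsNew ν' (k + 2)) (hE : Edge ν ν') :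
    ∃ i, (c i).trace = ν.dim ∧ ν.dim ≤ 2 * ν'.dim ∧ ∃ n : ℕ, (child (c i) (p i)).trace = n ∧
      ν'.dim ≤ n ∧ (n = ν'.dim → ∀ x ∈ centralizerAlg G (k + 2), ∃ a : ℂ,
        child (c i) (p i) * x * child (c i) (p i) = a • child (c i) (p i)) := by
  obtain ⟨i, y, htr, hy, hyy, hqy, hyq, hmin, hytr⟩ := h.exists_le_child hν hν' hE hp
  have hqq := (hp i).child_idem (h.mem i) (h.idem i)
  have hy0 : y ≠ 0 := by
    intro h0
    rw [h0, Matrix.trace_zero] at hytr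
    exact ν'.dim_ne_zero (by exact_mod_cast hytr.symm)
  refine ⟨i, htr, ?_, ?_⟩
  -- The trace 2 dim ν' - dim ν of the child of y is a natural number.
  · have hP : IsParent G (k + 1) (c i) y := h.isParent i
      (by rw [← hqy, ← mul_assoc, ext1_mul_child (h.idem i)])
      (by rw [← hyq, mul_assoc, child_mul_ext1 (h.idem i)])
    obtain ⟨m, hm⟩ := exists_trace_eq_nat (hP.child_idem hy hyy)
    rw [trace_child hyy _ hy0, htr, hytr] at hm
    have : 2 * ν'.dim = m + ν.dim := by exact_mod_cast sub_eq_iff_eq_add.mp hm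
    omega
  · obtain ⟨n, hn⟩ := exists_trace_eq_nat hqq
    have hd : (child (c i) (p i) - y) * (child (c i) (p i) - y) = child (c i) (p i) - y := by
      rw [sub_mul, mul_sub, mul_sub, hqq, hqy, hyq, hyy]
      abel
    obtain ⟨m, hm⟩ := exists_trace_eq_nat hd
    rw [Matrix.trace_sub, hn, hytr] at hm
    have h1 : n = m + ν'.dim := by exact_mod_cast sub_eq_iff_eq_add.mp hm
    refine ⟨n, hn, by omega, fun h2 => ?_⟩
    have h3 : child (c i) (p i) - y = 0 := eq_zero_of_trace hd (by
      rw [Matrix.trace_sub, hn, hytr, h2, sub_self])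
    rw [sub_eq_zero.mp h3]
    exact hmin

lemma Fam.isParent_child (h : Fam G (k + 1) c) (p : ι → TensorEnd k) (i : ι) :
    IsParent G (k + 1) (c i) (child (c i) (p i)) :=
  h.isParent i (ext1_mul_child (h.idem i) _) (child_mul_ext1 (h.idem i) _)

/-- The children of distinct nodes are distinct if they have no children themselves. -/
lemma Fam.child_mul_mul_child (h : Fam G (k + 1) c) (p : ι → TensorEnd k)
    {i j : ι} (hij : i ≠ j) (hi : child (child (c i) (p i)) (c i) = 0)
    (hj : child (child (c j) (p j)) (c j) = 0) {x : TensorEnd (k + 2)}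
    (hx : x ∈ centralizerAlg G (k + 2)) :
    child (c i) (p i) * x * child (c j) (p j) = 0 := by
  have hl := ext1_mul_child (h.idem i) (p i)
  have hr := child_mul_ext1 (h.idem j) (p j)
  have hqm := mul_mem (mul_mem (child_mem (h.mem i) (p i)) hx) (child_mem (h.mem j) (p j))
  -- A vanishing child means that q ⊗ 1 is a multiple of q e q. Then q x q' ⊗ 1 contains e (z ⊗ 1) e
  -- with z = q x q', which vanishes since the partial trace of z lies in c i Z c j = 0.
  rw [child, sub_eq_zero] at hi hj
  generalize child (c i) (p i) = q at *
  generalize child (c j) (p j) = q' at *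
  set z := q * x * q' with hz
  have hzl : ext1 (k + 1) (c i) * z = z := by rw [hz, ← mul_assoc, ← mul_assoc, hl]
  have hzr : z * ext1 (k + 1) (c j) = z := by rw [hz, mul_assoc, hr]
  have hpz : ptr z = 0 := by
    rw [← hzl, ptr_ext1_mul, ← hzr, ptr_mul_ext1, ← mul_assoc]
    exact h.orth i j hij _ (ptr_mem hqm)
  apply ext1_injective (k + 2)
  rw [map_zero, hz, map_mul, map_mul]
  have he : topE (k + 1) * ext1 (k + 2) z * topE (k + 1) = 0 := by
    rw [topE_mul_ext1_mul_topE, hpz, map_zero, map_zero, zero_mul]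
  rw [hi, hj]
  simp only [smul_mul_assoc, mul_smul_comm, smul_smul]
  have h2 : ext1 (k + 2) q * topE (k + 1) * ext1 (k + 2) q * ext1 (k + 2) x *
      (ext1 (k + 2) q' * topE (k + 1) * ext1 (k + 2) q') = ext1 (k + 2) q *
      (topE (k + 1) * ext1 (k + 2) z * topE (k + 1)) * ext1 (k + 2) q' := by
    rw [hz, map_mul, map_mul]
    simp only [mul_assoc]
  rw [h2, he, mul_zero, zero_mul, smul_zero]

end

section
variable {ι : Type} [Fintype ι] [DecidableEq ι] {c : ι → TensorEnd k}

lemma PreFam.fam_of_eq_zero (h : PreFam G k c) (i₀ : ι) (h0 : ∀ i, i ≠ i₀ → c i = 0)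
    (hmin : ∀ x ∈ centralizerAlg G k, ∃ a : ℂ, c i₀ * x * c i₀ = a • c i₀) : Fam G k c := by
  refine ⟨h, fun i => ?_, fun i j hij x _ => ?_⟩
  · by_cases hi : i = i₀
    · rw [hi]; exact hmin
    · exact fun x _ => ⟨0, by rw [h0 i hi, mul_zero, smul_zero]⟩
  · by_cases hi : i = i₀
    · rw [h0 j fun hj => hij (hi.trans hj.symm), mul_zero]
    · rw [h0 i hi, zero_mul, zero_mul]

lemma PreFam.one_mem_oldIdeal (h : PreFam G k c) (h0 : ∀ i, c i = 0) : 1 ∈ oldIdeal G k := by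
  have h1 := h.one
  rwa [Finset.sum_eq_zero fun i _ => h0 i, sub_zero] at h1

end

lemma child_zero (p : TensorEnd k) : child (0 : TensorEnd (k + 1)) p = 0 := by simp [child]

/-- The bound on the dimensions t i of the two summands says that the trace 2 t i - (l + 1) of the
child is not negative. -/
lemma SplitsAt.exists_fam (h : SplitsAt G l) : ∃ b : Fin 2 → TensorEnd (l + 1), Fam G (l + 1) b ∧
    (∀ i, IsParent G l (jw l) (b i)) ∧ (∀ i, b i ≠ 0) ∧ ∃ t : Fin 2 → ℕ,
      (∀ i, (b i).trace = t i) ∧ (∀ i, l + 1 ≤ 2 * t i) ∧ t 0 + t 1 = l + 2 := by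
  obtain ⟨b, hb, hs, h0⟩ := h.fam
  have hJ := jw_isParent h.symIrred
  have hm : ∀ i, jw (l + 1) * b i = b i ∧ b i * jw (l + 1) = b i := by
    intro i
    rw [← hs, add_mul, mul_add, hb.mul, hb.mul, hb.mul, hb.mul]
    fin_cases i <;> simp
  have hp : ∀ i, IsParent G l (jw l) (b i) := fun i => (jw_fam h.symIrred).isParent 0
    (by rw [← (hm i).1, ← mul_assoc, hJ.left]) (by rw [← (hm i).2, mul_assoc, hJ.right])
  choose t ht using fun i => exists_trace_eq_nat (hb.idem i)
  refine ⟨b, hb, hp, h0, t, ht, fun i => ?_, ?_⟩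
  · obtain ⟨m, hm⟩ := exists_trace_eq_nat ((hp i).child_idem (hb.mem i) (hb.idem i))
    rw [trace_child (hb.idem i) _ (h0 i), ht, trace_jw fun k hk => h.symIrred k hk.le] at hm
    have : 2 * t i = m + (l + 1) := by exact_mod_cast sub_eq_iff_eq_add.mp hm
    omega
  · have h1 := congrArg Matrix.trace hs
    rw [Matrix.trace_add, ht, ht, trace_jw fun k hk => h.symIrred k (by omega)] at h1
    have : t 0 + t 1 = l + 1 + 1 := by exact_mod_cast h1
    exact this

/-! ### The path away from the branch node -/

/-- What is needed about a path `ν_0, ν_1, …` to describe the centralizer algebras. The index `j`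
is in the range that is considered if `R j` holds. -/
structure BranchData (G : Subgroup SU2) (l : ℕ) (R : ℕ → Prop) (ν : ℕ → Irrep G) : Prop where
  symIrred : ∀ k ≤ l, SymIrred G k
  zero : R 0
  down : ∀ i j, i ≤ j → R j → R i
  new : ∀ j, R j → IsNew (ν j) (l + j)
  edge : ∀ j, R (j + 1) → Edge (ν j) (ν (j + 1))
  fam : ∀ j, R j → ∃ n ≤ 2, ∃ c : Fin n → TensorEnd (l + j), Fam G (l + j) c
  dim : ∀ j, R (j + 2) → (ν j).dim + (ν (j + 2)).dim = 2 * (ν (j + 1)).dim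

/-- The path has length `m`, and there are no new modules at its end. -/
structure EndsAt (G : Subgroup SU2) (l m : ℕ) (ν : ℕ → Irrep G) : Prop where
  dim : 2 * (ν m).dim = (ν (m - 1)).dim
  one_mem : 1 ∈ oldIdeal G (l + m + 1)

section
variable {ν : ℕ → Irrep G}

lemma dim_zero (hS : ∀ k ≤ l, SymIrred G k) (hν : IsNew (ν 0) l) : (ν 0).dim = l + 1 := by
  obtain ⟨i, -, -, h⟩ := (jw_fam hS).exists_projection hν
  rw [trace_jw fun k hk => hS k hk.le] at h
  exact_mod_cast h.symm

/-- The conditions t 0 + t 1 = 4 and 2 t i ≥ 3 force dimensions 2 and 2. The children have dimension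
2 · 2 - 3 = 1 and their children 2 · 1 - 2 = 0. The two lines are inequivalent by
`Fam.child_mul_mul_child`. -/
lemma SplitsAt.tetrahedral (h : SplitsAt G 2) (hν : ∀ j ≤ 2, IsNew (ν j) (2 + j))
    (hE : ∀ j, j + 1 ≤ 2 → Edge (ν j) (ν (j + 1))) :
    BranchData G 2 (· ≤ 2) ν ∧ EndsAt G 2 2 ν := by
  obtain ⟨b, hb, hp, h0, t, ht, ht3, hts⟩ := h.exists_fam
  have htr : ∀ i, (b i).trace = 2 := by
    intro i
    have h3 := ht3 0
    have h4 := ht3 1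
    rw [ht, show t i = 2 by fin_cases i <;> simp <;> omega]
    norm_num
  have hJ : (jw 2).trace = 3 := by
    rw [trace_jw fun k hk => h.symIrred k hk.le]; norm_num
  have hq1 : ∀ i, (child (b i) (jw 2)).trace = 1 := fun i => by
    rw [trace_child (hb.idem i) _ (h0 i), htr, hJ]; norm_num
  have hP := hb.preFam_child hp
  have hq0 : ∀ i, child (b i) (jw 2) ≠ 0 := fun i hi => by
    have := hq1 i
    rw [hi, Matrix.trace_zero] at this
    exact zero_ne_one this
  have hp' := fun i => hb.isParent_child (fun _ => jw 2) i
  have hqq : ∀ i, child (child (b i) (jw 2)) (b i) = 0 := fun i =>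
    eq_zero_of_trace ((hp' i).child_idem (hP.mem i) (hP.idem i)) (by
      rw [trace_child (hP.idem i) _ (hq0 i), hq1, htr]; norm_num)
  have hF : Fam G 4 fun i => child (b i) (jw 2) :=
    ⟨hP, fun i x _ => exists_smul_of_trace_eq_one (hP.idem i) (hq1 i) x,
      fun i j hij x hx => hb.child_mul_mul_child (fun _ => jw 2) hij (hqq i) (hqq j) hx⟩
  have d0 := dim_zero h.symIrred (hν 0 (by norm_num))
  have d1 : (ν 1).dim = 2 := by
    obtain ⟨i, -, -, hi⟩ := hb.exists_projection (hν 1 (by norm_num))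
    rw [htr] at hi
    exact_mod_cast hi.symm
  have d2 : (ν 2).dim = 1 := by
    obtain ⟨i, -, -, hi⟩ := hF.exists_projection (hν 2 (by norm_num))
    rw [hq1] at hi
    exact_mod_cast hi.symm
  refine ⟨⟨h.symIrred, by norm_num, fun i j hij hj => hij.trans hj, hν, hE, fun j hj => ?_,
    fun j hj => ?_⟩, by rw [d2, show 2 - 1 = 1 from rfl, d1],
    (hF.preFam_child hp').one_mem_oldIdeal hqq⟩
  · interval_cases j
    · exact ⟨1, by norm_num, _, jw_fam h.symIrred⟩
    · exact ⟨2, le_rfl, _, hb⟩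
    · exact ⟨2, le_rfl, _, hF⟩
  · obtain rfl : j = 0 := by omega
    rw [d0, d1, d2]

/-- The octahedral and icosahedral cases together, with r = 2, 3. From t 0 + t 1 = 2 r + 1 and t i ≥
r the summands have dimensions r and r + 1, and their children 0 and 2. The path continues, so it
takes the larger summand, and 2 dim ν_2 ≥ r + 1 ≥ 3 makes the child of dimension 2 irreducible. -/
lemma SplitsAt.exists_fam_succ {r : ℕ} (hr : l + 1 = 2 * r) (hr2 : 2 ≤ r) (h : SplitsAt G l)
    (hν : ∀ j ≤ 2, IsNew (ν j) (l + j)) (hE : ∀ j, j + 1 ≤ 2 → Edge (ν j) (ν (j + 1))) :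
    (ν 0).dim = 2 * r ∧ (ν 1).dim = r + 1 ∧ (ν 2).dim = 2 ∧
      ∃ (b : Fin 2 → TensorEnd (l + 1)) (q : Fin 2 → TensorEnd (l + 2)) (i₀ : Fin 2),
        Fam G (l + 1) b ∧ Fam G (l + 2) q ∧ (∀ i, IsParent G (l + 1) (b i) (q i)) ∧
        (b i₀).trace = r + 1 ∧ (q i₀).trace = 2 ∧ ∀ i, i ≠ i₀ → q i = 0 := by
  obtain ⟨b, hb, hp, h0, t, ht, ht3, hts⟩ := h.exists_fam
  have d0 := dim_zero h.symIrred (hν 0 (by norm_num))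
  have hJ : (jw l).trace = ((2 * r : ℕ) : ℂ) := by
    rw [trace_jw fun k hk => h.symIrred k hk.le, ← hr]; push_cast; rfl
  have hq : ∀ i, (child (b i) (jw l)).trace = ((2 * t i - 2 * r : ℕ) : ℂ) := fun i => by
    have := ht3 i
    rw [trace_child (hb.idem i) _ (h0 i), ht, hJ, Nat.cast_sub (by omega)]
    push_cast; rfl
  have hP := hb.preFam_child hp
  obtain ⟨i₀, hi₀, hd, n, hn, hdn, hmin⟩ := hb.dim_edge hp (hν 1 (by norm_num)) (hν 2 le_rfl)
    (hE 1 le_rfl)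
  rw [ht] at hi₀
  rw [hq] at hn
  have hi₀' : t i₀ = (ν 1).dim := by exact_mod_cast hi₀
  have hn' : 2 * t i₀ - 2 * r = n := by exact_mod_cast hn
  have hpos := Nat.pos_of_ne_zero (ν 2).dim_ne_zero
  have key : t i₀ = r + 1 ∧ ∀ i, i ≠ i₀ → t i = r := by
    have a0 := ht3 0
    have a1 := ht3 1
    have h1 : ∀ i j : Fin 2, i ≠ j → t i + t j = l + 2 := by
      intro i j hij
      fin_cases i <;> fin_cases j <;> first | exact absurd rfl hij | simp <;> omega
    obtain ⟨j, hj⟩ : ∃ j, j ≠ i₀ := exists_ne i₀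
    have h2 := h1 i₀ j hj.symm
    have h3 := ht3 j
    refine ⟨by omega, fun i hi => ?_⟩
    have h2 := h1 i₀ i hi.symm
    have h3 := ht3 i
    omega
  have d2 : (ν 2).dim = 2 := by omega
  refine ⟨by omega, by omega, d2, b, _, i₀, hb, hP.fam_of_eq_zero i₀ (fun i hi => ?_)
    (hmin (by omega)), fun i => hb.isParent_child (fun _ => jw l) i, ?_, ?_, fun i hi => ?_⟩
  · exact eq_zero_of_trace (hP.idem i) (by rw [hq, key.2 i hi, Nat.sub_self, Nat.cast_zero])
  · rw [ht, key.1]; push_cast; rfl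
  · rw [hq, key.1, show 2 * (r + 1) - 2 * r = 2 by omega]; rfl
  · exact eq_zero_of_trace (hP.idem i) (by rw [hq, key.2 i hi, Nat.sub_self, Nat.cast_zero])

/-- The dimensions along the path are 6, 4, 2, and the next one would be 2 · 2 - 4 = 0. -/
lemma SplitsAt.icosahedral (h : SplitsAt G 5) (hν : ∀ j ≤ 2, IsNew (ν j) (5 + j))
    (hE : ∀ j, j + 1 ≤ 2 → Edge (ν j) (ν (j + 1))) :
    BranchData G 5 (· ≤ 2) ν ∧ EndsAt G 5 2 ν := by
  obtain ⟨d0, d1, d2, b, q, i₀, hb, hq, hp, htb, htq, hz⟩ :=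
    h.exists_fam_succ (r := 3) rfl (by norm_num) hν hE
  have hq0 : q i₀ ≠ 0 := fun h0 => by
    rw [h0, Matrix.trace_zero] at htq
    norm_num at htq
  refine ⟨⟨h.symIrred, by norm_num, fun i j hij hj => hij.trans hj, hν, hE, fun j hj => ?_,
    fun j hj => ?_⟩, by rw [d2, show 2 - 1 = 1 from rfl, d1],
    (hq.preFam_child hp).one_mem_oldIdeal fun i => ?_⟩
  · interval_cases j
    · exact ⟨1, by norm_num, _, jw_fam h.symIrred⟩
    · exact ⟨2, le_rfl, _, hb⟩
    · exact ⟨2, le_rfl, _, hq⟩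
  · obtain rfl : j = 0 := by omega
    rw [d0, d1, d2]
  · by_cases hi : i = i₀
    · subst hi
      refine eq_zero_of_trace ((hp i).child_idem (hq.mem i) (hq.idem i)) ?_
      rw [trace_child (hq.idem i) _ hq0, htb, htq]
      norm_num
    · rw [hz i hi, child_zero]

/-- The dimensions along the path are 4, 3, 2, 1, and the next one would be 2 · 1 - 2 = 0. -/
lemma SplitsAt.octahedral (h : SplitsAt G 3) (hν : ∀ j ≤ 3, IsNew (ν j) (3 + j))
    (hE : ∀ j, j + 1 ≤ 3 → Edge (ν j) (ν (j + 1))) :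
    BranchData G 3 (· ≤ 3) ν ∧ EndsAt G 3 3 ν := by
  obtain ⟨d0, d1, d2, b, q, i₀, hb, hq, hp, htb, htq, hz⟩ := h.exists_fam_succ (r := 2) rfl le_rfl
    (fun j hj => hν j (by omega)) (fun j hj => hE j (by omega))
  have hq0 : q i₀ ≠ 0 := fun h0 => by
    rw [h0, Matrix.trace_zero] at htq
    norm_num at htq
  have hP := hq.preFam_child hp
  have hs0 : ∀ i, i ≠ i₀ → child (q i) (b i) = 0 := fun i hi => by rw [hz i hi, child_zero]
  have hs1 : (child (q i₀) (b i₀)).trace = 1 := by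
    rw [trace_child (hq.idem i₀) _ hq0, htb, htq]
    norm_num
  have hF : Fam G 6 fun i => child (q i) (b i) := hP.fam_of_eq_zero i₀ hs0 fun x _ =>
    exists_smul_of_trace_eq_one (hP.idem i₀) hs1 x
  have hp' := fun i => hq.isParent_child b i
  have hs : child (q i₀) (b i₀) ≠ 0 := fun h0 => by
    rw [h0, Matrix.trace_zero] at hs1
    exact zero_ne_one hs1
  have d3 : (ν 3).dim = 1 := by
    obtain ⟨i, -, -, hi⟩ := hF.exists_projection (hν 3 (by norm_num))
    by_cases h1 : i = i₀
    · rw [h1, hs1] at hi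
      exact_mod_cast hi.symm
    · rw [hs0 i h1, Matrix.trace_zero] at hi
      exact absurd (by exact_mod_cast hi.symm) (ν 3).dim_ne_zero
  refine ⟨⟨h.symIrred, by norm_num, fun i j hij hj => hij.trans hj, hν, hE, fun j hj => ?_,
    fun j hj => ?_⟩, by rw [d3, show 3 - 1 = 2 from rfl, d2],
    (hF.preFam_child hp').one_mem_oldIdeal fun i => ?_⟩
  · interval_cases j
    · exact ⟨1, by norm_num, _, jw_fam h.symIrred⟩
    · exact ⟨2, le_rfl, _, hb⟩
    · exact ⟨2, le_rfl, _, hq⟩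
    · exact ⟨2, le_rfl, _, hF⟩
  · have hj' : j ≤ 1 := by omega
    interval_cases j
    · rw [d0, d1, d2]
    · rw [d1, d2, d3]
  · by_cases hi : i = i₀
    · subst hi
      refine eq_zero_of_trace ((hp' i).child_idem (hF.mem i) (hF.idem i)) ?_
      rw [trace_child (hF.idem i) _ hs, hs1, htq]
      norm_num
    · rw [hs0 i hi, child_zero]

end

end McKay

namespace McKay

/-! ### The generators and relations -/

variable {G : Subgroup SU2} {k l m M N : ℕ} {R : ℕ → Prop} {ν : ℕ → Irrep G}
  {b : (j : ℕ) → TensorEnd (l + j)}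

lemma oldIdeal_succ_le {A : Subalgebra ℂ (TensorEnd (k + 1))}
    (hA : ∀ x ∈ centralizerAlg G k, ext1 k x ∈ A) (he : 1 ≤ k → tl (k + 1) k ∈ A) :
    oldIdeal G (k + 1) ≤ Subalgebra.toSubmodule A := by
  cases k with
  | zero => rw [oldIdeal_one]; exact bot_le
  | succ k => exact oldIdeal_le_of_mem hA (he (by omega))

/-- Old endomorphisms and 1 lie in A, hence so does the sum of the c i. As there are at most two of
them, one gives the other, and `Fam.decomp` gives everything. -/
lemma Fam.centralizerAlg_le {n : ℕ} (hn : n ≤ 2) {c : Fin n → TensorEnd (k + 1)}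
    (h : Fam G (k + 1) c) {A : Subalgebra ℂ (TensorEnd (k + 1))}
    (hA : ∀ x ∈ centralizerAlg G k, ext1 k x ∈ A) (he : 1 ≤ k → tl (k + 1) k ∈ A) {i₀ : Fin n}
    (hi₀ : c i₀ ∈ A) : centralizerAlg G (k + 1) ≤ A := by
  have hold := oldIdeal_succ_le hA he
  have hc : ∀ i, c i ∈ A := by
    intro i
    by_cases hi : i = i₀
    · rwa [hi]
    · have h1 : Finset.univ = {i₀, i} := by
        refine (Finset.eq_of_subset_of_card_le (Finset.subset_univ _) ?_).symm
        rw [Finset.card_pair (Ne.symm hi), Finset.card_univ, Fintype.card_fin]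
        exact hn
      have h2 : 1 - ∑ i, c i ∈ A := hold h.one
      rw [h1, Finset.sum_pair (Ne.symm hi)] at h2
      have h3 := sub_mem (sub_mem (one_mem A) h2) hi₀
      rwa [sub_sub_cancel, add_sub_cancel_left] at h3
  intro x hx
  obtain ⟨a, -, ha⟩ := h.decomp hx
  have h1 : x - ∑ i, a i • c i ∈ A := hold ha
  have h2 : ∑ i, a i • c i ∈ A := sum_mem fun i _ => A.smul_mem (hc i) _
  simpa using add_mem h1 h2

lemma centralizerAlg_eq_temperleyLieb (hS : ∀ j ≤ k, SymIrred G j) :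
    centralizerAlg G k = temperleyLieb k := by
  refine le_antisymm ?_ (temperleyLieb_le G k)
  induction k with
  | zero =>
    intro x hx
    obtain ⟨a, ha⟩ := hS 0 le_rfl x hx
    rw [jw_zero, one_mul, mul_one] at ha
    rw [ha]
    exact Subalgebra.smul_mem _ (one_mem _) _
  | succ k ih =>
    exact (jw_fam hS).centralizerAlg_le (by norm_num)
      (fun x hx => ext1_mem_temperleyLieb (ih (fun j hj => hS j (by omega)) hx))
      (fun hk => tl_mem_temperleyLieb hk (Nat.lt_succ_self k)) (i₀ := 0)
      (jw_mem_temperleyLieb (k + 1))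

lemma ext1_mem_generatedAlg (hM : M ≤ m) (hk : l + M ≤ k) {x : TensorEnd k}
    (hx : x ∈ generatedAlg l k M b) : ext1 k x ∈ generatedAlg l (k + 1) m b := by
  have h1 : generatedAlg l k M b ≤ (generatedAlg l (k + 1) m b).comap (ext1 k) := by
    refine Algebra.adjoin_le ?_
    rintro _ (⟨i, h1, h2, rfl⟩ | ⟨j, h1, h2, rfl⟩)
    · refine Algebra.subset_adjoin (Or.inl ⟨i, h1, by omega, ?_⟩)
      exact tl_embed (Nat.le_succ k) h1 h2
    · exact Algebra.subset_adjoin (Or.inr ⟨j, h1, by omega, embed_trans (by omega) (Nat.le_succ k) _⟩)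
  exact h1 hx


lemma BranchData.existsUnique (hB : BranchData G l R ν) {j : ℕ} (hj : R j) :
    ∃! b, IsProjectionOnto (ν j) (l + j) b := by
  obtain ⟨n, -, c, hc⟩ := hB.fam j hj
  obtain ⟨i, h1, h2, -⟩ := hc.exists_projection (hB.new j hj)
  exact ⟨_, h1, h2⟩

lemma BranchData.exists_fam (hB : BranchData G l R ν)
    (hb : ∀ j, R j → IsProjectionOnto (ν j) (l + j) (b j))
    {j : ℕ} (hj : R j) : ∃ n ≤ 2, ∃ c : Fin n → TensorEnd (l + j),
    Fam G (l + j) c ∧ (∃ i, c i = b j) ∧ (b j).trace = (ν j).dim := by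
  obtain ⟨n, hn, c, hc⟩ := hB.fam j hj
  obtain ⟨i, -, h2, h3⟩ := hc.exists_projection (hB.new j hj)
  have h4 := h2 _ (hb j hj)
  exact ⟨n, hn, c, hc, ⟨i, h4.symm⟩, by rw [h4, h3]⟩

lemma BranchData.trace_eq (hB : BranchData G l R ν)
    (hb : ∀ j, R j → IsProjectionOnto (ν j) (l + j) (b j))
    {j : ℕ} (hj : R j) : (b j).trace = (ν j).dim := by
  obtain ⟨n, -, c, -, -, h⟩ := hB.exists_fam hb hj
  exact h

lemma BranchData.ne_zero (hB : BranchData G l R ν)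
    (hb : ∀ j, R j → IsProjectionOnto (ν j) (l + j) (b j))
    {j : ℕ} (hj : R j) : b j ≠ 0 := fun h0 => by
  have h := hB.trace_eq hb hj
  rw [h0, Matrix.trace_zero] at h
  exact (ν j).dim_ne_zero (by exact_mod_cast h.symm)

lemma BranchData.isParent (hB : BranchData G l R ν)
    (hb : ∀ j, R j → IsProjectionOnto (ν j) (l + j) (b j))
    {j : ℕ} (hj : R (j + 1)) : IsParent G (l + j) (b j) (b (j + 1)) := by
  have hj' := hB.down j (j + 1) (Nat.le_succ j) hj
  obtain ⟨n, -, c, hc, ⟨i, hi⟩, -⟩ := hB.exists_fam hb hj'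
  obtain ⟨n', -, c', hc', ⟨i', hi'⟩, -⟩ := hB.exists_fam hb hj
  obtain ⟨f, hf⟩ := (hB.new j hj').1
  obtain ⟨L, hS⟩ := (embeds_of_injective hf).exists_split
  obtain ⟨F', hF', h1⟩ := (hB.edge j hj).exists_embeds hS
  rw [(hB.existsUnique hj').unique hS.isProjectionOnto (hb j hj')] at h1
  obtain ⟨L', hS'⟩ := hF'.exists_split
  have h2 := (hB.existsUnique hj).unique hS'.isProjectionOnto (hb (j + 1) hj)
  have h3 : ext1 (l + j) (b j) * b (j + 1) = b (j + 1) := by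
    rw [← h2, ← Matrix.mul_assoc, h1]
  -- The edge yields only that b_{j+1} is fixed by b_j ⊗ 1 from the left; centrality modulo old
  -- endomorphisms gives the other side.
  obtain ⟨a, ha, ha'⟩ := hc'.central i' (ext1_mem (hb j hj').mem)
  rw [hi'] at ha ha'
  rw [← hi]
  refine hc.isParent i ?_ ?_
  · rw [hi, h3]
  · rw [hi]
    exact ha.trans (ha'.symm.trans h3)

/-- The projection b_{j+2} lies under b_{j+1} ⊗ 1 and is killed by e, hence lies under the child.
The traces agree by the dimension formula. -/
lemma BranchData.child_eq (hB : BranchData G l R ν)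
    (hb : ∀ j, R j → IsProjectionOnto (ν j) (l + j) (b j))
    {j : ℕ} (hj : R (j + 2)) :
    child (k := l + j) (b (j + 1)) (b j) = b (j + 2) := by
  have hj1 := hB.down (j + 1) (j + 2) (Nat.le_succ _) hj
  have hj0 := hB.down j (j + 1) (Nat.le_succ _) hj1
  have hP := hB.isParent hb hj1
  have hP' := hB.isParent hb hj
  have h1 := hb (j + 1) hj1
  have h2 := hb (j + 2) hj
  obtain ⟨n, -, c, hc, ⟨i, hi⟩, -⟩ := hB.exists_fam hb hj
  have hte : topE (l + j) * b (j + 2) = 0 := by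
    rw [← hi]
    exact hc.tl_mul i (by omega) (by omega)
  have het : (b (j + 2) : TensorEnd (l + j + 2)) * topE (l + j) = 0 := by
    rw [← hi]
    exact hc.mul_tl i (by omega) (by omega)
  have hl : ext1 (l + j + 1) (b (j + 1)) * b (j + 2) = b (j + 2) := hP'.left
  have hr : b (j + 2) * ext1 (l + j + 1) (b (j + 1)) = b (j + 2) := hP'.right
  have hql : child (k := l + j) (b (j + 1)) (b j) * b (j + 2) = b (j + 2) := by
    rw [child, sub_mul, smul_mul_assoc, mul_assoc, hl, mul_assoc, hte, mul_zero, smul_zero,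
      sub_zero]
  have hqr : b (j + 2) * child (k := l + j) (b (j + 1)) (b j) = b (j + 2) := by
    rw [child, mul_sub, mul_smul_comm, ← mul_assoc, ← mul_assoc, hr, het, zero_mul, smul_zero,
      sub_zero]
  have hqq := hP.child_idem h1.mem h1.idem
  refine sub_eq_zero.mp (eq_zero_of_trace ?_ ?_)
  · rw [sub_mul, mul_sub, mul_sub, hqq, hql, hqr]
    exact (congrArg _ (sub_eq_zero.mpr h2.idem.symm)).trans (sub_zero _)
  · have hd : ((ν j).dim : ℂ) + (ν (j + 2)).dim = 2 * (ν (j + 1)).dim := by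
      exact_mod_cast hB.dim j hj
    have ht := trace_child (k := l + j) h1.idem (b j) (hB.ne_zero hb hj1)
    rw [hB.trace_eq hb hj1, hB.trace_eq hb hj0] at ht
    refine (Matrix.trace_sub _ _).trans ?_
    rw [ht]
    refine (congrArg _ (hB.trace_eq hb hj)).trans ?_
    linear_combination -hd

lemma BranchData.relBE (hB : BranchData G l R ν)
    (hb : ∀ j, R j → IsProjectionOnto (ν j) (l + j) (b j))
    (hM : R M) (hN : l + M ≤ N) : RelBE l N M (fun j => (ν j).dim) b := by
  have hR : ∀ {j}, j ≤ M → R j := fun h => hB.down _ _ h hM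
  have hstep : ∀ j, j + 1 ≤ M →
      embed (l + j) N (b j) * embed (l + (j + 1)) N (b (j + 1)) = embed (l + (j + 1)) N (b (j + 1)) ∧
      embed (l + (j + 1)) N (b (j + 1)) * embed (l + j) N (b j) =
        embed (l + (j + 1)) N (b (j + 1)) := by
    intro j hj
    have hP := hB.isParent hb (hR hj)
    have h1 : l + j + 1 ≤ N := by omega
    have h2 := congrArg (embedHom h1) hP.left
    have h3 := congrArg (embedHom h1) hP.right
    rw [map_mul, embedHom_trans] at h2 h3
    exact ⟨h2, h3⟩
  constructor
  · intro i j hij hj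
    induction j, hij using Nat.le_induction with
    | base =>
      rw [← embed_mul (by omega), (hb i (hR hj)).idem]
      exact ⟨rfl, rfl⟩
    | succ j hij ih =>
      obtain ⟨h1, h2⟩ := hstep j hj
      obtain ⟨h3, h4⟩ := ih (by omega)
      constructor
      · rw [← h1, ← mul_assoc, h3]
      · rw [← h2, mul_assoc, h4]
  · intro j hj1 hj
    obtain ⟨j, rfl⟩ := Nat.exists_eq_add_of_le' hj1
    have h1 := hB.child_eq hb (hR hj)
    have h2 : l + j + 2 ≤ N := by omega
    rw [child, hB.trace_eq hb (hR (by omega : j ≤ M)),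
      hB.trace_eq hb (hR (by omega : j + 1 ≤ M))] at h1
    have h3 := congrArg (embedHom h2) h1
    rw [map_sub, map_smul, map_mul, map_mul, ← tl_eq_embed, embedHom_trans] at h3
    exact h3.symm
  · intro i j hj hi hij
    obtain ⟨n, -, c, hc, ⟨i', hi'⟩, -⟩ := hB.exists_fam hb (hR hj)
    have h1 : l + j ≤ N := by omega
    rw [← tl_embed h1 hi hij, ← hi']
    change embedHom h1 _ * embedHom h1 _ = 0 ∧ embedHom h1 _ * embedHom h1 _ = 0
    rw [← map_mul, ← map_mul, hc.tl_mul i' hi hij, hc.mul_tl i' hi hij, map_zero]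
    exact ⟨rfl, rfl⟩
  · intro i j _ h1 h2
    exact tl_comm_embed h1 h2 _
  · intro j hj1 hj hN'
    obtain ⟨j, rfl⟩ := Nat.exists_eq_add_of_le' hj1
    have h2 : l + j + 2 ≤ N := by omega
    have h1 := (hB.isParent hb (hR hj)).topE_mul_mul (hb (j + 1) (hR hj)).mem
    rw [hB.trace_eq hb (hR (by omega : j ≤ M)), hB.trace_eq hb (hR hj)] at h1
    have h3 := congrArg (embedHom h2) h1
    rw [map_smul, map_mul, map_mul, map_mul, ← tl_eq_embed, embedHom_trans, embedHom_trans,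
      embedHom_trans] at h3
    exact h3

lemma generatedAlg_le (hb : ∀ j, R j → IsProjectionOnto (ν j) (l + j) (b j))
    (hM : ∀ j ≤ M, R j) (hk : l + M ≤ k) :
    generatedAlg l k M b ≤ centralizerAlg G k := by
  refine Algebra.adjoin_le ?_
  rintro _ (⟨i, h1, h2, rfl⟩ | ⟨j, h1, h2, rfl⟩)
  · exact tl_mem G h1 h2
  · exact embedHom_mem (by omega) (hb j (hM j h2)).mem

lemma BranchData.centralizerAlg_eq (hB : BranchData G l R ν)
    (hb : ∀ j, R j → IsProjectionOnto (ν j) (l + j) (b j))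
    (hM : R M) :
    centralizerAlg G (l + M) = generatedAlg l (l + M) M b := by
  refine le_antisymm ?_ (generatedAlg_le hb (fun j hj => hB.down j M hj hM) le_rfl)
  induction M with
  | zero =>
    refine (centralizerAlg_eq_temperleyLieb hB.symIrred).le.trans ?_
    exact Algebra.adjoin_mono Set.subset_union_left
  | succ M ih =>
    obtain ⟨n, hn, c, hc, ⟨i, hi⟩, -⟩ := hB.exists_fam hb hM
    refine Fam.centralizerAlg_le (k := l + M) hn hc (fun x hx => ext1_mem_generatedAlg (Nat.le_succ M)
      le_rfl (ih (hB.down _ _ (Nat.le_succ M) hM) hx)) (fun h => ?_) (i₀ := i) ?_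
    · exact Algebra.subset_adjoin (Or.inl ⟨l + M, h, by omega, rfl⟩)
    · rw [hi]
      exact Algebra.subset_adjoin (Or.inr ⟨M + 1, by omega, le_rfl, (embed_self _ _).symm⟩)

/-- Once 1 is old it stays old at all later levels, so each further centralizer algebra is its own
old ideal and comes from the preceding one and the last e. -/
lemma BranchData.centralizerAlg_eq_of_endsAt (hB : BranchData G l R ν)
    (hb : ∀ j, R j → IsProjectionOnto (ν j) (l + j) (b j))
    (hM : R m) (hm : EndsAt G l m ν) (hk : l + m ≤ k) :
    centralizerAlg G k = generatedAlg l k m b := by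
  refine le_antisymm ?_ (generatedAlg_le hb (fun j hj => hB.down j m hj hM) hk)
  have hone : ∀ k, l + m ≤ k → 1 ∈ oldIdeal G (k + 1) := by
    intro k hk
    induction k, hk using Nat.le_induction with
    | base => exact hm.one_mem
    | succ k _ ih => simpa using ext1_mem_oldIdeal ih
  induction k, hk using Nat.le_induction with
  | base => exact (hB.centralizerAlg_eq hb hM).le
  | succ k hk ih =>
    intro x hx
    have h1 := oldIdeal_succ_le (A := generatedAlg l (k + 1) m b)
      (fun x hx => ext1_mem_generatedAlg le_rfl hk (ih hx))
      (fun h => Algebra.subset_adjoin (Or.inl ⟨k, h, Nat.lt_succ_self k, rfl⟩))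
    have h2 := mul_mem_oldIdeal hx (hone k hk)
    rw [mul_one] at h2
    exact h1 h2

/-- The child of b_m has trace 2 d_m - d_{m-1} = 0. -/
lemma BranchData.rel_f (hB : BranchData G l R ν)
    (hb : ∀ j, R j → IsProjectionOnto (ν j) (l + j) (b j))
    (hM : R m) (hm1 : 1 ≤ m) (hm : EndsAt G l m ν) (hN : l + m < N) :
    embed (l + m) N (b m) = (((ν (m - 1)).dim : ℂ) / (ν m).dim) •
      (embed (l + m) N (b m) * tl N (l + m) * embed (l + m) N (b m)) := by
  obtain ⟨m, rfl⟩ := Nat.exists_eq_add_of_le' hm1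
  have h2 : l + m + 2 ≤ N := by omega
  have hR := hB.down m (m + 1) (Nat.le_succ m) hM
  have hP := hB.isParent hb hM
  have hbm := hb (m + 1) hM
  have hd : (2 : ℂ) * (ν (m + 1)).dim = (ν m).dim := by exact_mod_cast hm.dim
  have h0 : child (k := l + m) (b (m + 1)) (b m) = 0 := by
    refine eq_zero_of_trace (hP.child_idem hbm.mem hbm.idem) ?_
    rw [trace_child (k := l + m) hbm.idem (b m) (hB.ne_zero hb hM), hB.trace_eq hb hM,
      hB.trace_eq hb hR, hd, sub_self]
  rw [child, hB.trace_eq hb hM, hB.trace_eq hb hR] at h0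
  have h3 := congrArg (embedHom h2) (sub_eq_zero.mp h0)
  rw [map_smul, map_mul, map_mul, ← tl_eq_embed, embedHom_trans] at h3
  exact h3

end McKay

namespace McKay

/-! ### The groups of each type -/

section
variable {t : GroupType} {G : Subgroup SU2} {ν : ℕ → Irrep G}

lemma InRange.of_le {i k : ℕ} (h : InRange t k) (hik : i ≤ k) : InRange t i := by
  have h1 : (i : ℕ∞) ≤ k := by exact_mod_cast hik
  exact ⟨h1.trans h.1, fun ht hi => h.2 ht (le_antisymm h.1 (hi ▸ h1))⟩

lemma BranchData.of_inRange (hS : ∀ k ≤ br t, SymIrred G k) (h0 : InRange t (br t))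
    (hν : IsBranchPath t ν)
    (hF : ∀ j, InRange t (br t + j) → ∃ n ≤ 2, ∃ c : Fin n → TensorEnd (br t + j),
      Fam G (br t + j) c)
    (hd : ∀ j, InRange t (br t + (j + 2)) →
      (ν j).dim + (ν (j + 2)).dim = 2 * (ν (j + 1)).dim) :
    BranchData G (br t) (fun j => InRange t (br t + j)) ν :=
  ⟨hS, h0, fun _ _ hij h => h.of_le (Nat.add_le_add_left hij _), fun j hj => hν.new j hj.1,
    fun j hj => hν.edge j hj.1, hF, hd⟩

end

section
variable {ζ : Circle} {k : ℕ} (u : SU2)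

lemma exists_fam_cyclic (hζ : ∀ j, 1 ≤ j → j ≤ k → ζ ^ (2 * j) ≠ 1) :
    ∃ n ≤ 2, ∃ c : Fin n → TensorEnd k,
      Fam ((Subgroup.closure {diagElt ζ}).map (MulAut.conj u).toMonoidHom) k c ∧
        ∀ i, (c i).trace = 1 := by
  cases k with
  | zero =>
    refine ⟨1, by norm_num, _, (jw_fam fun k hk => ?_).conj u, fun i => ?_⟩
    · rw [Nat.le_zero.mp hk]
      exact symIrred_zero _
    · rw [trace_conjBy, jw_zero, Matrix.trace_one]
      simp
  | succ k => exact ⟨2, le_rfl, _, (fam_cyc k hζ).conj u, fun i => by rw [trace_conjBy, trace_cyc]⟩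

lemma branchData_cyclic {t : GroupType} (hbr : br t = 0) (h0 : InRange t 0)
    (hζ : ∀ k, InRange t k → ∀ j, 1 ≤ j → j ≤ k → ζ ^ (2 * j) ≠ 1)
    {ν : ℕ → Irrep ((Subgroup.closure {diagElt ζ}).map (MulAut.conj u).toMonoidHom)}
    (hν : IsBranchPath t ν) : BranchData _ (br t) (fun j => InRange t (br t + j)) ν := by
  have hd : ∀ j, InRange t (br t + j) → (ν j).dim = 1 := by
    intro j hj
    obtain ⟨n, -, c, hc, htr⟩ := exists_fam_cyclic u (hζ _ hj)
    obtain ⟨i, -, -, h⟩ := hc.exists_projection (hν.new j hj.1)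
    rw [htr] at h
    exact_mod_cast h.symm
  refine BranchData.of_inRange (fun k hk => ?_) (hbr ▸ h0) hν (fun j hj => ?_) fun j hj => ?_
  · obtain rfl : k = 0 := by omega
    exact symIrred_zero _
  · obtain ⟨n, hn, c, hc, -⟩ := exists_fam_cyclic u (hζ _ hj)
    exact ⟨n, hn, c, hc⟩
  · rw [hd j (hj.of_le (by omega)), hd (j + 1) (hj.of_le (by omega)), hd (j + 2) hj]

lemma branchData_dihedral {t : GroupType} (hbr : br t = 1) (h1 : InRange t 1)
    (hζ : ∀ k, InRange t k → ∀ j, 1 ≤ j → j ≤ k → ζ ^ (2 * j) ≠ 1)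
    {ν : ℕ → Irrep ((Subgroup.closure {diagElt ζ, quatK}).map (MulAut.conj u).toMonoidHom)}
    (hν : IsBranchPath t ν) : BranchData _ (br t) (fun j => InRange t (br t + j)) ν := by
  have hS : ∀ k ≤ 1, SymIrred ((Subgroup.closure {diagElt ζ, quatK}).map
      (MulAut.conj u).toMonoidHom) k := fun k hk =>
    (symIrred_one_dih (hζ 1 h1 1 le_rfl le_rfl) k hk).conj u
  have hν' : ∀ j, InRange t (j + 1) → IsNew (ν j) (j + 1) := fun j hj => by
    have h2 := hν.new j (by rw [hbr, Nat.add_comm]; exact hj.1)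
    rwa [hbr, Nat.add_comm] at h2
  have h3 : ∀ j, InRange t (j + 3) → (ν (j + 2)).dim = 2 := by
    intro j hj
    obtain ⟨i, -, -, h⟩ := ((fam_dih j (hζ _ hj)).conj u).exists_projection (hν' (j + 2) hj)
    rw [trace_conjBy, trace_dih] at h
    exact_mod_cast h.symm
  have d0 : (ν 0).dim = 2 := dim_zero hS (hν' 0 h1)
  -- At level 2 the new dimensions are 2 and 1. The path goes on to a module of dimension 2, and the
  -- child of the one-dimensional node is zero.
  have d1 : InRange t 3 → (ν 1).dim = 2 := by
    intro hr
    obtain ⟨hF, hz⟩ := fam_dih_two (hζ 2 (hr.of_le (by norm_num)))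
    have hp : ∀ i, IsParent ((Subgroup.closure {diagElt ζ, quatK}).map
        (MulAut.conj u).toMonoidHom) 1 (jw 1) (conjBy u 2 (![dih 2, jw 2 - dih 2] i)) := fun i =>
      (jw_fam hS).isParent 0 (by rw [jw_one, map_one, one_mul]) (by rw [jw_one, map_one, mul_one])
    have hE : Edge (ν 1) (ν 2) := hν.edge 1 (by rw [hbr]; exact hr.1)
    obtain ⟨i, hi, -, n, hn, hdn, -⟩ := (hF.conj u).dim_edge hp
      (hν' 1 (hr.of_le (by norm_num))) (hν' 2 hr) hE
    have hc0 : conjBy u 2 (![dih 2, jw 2 - dih 2] i) ≠ 0 := fun h0 => by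
      rw [h0, Matrix.trace_zero] at hi
      exact (ν 1).dim_ne_zero (by exact_mod_cast hi.symm)
    rw [trace_child ((hF.conj u).idem i) _ hc0, hi, jw_one, Matrix.trace_one] at hn
    have h4 : 2 * (ν 1).dim = n + 2 := by
      have : (2 : ℂ) * (ν 1).dim = n + 2 := by
        rw [← hn]
        simp
      exact_mod_cast this
    have h5 := h3 0 hr
    have h6 : (ν 1).dim ≤ 2 := by
      rw [trace_conjBy] at hi
      fin_cases i
      · refine le_of_eq ?_
        have h7 := (trace_dih 2).symm.trans hi
        exact_mod_cast h7.symm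
      · have h7 := hz.symm.trans hi
        have : (ν 1).dim = 1 := by exact_mod_cast h7.symm
        omega
    rw [zero_add] at h5
    omega
  have hd : ∀ j i, i ≤ j + 2 → InRange t (j + 3) → (ν i).dim = 2 := by
    intro j i hi hj
    match i, hi with
    | 0, _ => exact d0
    | 1, _ => exact d1 (hj.of_le (by omega))
    | i + 2, hi => exact h3 i (hj.of_le (by omega))
  have hF : ∀ k, 1 ≤ k → InRange t k → ∃ n ≤ 2, ∃ c : Fin n → TensorEnd k,
      Fam ((Subgroup.closure {diagElt ζ, quatK}).map (MulAut.conj u).toMonoidHom) k c := by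
    intro k hk hr
    match k, hk, hr with
    | 1, _, _ => exact ⟨1, by norm_num, _, jw_fam hS⟩
    | 2, _, hr => exact ⟨2, le_rfl, _, (fam_dih_two (hζ 2 hr)).1.conj u⟩
    | k + 3, _, hr => exact ⟨1, by norm_num, _, (fam_dih k (hζ _ hr)).conj u⟩
  refine BranchData.of_inRange (by rwa [hbr]) (hbr ▸ h1) hν (fun j hj => hF _ (by omega) hj)
    fun j hj => ?_
  have hj' : InRange t (j + 3) := by rwa [hbr, show 1 + (j + 2) = j + 3 by omega] at hj
  rw [hd j j (by omega) hj', hd j (j + 1) (by omega) hj', hd j (j + 2) le_rfl hj']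

end

/-- The order of ζ² is n/2 for even n and n for odd n. This is the diameter, at which the two
extreme weights coincide; hence its exclusion. -/
lemma InRange.pow_ne_one_cyclic {n k : ℕ} (hn : 3 ≤ n) {ζ : Circle} (hζ : IsPrimitiveRoot ζ n)
    (hk : InRange (.cyclic n) k) (j : ℕ) (hj : 1 ≤ j) (hjk : j ≤ k) : ζ ^ (2 * j) ≠ 1 := by
  intro h
  rw [hζ.pow_eq_one_iff_dvd] at h
  obtain ⟨h1, h2⟩ := hk
  have h2 := h2 trivial
  rw [diam] at h1 h2
  split_ifs at h1 h2 with he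
  · have h1 : k ≤ n / 2 := by exact_mod_cast h1
    have h2 : k ≠ n / 2 := by exact_mod_cast h2
    have := Nat.le_of_dvd (by omega) h
    omega
  · have h1 : k ≤ n := by exact_mod_cast h1
    have h2 : k ≠ n := by exact_mod_cast h2
    have h3 : n ∣ j := (Nat.Coprime.dvd_mul_left
      ((Nat.coprime_two_right).mpr (Nat.not_even_iff_odd.mp he))).mp h
    have := Nat.le_of_dvd (by omega) h3
    omega

lemma inRange_cyclic_zero {n : ℕ} (hn : 3 ≤ n) : InRange (.cyclic n) 0 := by
  refine ⟨by simp, fun _ h => ?_⟩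
  rw [diam] at h
  split_ifs at h with he
  · have h : 0 = n / 2 := by exact_mod_cast h
    omega
  · have h : 0 = n := by exact_mod_cast h
    omega

lemma inRange_dihedral {n k : ℕ} : InRange (.dihedral n) k ↔ k < n := by
  have h1 : InRange (.dihedral n) k ↔ k ≤ n ∧ k ≠ n := by
    simp [InRange, diam, IsFiniteCD]
  rw [h1, lt_iff_le_and_ne]

lemma inRange_cyclicInf (k : ℕ) : InRange .cyclicInf k := ⟨le_top, fun h => h.elim⟩

lemma inRange_dihedralInf (k : ℕ) : InRange .dihedralInf k := ⟨le_top, fun h => h.elim⟩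

lemma inRange_tetrahedral (j : ℕ) : InRange .tetrahedral (br .tetrahedral + j) ↔ j ≤ 2 := by
  have h : InRange .tetrahedral (2 + j) ↔ ((2 + j : ℕ) : ℕ∞) ≤ ((4 : ℕ) : ℕ∞) :=
    and_iff_left fun h => h.elim
  refine h.trans ?_
  rw [Nat.cast_le]
  omega

lemma inRange_octahedral (j : ℕ) : InRange .octahedral (br .octahedral + j) ↔ j ≤ 3 := by
  have h : InRange .octahedral (3 + j) ↔ ((3 + j : ℕ) : ℕ∞) ≤ ((6 : ℕ) : ℕ∞) :=
    and_iff_left fun h => h.elim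
  refine h.trans ?_
  rw [Nat.cast_le]
  omega

lemma inRange_icosahedral (j : ℕ) : InRange .icosahedral (br .icosahedral + j) ↔ j ≤ 2 := by
  have h : InRange .icosahedral (5 + j) ↔ ((5 + j : ℕ) : ℕ∞) ≤ ((7 : ℕ) : ℕ∞) :=
    and_iff_left fun h => h.elim
  refine h.trans ?_
  rw [Nat.cast_le]
  omega

lemma symIrred_of_isOfType {t : GroupType} {G : Subgroup SU2} (hG : IsOfType t G) :
    ∀ k ≤ br t, SymIrred G k := by
  obtain ⟨S, u, hS, rfl⟩ := hG
  cases t with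
  | cyclic n => intro k hk; rw [Nat.le_zero.mp hk]; exact symIrred_zero _
  | cyclicInf => intro k hk; rw [Nat.le_zero.mp hk]; exact symIrred_zero _
  | dihedral n =>
    obtain ⟨hn, ζ, hζ, rfl⟩ := hS
    refine fun k hk => (symIrred_one_dih (fun h => ?_) k hk).conj u
    rw [hζ.pow_eq_one_iff_dvd] at h
    have := Nat.le_of_dvd (by norm_num) h
    omega
  | dihedralInf =>
    obtain ⟨ζ, hζ, rfl⟩ := hS
    exact fun k hk => (symIrred_one_dih (hζ 2 (by norm_num)) k hk).conj u
  | tetrahedral => rw [show S = _ from hS]; exact (splitsAt_tetrahedral.conj u).symIrred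
  | octahedral => rw [show S = _ from hS]; exact (splitsAt_octahedral.conj u).symIrred
  | icosahedral => rw [show S = _ from hS]; exact (splitsAt_icosahedral.conj u).symIrred

lemma branchData_of_isOfType {t : GroupType} {G : Subgroup SU2} (hG : IsOfType t G)
    {ν : ℕ → Irrep G} (hν : IsBranchPath t ν) :
    BranchData G (br t) (fun j => InRange t (br t + j)) ν ∧
      ∀ m : ℕ, ¬ IsFiniteCD t → diam t = ((br t + m : ℕ) : ℕ∞) → 1 ≤ m ∧ EndsAt G (br t) m ν := by
  obtain ⟨S, u, hS, rfl⟩ := hG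
  cases t with
  | cyclic n =>
    obtain ⟨hn, ζ, hζ, rfl⟩ := hS
    exact ⟨branchData_cyclic u rfl (inRange_cyclic_zero hn)
      (fun k hk => hk.pow_ne_one_cyclic hn hζ) hν, fun m hm => (hm trivial).elim⟩
  | cyclicInf =>
    obtain ⟨ζ, hζ, rfl⟩ := hS
    exact ⟨branchData_cyclic u rfl (inRange_cyclicInf 0) (fun k _ j hj _ => hζ _ (by omega)) hν,
      fun m _ hm => (ENat.natCast_ne_top _ hm.symm).elim⟩
  | dihedral n =>
    obtain ⟨hn, ζ, hζ, rfl⟩ := hS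
    refine ⟨branchData_dihedral u rfl (inRange_dihedral.mpr (by omega)) (fun k hk j hj hjk h => ?_)
      hν, fun m hm => (hm trivial).elim⟩
    rw [hζ.pow_eq_one_iff_dvd] at h
    have := Nat.le_of_dvd (by omega) h
    have := inRange_dihedral.mp hk
    omega
  | dihedralInf =>
    obtain ⟨ζ, hζ, rfl⟩ := hS
    exact ⟨branchData_dihedral u rfl (inRange_dihedralInf 1) (fun k _ j hj _ => hζ _ (by omega)) hν,
      fun m _ hm => (ENat.natCast_ne_top _ hm.symm).elim⟩
  | tetrahedral =>
    obtain rfl : S = _ := hS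
    have h := (splitsAt_tetrahedral.conj u).tetrahedral
      (fun j hj => hν.new j ((inRange_tetrahedral j).mpr hj).1)
      (fun j hj => hν.edge j ((inRange_tetrahedral (j + 1)).mpr hj).1)
    refine ⟨by simp only [inRange_tetrahedral]; exact h.1, fun m _ hm => ?_⟩
    have hm : 4 = 2 + m := by exact_mod_cast (show ((4 : ℕ) : ℕ∞) = ((2 + m : ℕ) : ℕ∞) from hm)
    obtain rfl : m = 2 := by omega
    exact ⟨by norm_num, h.2⟩
  | octahedral =>
    obtain rfl : S = _ := hS
    have h := (splitsAt_octahedral.conj u).octahedral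
      (fun j hj => hν.new j ((inRange_octahedral j).mpr hj).1)
      (fun j hj => hν.edge j ((inRange_octahedral (j + 1)).mpr hj).1)
    refine ⟨by simp only [inRange_octahedral]; exact h.1, fun m _ hm => ?_⟩
    have hm : 6 = 3 + m := by exact_mod_cast (show ((6 : ℕ) : ℕ∞) = ((3 + m : ℕ) : ℕ∞) from hm)
    obtain rfl : m = 3 := by omega
    exact ⟨by norm_num, h.2⟩
  | icosahedral =>
    obtain rfl : S = _ := hS
    have h := (splitsAt_icosahedral.conj u).icosahedral
      (fun j hj => hν.new j ((inRange_icosahedral j).mpr hj).1)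
      (fun j hj => hν.edge j ((inRange_icosahedral (j + 1)).mpr hj).1)
    refine ⟨by simp only [inRange_icosahedral]; exact h.1, fun m _ hm => ?_⟩
    have hm : 7 = 5 + m := by exact_mod_cast (show ((7 : ℕ) : ℕ∞) = ((5 + m : ℕ) : ℕ∞) from hm)
    obtain rfl : m = 2 := by omega
    exact ⟨by norm_num, h.2⟩

end McKay

end

theorem mainTheorem7 (t : McKay.GroupType) (G : Subgroup McKay.SU2) (hG : McKay.IsOfType t G) :
    -- part (i)
    (∀ k : ℕ, k ≤ McKay.br t →
      McKay.centralizerAlg G k = McKay.temperleyLieb k ∧ McKay.RelA k) ∧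
    ∀ ν : ℕ → McKay.Irrep G, McKay.IsBranchPath t ν →
      -- the projections are well defined
      (∀ j : ℕ, McKay.InRange t (McKay.br t + j) →
        ∃! b : McKay.TensorEnd (McKay.br t + j),
          McKay.IsProjectionOnto (ν j) (McKay.br t + j) b) ∧
      ∀ b : (j : ℕ) → McKay.TensorEnd (McKay.br t + j),
        (∀ j : ℕ, McKay.InRange t (McKay.br t + j) →
          McKay.IsProjectionOnto (ν j) (McKay.br t + j) (b j)) →
        -- part (ii), with `k = ℓ + M`
        (∀ M : ℕ, 1 ≤ M → McKay.InRange t (McKay.br t + M) →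
          McKay.centralizerAlg G (McKay.br t + M) =
            McKay.generatedAlg (McKay.br t) (McKay.br t + M) M b ∧
          ∀ N : ℕ, McKay.br t + M ≤ N →
            McKay.RelA N ∧ McKay.RelBE (McKay.br t) N M (fun j => (ν j).dim) b) ∧
        -- part (iii)
        (∀ m k : ℕ, ¬ McKay.IsFiniteCD t →
          McKay.diam t = ((McKay.br t + m : ℕ) : ℕ∞) → McKay.br t + m < k →
          McKay.centralizerAlg G k = McKay.generatedAlg (McKay.br t) k m b ∧
          ∀ N : ℕ, k ≤ N →
            McKay.RelA N ∧ McKay.RelBE (McKay.br t) N m (fun j => (ν j).dim) b ∧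
            McKay.embed (McKay.br t + m) N (b m) =
              (((ν (m - 1)).dim : ℂ) / ((ν m).dim : ℂ)) •
                (McKay.embed (McKay.br t + m) N (b m) * McKay.tl N (McKay.br t + m) *
                  McKay.embed (McKay.br t + m) N (b m))) := by
  have hS := McKay.symIrred_of_isOfType hG
  refine ⟨fun k hk => ⟨McKay.centralizerAlg_eq_temperleyLieb fun j hj => hS j (hj.trans hk),
    McKay.relA k⟩, fun ν hν => ?_⟩
  obtain ⟨hB, hE⟩ := McKay.branchData_of_isOfType hG hν
  refine ⟨fun j hj => hB.existsUnique hj, fun b hb => ⟨fun M _ hM =>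
    ⟨hB.centralizerAlg_eq hb hM, fun N hN => ⟨McKay.relA N, hB.relBE hb hM hN⟩⟩,
    fun m k ht hm hk => ?_⟩⟩
  obtain ⟨hm1, hend⟩ := hE m ht hm
  -- The diameter itself is in range because the type is not a finite cyclic or dihedral one.
  have hM : McKay.InRange t (McKay.br t + m) := ⟨hm.ge, fun h => absurd h ht⟩
  exact ⟨hB.centralizerAlg_eq_of_endsAt hb hM hend hk.le, fun N hN => ⟨McKay.relA N,
    hB.relBE hb hM (hk.le.trans hN), hB.rel_f hb hM hm1 hend (hk.trans_le hN)⟩⟩
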